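/- **Notation.** Let $\hat H_T=\mathbb C[T,T^{-1},\partial]$ be the commutative Hopf algebra with $T$ group-like and $\partial$ primitive (counit $\varepsilon$, antipode $S$), and $H_T=\mathbb C[T,T^{-1}]$. Put $\Delta=T-1$, $\bar\Delta=1-T^{-1}$, $\Delta[n]=\Delta^n/n!$ for $n\ge 0$, $\Delta[-n]=\bar\Delta^n/n!$ for $n>0$. The elements $e_{n,k}=\Delta[n]\,\partial^k/k!$ ($n\in\mathbb Z$, $k\ge 0$) form a basis of $\hat H_T$; let $e^*_{n,k}\in\hat H_T^*$ be the dual functionals. Let $K$ be the localization of $\mathbb C[\tau]$ at the products of the $\tau+n$, $n\in\mathbb Z$. $\hat H_T$ acts on $K$ by $(TF)(\tau)=F(\tau+1)$, $\partial=d/d\tau$. With $\alpha(h)=S(h)\frac1\tau$, $K_{\rm Sing}=\alpha(\hat H_T)$, one has $K=\mathbb C[\tau]\oplus K_{\rm Sing}$ with $\alpha$ injective; $\mathrm{Tr}:K\to\mathbb C$ is $\mathrm{Tr}(p+\alpha(h))=\varepsilon(h)$ (the sum of the residues at the integers). Let $\hat K=\bigl(\bigoplus\mathbb C e^*_{n,k}\bigr)\oplus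 K_{\rm Sing}$, and $\tau(\ell)=\tau(\tau-1)\cdots(\tau-\ell+1)$. A $W$-valued distribution is a linear map $D:K\to W$, and $(GD)(F)=D(GF)$ for $F,G\in K$. It is *rational* if for some $\kappa=\sum w_i\otimes h_i\in W\otimes\hat H_T$ one has $D(p)=\sum\mathrm{Tr}(\alpha(h_i)p)\,w_i$ for all $p\in\mathbb C[\tau]$; then $\kappa=:\kappa(D)$ is unique, and for a functional $\varphi\in\hat H_T^*$ one puts $D(\varphi)=\sum\varphi(h_i)w_i$. So $D(F)$ is defined for $F\in K$ and $F\in\hat K$. On functionals put $(h\varphi)(h')=\varphi(hh')$, $\varphi^-=\varphi\circ S$; for $F\in K$ put $F^-(\tau)=F(-\tau)$. A *field* on a vector space $V$ is a distribution $f=f(\tau):K\to\mathrm{End}(V)$ such that $f(\tau)v$ is rational for each $v\in V$; $f_{\{F\}}\in\mathrm{End}(V)$ is $v\mapsto (f(\tau)v)(F)$. The normal ordered product of the fields $f,g$ is the distribution $$\bigl(f(\tau)_{\{F\}}g(\tau)\bigr)(G)\,v=\sum_i \bigl(f(\tau)w_i\bigr)(S(h_i)F)-\sum_j\bigl(G\,g(\tau)w'_j\bigr)\bigl((h'_jF)^-\bigr),$$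 where $\kappa(G\,g(\tau)v)=\sum w_i\otimes h_i$ and $\kappa(f(\tau)v)=\sum w'_j\otimes h'_j$. (This is $\mathrm{Tr}_{\tau_1}\bigl(f(\tau_1)g(\tau_2)F(\tau_1-\tau_2)-g(\tau_2)f(\tau_1)F(\tau_1-\tau_2)\bigr)$, with $F(\tau_1-\tau_2)$ expanded in $\tau_2$ in the first and in $\tau_1$ in the second term.) The commutator $[f(\tau_1),g(\tau_2)]$ is the distribution $A\otimes B\mapsto f(A)g(B)-g(B)f(A)$ on $K\otimes K$; $f,g$ are *mutually rational* if it is killed by multiplication by $p(\tau_1-\tau_2)$ for some nonzero polynomial $p$. For a distribution $D$ and $h\in\hat H_T$, $D(\tau_2)h_2\delta(\tau_1,\tau_2)$ is the distribution $A\otimes B\mapsto D(h(A)B)$ on $K\otimes K$. **Definition.** An $H_T$-vertex algebra is a complex vector space $V$ with a vector $1_V$ and a linear map $f\mapsto Y(f,\tau)$ from $V$ to the fields on $V$ (also written $f(\tau)$) such that (i) $Y(1_V,\tau)$ is the identity field $F\mapsto\mathrm{Tr}(F)\,\mathrm{id}_V$; $Y(f,\tau)1_V$ vanishes on $\mathbb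 C[\tau]$ and has value $f$ at $\frac1\tau$; (ii) the operators $h_Vf=f_{\{\alpha(h)\}}1_V$, $h\in\hat H_T$, make $V$ an $\hat H_T$-module; (iii) $Y(h_Vf,\tau)(F)=Y(f,\tau)(S(h)F)$ for $h\in H_T$, $F\in K$; (iv) $Y(f,\tau)g=\mathcal R_V(\tau)\,Y^S(g,\tau)f$, where $Y^S(g,\tau)$ is the distribution $F\mapsto -Y(g,\tau)(F^-)$ with kernel $Y(g,-\tau)$, and the exponential operator $\mathcal R_V(\tau)=\sum_{n,k}(e_{n,k})_V\,e^*_{n,k}$ acts by $(\mathcal R_V(\tau)D)(G)=\sum (h_i)_Vw_i$ if $\kappa(GD)=\sum w_i\otimes h_i$; (v) all $Y(f,\tau)$, $Y(g,\tau)$ are mutually rational. **Statement.** Let $V$ be an $H_T$-vertex algebra. 1. For $f,g\in V$ and $F\in\hat K$ or $F\in K$ (or a sum of such): $Y(f_{\{F\}}g,\tau)=f(\tau)_{\{F\}}g(\tau)$. 2. For $f^1,\dots,f^k\in V$ and $F_1,\dots,F_k$ as in 1, $$Y\bigl(f^1_{\{F_1\}}f^2_{\{F_2\}}\cdots f^k_{\{F_k\}}1_V,\tau\bigr)=f^1(\tau)_{\{F_1\}}f^2(\tau)_{\{F_2\}}\cdots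 f^k(\tau)_{\{F_k\}}Y(1_V,\tau),$$ with products formed from right to left. 3. For $f,g\in V$ only finitely many $f_{\{e^*_{n,k}\}}g$ are nonzero, and on $K\otimes K$ $$[Y(f,\tau_1),Y(g,\tau_2)]=\sum_{n,k}Y\bigl(f_{\{e^*_{n,k}\}}g,\tau_2\bigr)(e_{n,k})_2\,\delta(\tau_1,\tau_2)\qquad\text{(a finite sum).}$$ Moreover $$[Y(f,\tau_1),Y(g,\tau_2)]=\sum_{\ell\ge0}Y\bigl(f_{\{\tau(\ell)\}}g,\tau_2\bigr)\Delta[\ell]_2\,\delta(\tau_1,\tau_2)\qquad\text{(in general an infinite sum)}$$ as distributions on $\mathbb C[\tau_1]\otimes K$, i.e. at each $p\otimes B$ with $p\in\mathbb C[\tau]$, $B\in K$ only finitely many terms are nonzero and their sum is the value of the commutator; if only finitely many $f_{\{\tau(\ell)\}}g$ are nonzero, the identity holds on all of $K\otimes K$. -/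

import Mathlib

open Polynomial TensorProduct

namespace HTVertex

noncomputable section

/-- The multiplicative set generated by the translates `τ + n`, `n ∈ ℤ`. -/
def translates : Submonoid ℂ[X] := Submonoid.closure (Set.range fun n : ℤ => X + C (n : ℂ))

/-- The localization `K = M⁻¹ ℂ[τ]`. -/
abbrev K : Type := Localization translates

/-- A polynomial (sequence) regarded as an element of `K`. -/
def ofPoly : ℂ[X] →ₐ[ℂ] K := IsScalarTower.toAlgHom ℂ ℂ[X] K

/-- The element `τ` of `K`. -/
def tau : K := ofPoly X

/-- The algebra homomorphism out of `K` with `τ ↦ b`, where all `b + n` are units. -/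
def liftK {B : Type*} [CommRing B] [Algebra ℂ B] (b : B)
    (hb : ∀ n : ℤ, IsUnit (b + algebraMap ℂ B n)) : K →ₐ[ℂ] B :=
  IsLocalization.liftAlgHom (M := translates) (f := aeval b) (by
    rintro ⟨y, hy⟩
    show IsUnit (aeval b y)
    have : translates ≤ (IsUnit.submonoid B).comap (aeval b : ℂ[X] →ₐ[ℂ] B) := by
      rw [translates, Submonoid.closure_le]
      rintro _ ⟨n, rfl⟩
      have := hb n
      simpa [IsUnit.mem_submonoid_iff] using this
    exact this hy)

theorem liftK_ofPoly {B : Type*} [CommRing B] [Algebra ℂ B] (b : B)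
    (hb : ∀ n : ℤ, IsUnit (b + algebraMap ℂ B n)) (p : ℂ[X]) :
    liftK b hb (ofPoly p) = aeval b p := by
  simp [liftK, ofPoly, IsLocalization.liftAlgHom]

theorem liftK_tau {B : Type*} [CommRing B] [Algebra ℂ B] (b : B)
    (hb : ∀ n : ℤ, IsUnit (b + algebraMap ℂ B n)) : liftK b hb tau = b := by
  rw [tau, liftK_ofPoly, aeval_X]

theorem isUnit_tau_add (n : ℤ) : IsUnit (tau + algebraMap ℂ K n) := by
  have h : X + C (n : ℂ) ∈ translates := Submonoid.subset_closure ⟨n, rfl⟩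
  have := IsLocalization.map_units K (⟨_, h⟩ : translates)
  have e : tau + algebraMap ℂ K n = algebraMap ℂ[X] K (X + C (n : ℂ)) := by
    rw [map_add]; rfl
  rw [e]; exact this

theorem algHom_ext_tau {B : Type*} [CommRing B] [Algebra ℂ B] {f g : K →ₐ[ℂ] B}
    (h : f tau = g tau) : f = g := by
  apply IsLocalization.algHom_ext translates
  apply Polynomial.algHom_ext
  exact h

/-- The translation `Tⁿ` of `K`: `(Tⁿ F)(τ) = F(τ + n)`. -/
def shift (n : ℤ) : K →ₐ[ℂ] K :=
  liftK (tau + algebraMap ℂ K n) fun m => by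
    have := isUnit_tau_add (n + m)
    rwa [Int.cast_add, map_add, ← add_assoc] at this

/-- The antipodal homomorphism of `K`: `(S F)(τ) = F(-τ)`. -/
def antipodeK : K →ₐ[ℂ] K :=
  liftK (-tau) fun m => by
    have := (isUnit_tau_add (-m)).neg
    rwa [Int.cast_neg, map_neg, neg_add, neg_neg] at this

/-- `F ↦ F(τ + ε)`, with `ε² = 0`. -/
def taylorK : K →ₐ[ℂ] TrivSqZeroExt K K :=
  liftK (TrivSqZeroExt.inl tau + TrivSqZeroExt.inr (1 : K)) fun m => by
    rw [TrivSqZeroExt.isUnit_iff_isUnit_fst]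
    have := isUnit_tau_add m
    simpa [TrivSqZeroExt.algebraMap_eq_inl'] using this

/-- The derivation `∂_τ` of `K`. -/
def derivK : K →ₗ[ℂ] K := (TrivSqZeroExt.sndHom K K).restrictScalars ℂ ∘ₗ taylorK.toLinearMap

theorem fst_taylorK (F : K) : (taylorK F).fst = F := by
  have : (TrivSqZeroExt.fstHom ℂ K K).comp taylorK = AlgHom.id ℂ K := by
    apply algHom_ext_tau
    simp [taylorK, liftK_tau]
  exact DFunLike.congr_fun this F

theorem derivK_mul (F G : K) : derivK (F * G) = F * derivK G + G * derivK F := by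
  simp [derivK, fst_taylorK, mul_comm]

theorem derivK_one : derivK 1 = 0 := by
  simp [derivK]

theorem derivK_tau : derivK tau = 1 := by
  simp [derivK, taylorK, liftK_tau]

theorem shift_zero : shift 0 = AlgHom.id ℂ K := by
  apply algHom_ext_tau; simp [shift, liftK_tau]

theorem shift_add (m n : ℤ) : shift (m + n) = (shift m).comp (shift n) := by
  apply algHom_ext_tau; simp [shift, liftK_tau]; ring

theorem taylorK_eq (F : K) : taylorK F = TrivSqZeroExt.inl F + TrivSqZeroExt.inr (derivK F) := by
  ext <;> simp [fst_taylorK, derivK]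

theorem derivK_shift (n : ℤ) (F : K) : derivK (shift n F) = shift n (derivK F) := by
  let e : DualNumber K →ₐ[ℂ] DualNumber K := DualNumber.lift
    ⟨((TrivSqZeroExt.inlAlgHom ℂ K K).comp (shift n), DualNumber.eps),
      DualNumber.eps_mul_eps, fun a => DualNumber.commute_eps_left _⟩
  have he : ∀ x : DualNumber K, e x =
      TrivSqZeroExt.inl (shift n x.fst) + TrivSqZeroExt.inl (shift n x.snd) * DualNumber.eps :=
    fun x => DualNumber.lift_apply_apply _ _
  have h : taylorK.comp (shift n) = e.comp taylorK := by
    refine algHom_ext_tau (B := TrivSqZeroExt K K) ?_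
    simp only [AlgHom.comp_apply, he, taylorK_eq, derivK_tau]
    have h1 : shift n tau = tau + algebraMap ℂ K n := liftK_tau _ _
    have h2 : derivK (algebraMap ℂ K n) = 0 := by
      rw [Algebra.algebraMap_eq_smul_one, map_smul, derivK_one, smul_zero]
    have h4 : derivK (n : K) = 0 := by simpa using h2
    ext <;> simp [h1, h4, derivK_tau]
  have h3 := congrArg TrivSqZeroExt.snd (DFunLike.congr_fun h F)
  simpa [he, taylorK_eq] using h3

/-- `Ĥ_T = ℂ[T, T⁻¹, ∂]`, the element `Tⁿ ∂ᵏ` being `single (n, k) 1`. -/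
abbrev HatHT : Type := AddMonoidAlgebra ℂ (ℤ × ℕ)

/-- The group-like element `Tⁿ`. -/
def T (n : ℤ) : HatHT := AddMonoidAlgebra.single (n, 0) 1

/-- The primitive element `∂_τ`. -/
def del : HatHT := AddMonoidAlgebra.single (0, 1) 1

/-- The subalgebra `H_T = ℂ[T, T⁻¹]`. -/
def HT : Subalgebra ℂ HatHT := Algebra.adjoin ℂ (Set.range T)

/-- The antipode `S`: `T ↦ T⁻¹`, `∂ ↦ -∂`. -/
def antipode : HatHT →ₐ[ℂ] HatHT :=
  AddMonoidAlgebra.lift ℂ HatHT (ℤ × ℕ)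
    { toFun := fun p => AddMonoidAlgebra.single (-p.toAdd.1, p.toAdd.2) ((-1) ^ p.toAdd.2)
      map_one' := by simp [AddMonoidAlgebra.one_def, Prod.zero_eq_mk]
      map_mul' := fun p q => by
        simp [AddMonoidAlgebra.single_mul_single, pow_add, add_comm] }

/-- The counit `ε`: `T ↦ 1`, `∂ ↦ 0`. -/
def counit : HatHT →ₐ[ℂ] ℂ :=
  AddMonoidAlgebra.lift ℂ ℂ (ℤ × ℕ)
    { toFun := fun p => if p.toAdd.2 = 0 then 1 else 0
      map_one' := by simp
      map_mul' := fun p q => by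
        by_cases h : p.toAdd.2 = 0 <;> by_cases h' : q.toAdd.2 = 0 <;> simp [h, h'] }

/-- The action of `Ĥ_T` on `K`. -/
def actK : HatHT →ₐ[ℂ] Module.End ℂ K :=
  AddMonoidAlgebra.lift ℂ (Module.End ℂ K) (ℤ × ℕ)
    { toFun := fun p => (shift p.toAdd.1).toLinearMap * derivK ^ p.toAdd.2
      map_one' := by
        ext F; simp [shift_zero]
      map_mul' := fun p q => by
        have hc : Commute derivK (shift q.toAdd.1).toLinearMap := by
          ext F; exact derivK_shift _ _
        have hs : (shift (p.toAdd.1 + q.toAdd.1)).toLinearMap =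
            (shift p.toAdd.1).toLinearMap * (shift q.toAdd.1).toLinearMap := by
          rw [shift_add]; rfl
        simp only [toAdd_mul, Prod.fst_add, Prod.snd_add, hs, pow_add]
        have := (hc.pow_left p.toAdd.2).eq
        simp only [mul_assoc]
        rw [← mul_assoc (derivK ^ _) (AlgHom.toLinearMap _), this, mul_assoc] }

/-- The map `α : Ĥ_T → K_Sing`, `α(h) = S(h) (1/τ)`. -/
def alpha : HatHT →ₗ[ℂ] K := (LinearMap.applyₗ (Ring.inverse tau)) ∘ₗ actK.toLinearMap ∘ₗ antipode.toLinearMap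


/-- The element `1/(τ - n)`. -/
def pole (n : ℤ) : K := shift (-n) (Ring.inverse tau)

theorem mul_pole (n : ℤ) : (tau - algebraMap ℂ K n) * pole n = 1 := by
  have h : IsUnit tau := by simpa using isUnit_tau_add 0
  have h1 : shift (-n) tau = tau - algebraMap ℂ K n := by
    rw [shift, liftK_tau, Int.cast_neg, map_neg, sub_eq_add_neg]
  rw [pole, ← h1, ← map_mul, Ring.mul_inverse_cancel _ h, map_one]

theorem eq_pole {n : ℤ} {x : K} (h : (tau - algebraMap ℂ K n) * x = 1) : x = pole n := by
  calc x = x * ((tau - algebraMap ℂ K n) * pole n) := by rw [mul_pole, mul_one]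
    _ = ((tau - algebraMap ℂ K n) * x) * pole n := by ring
    _ = pole n := by rw [h, one_mul]

theorem derivK_algebraMap (c : ℂ) : derivK (algebraMap ℂ K c) = 0 := by
  rw [Algebra.algebraMap_eq_smul_one, map_smul, derivK_one, smul_zero]

theorem derivK_pole (n : ℤ) : derivK (pole n) = -pole n ^ 2 := by
  have h := congrArg derivK (mul_pole n)
  rw [derivK_mul, derivK_one, map_sub, derivK_tau, derivK_algebraMap, sub_zero, mul_one] at h
  have h2 := mul_pole n
  linear_combination pole n * h - (derivK (pole n)) * h2

theorem derivK_pow (F : K) (k : ℕ) : derivK (F ^ (k + 1)) = (k + 1) * F ^ k * derivK F := by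
  induction k with
  | zero => simp
  | succ k ih => rw [pow_succ, derivK_mul, ih]; push_cast; ring

theorem derivK_iter_pole (n : ℤ) (k : ℕ) :
    (derivK ^ k) (pole n) = ((-1) ^ k * (k.factorial : ℂ)) • pole n ^ (k + 1) := by
  induction k with
  | zero => simp
  | succ k ih =>
    rw [pow_succ', Module.End.mul_apply, ih, map_smul, derivK_pow, derivK_pole,
      Algebra.smul_def, Algebra.smul_def]
    simp only [map_mul, map_pow, map_neg, map_one, map_natCast, Nat.factorial_succ]
    push_cast
    ring

theorem alpha_single (n : ℤ) (k : ℕ) (c : ℂ) :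
    alpha (AddMonoidAlgebra.single (n, k) c) = (c * k.factorial) • pole n ^ (k + 1) := by
  have h1 : Ring.inverse tau = pole 0 := by simp [pole, shift_zero]
  simp only [alpha, antipode, actK, LinearMap.comp_apply, AlgHom.toLinearMap_apply,
    AddMonoidAlgebra.lift_single, h1]
  have h5 : shift (-n) (pole 0) = pole n := by rw [← h1, pole]
  simp [h5, derivK_iter_pole, smul_smul]
  rw [mul_assoc, ← mul_assoc _ _ (k.factorial : ℂ), ← mul_pow]; simp

/-- `(p, h) ↦ p + α(h)`. -/
def decompMap : (ℂ[X] × HatHT) →ₗ[ℂ] K := ofPoly.toLinearMap.coprod alpha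

theorem pole_pow_mem (n : ℤ) (k : ℕ) : pole n ^ (k + 1) ∈ LinearMap.range decompMap :=
  ⟨(0, AddMonoidAlgebra.single (n, k) ((k.factorial : ℂ)⁻¹)), by
    simp [decompMap, alpha_single, Nat.factorial_ne_zero]⟩

theorem ofPoly_mem (p : ℂ[X]) : ofPoly p ∈ LinearMap.range decompMap :=
  ⟨(p, 0), by simp [decompMap]⟩

theorem pole_pow_mul_mem (m n : ℤ) (k : ℕ) :
    pole m ^ (k + 1) * pole n ∈ LinearMap.range decompMap := by
  by_cases hmn : m = n
  · subst hmn
    rw [← pow_succ]; exact pole_pow_mem _ _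
  · have key : pole m * pole n = ((m - n : ℂ)⁻¹) • (pole m - pole n) := by
      have hne : (m - n : ℂ) ≠ 0 := sub_ne_zero.2 (by exact_mod_cast hmn)
      have h1 := mul_pole m
      have h2 := mul_pole n
      rw [eq_inv_smul_iff₀ hne, Algebra.smul_def, map_sub]
      linear_combination pole m * h2 - pole n * h1
    induction k with
    | zero =>
      rw [zero_add, pow_one, key]
      refine Submodule.smul_mem _ _ (Submodule.sub_mem _ ?_ ?_)
      · simpa using pole_pow_mem m 0
      · simpa using pole_pow_mem n 0
    | succ k ih =>
      have : pole m ^ (k + 1 + 1) * pole n =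
          ((m - n : ℂ)⁻¹) • (pole m ^ (k + 1 + 1) - pole m ^ (k + 1) * pole n) := by
        rw [pow_succ, mul_assoc, key, mul_smul_comm, mul_sub]
      rw [this]
      exact Submodule.smul_mem _ _ (Submodule.sub_mem _ (pole_pow_mem m (k + 1)) ih)

theorem mul_pole_mem {x : K} (hx : x ∈ LinearMap.range decompMap) (n : ℤ) :
    x * pole n ∈ LinearMap.range decompMap := by
  obtain ⟨⟨p, h⟩, rfl⟩ := hx
  have e : decompMap (p, h) = ofPoly p + alpha h := by simp [decompMap]
  rw [e, add_mul]
  refine Submodule.add_mem _ ?_ ?_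
  · have hp : p = (X - C (n : ℂ)) * (p /ₘ (X - C (n : ℂ))) + C (p.eval (n : ℂ)) := by
      rw [mul_comm, mul_comm (p /ₘ _), add_comm, ← modByMonic_X_sub_C_eq_C_eval]
      exact (modByMonic_add_div p (X - C (n : ℂ))).symm
    have hX : ofPoly (X - C (n : ℂ)) = tau - algebraMap ℂ K n := by
      rw [map_sub]; rfl
    have hC : ofPoly (C (p.eval (n : ℂ))) = algebraMap ℂ K (p.eval (n : ℂ)) := rfl
    have : ofPoly p * pole n = ofPoly (p /ₘ (X - C (n : ℂ))) + (p.eval (n : ℂ)) • pole n := by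
      conv_lhs => rw [hp]
      rw [map_add, map_mul, hX, hC, Algebra.smul_def]
      linear_combination ofPoly (p /ₘ (X - C (n : ℂ))) * mul_pole n
    rw [this]
    refine Submodule.add_mem _ (ofPoly_mem _) (Submodule.smul_mem _ _ ?_)
    simpa using pole_pow_mem n 0
  · induction h using AddMonoidAlgebra.induction_linear with
    | zero => simp
    | add f g hf hg =>
      rw [map_add, add_mul]
      exact Submodule.add_mem _ (hf (by simp [decompMap])) (hg (by simp [decompMap]))
    | single a r =>
      obtain ⟨m, k⟩ := a
      rw [alpha_single, smul_mul_assoc]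
      exact Submodule.smul_mem _ _ (pole_pow_mul_mem m n k)

theorem decompMap_surjective : Function.Surjective decompMap := by
  rw [← LinearMap.range_eq_top, eq_top_iff]
  rintro x -
  obtain ⟨p, m, rfl⟩ := IsLocalization.exists_mk'_eq translates x
  obtain ⟨m, hm⟩ := m
  have key : ∀ m ∈ translates, ∀ y : K, ofPoly m * y ∈ LinearMap.range decompMap →
      y ∈ LinearMap.range decompMap := by
    intro m hm
    induction hm using Submonoid.closure_induction with
    | mem a ha =>
      obtain ⟨n, rfl⟩ := ha
      intro y hy
      have := mul_pole_mem hy (-n)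
      have h2 := mul_pole (-n)
      have hX : ofPoly (X + C (n : ℂ)) = tau - algebraMap ℂ K ((-n : ℤ) : ℂ) := by
        rw [map_add, Int.cast_neg, map_neg, sub_neg_eq_add]; rfl
      have e : ofPoly (X + C (n : ℂ)) * y * pole (-n) = y := by
        rw [hX]; linear_combination y * h2
      rwa [e] at this
    | one => intro y hy; simpa using hy
    | mul a b _ _ ha hb =>
      intro y hy
      rw [map_mul, mul_assoc] at hy
      exact hb _ (ha _ hy)
  refine key m hm _ ?_
  have : ofPoly m * IsLocalization.mk' K p ⟨m, hm⟩ = ofPoly p :=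
    IsLocalization.mk'_spec' K p ⟨m, hm⟩
  rw [this]
  exact ofPoly_mem p

theorem ofPoly_injective : Function.Injective ofPoly := by
  apply IsLocalization.injective K (M := translates)
  rw [translates, Submonoid.closure_le]
  rintro _ ⟨n, rfl⟩
  exact mem_nonZeroDivisors_of_ne_zero (X_add_C_ne_zero _)

/-- The expansion of a polynomial at the point `n`. -/
def expandAt (n : ℤ) : ℂ[X] →+* PowerSeries ℂ :=
  eval₂RingHom PowerSeries.C (PowerSeries.X + PowerSeries.C (n : ℂ))

theorem expandAt_X (n : ℤ) : expandAt n X = PowerSeries.X + PowerSeries.C (n : ℂ) :=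
  eval₂_X _ _

theorem expandAt_C (n : ℤ) (c : ℂ) : expandAt n (C c) = PowerSeries.C c :=
  eval₂_C _ _

/-- The Laurent expansion of an element of `K` at the point `n ∈ ℤ`. -/
def laurent (n : ℤ) : K →+* LaurentSeries ℂ :=
  IsLocalization.lift (M := translates)
    (g := (HahnSeries.ofPowerSeries ℤ ℂ).comp (expandAt n)) (by
      rintro ⟨y, hy⟩
      have : translates ≤ (IsUnit.submonoid (LaurentSeries ℂ)).comap
          ((HahnSeries.ofPowerSeries ℤ ℂ).comp (expandAt n)) := by
        rw [translates, Submonoid.closure_le]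
        rintro _ ⟨m, rfl⟩
        show IsUnit (HahnSeries.ofPowerSeries ℤ ℂ (expandAt n (X + C (m : ℂ))))
        rw [isUnit_iff_ne_zero, map_ne_zero_iff _ HahnSeries.ofPowerSeries_injective]
        intro h
        rw [map_add, expandAt_X, expandAt_C] at h
        have := congrArg (PowerSeries.coeff 1) h
        rw [map_add, map_add, PowerSeries.coeff_one_X, PowerSeries.coeff_C, PowerSeries.coeff_C,
          map_zero] at this
        simp at this
      exact this hy)

theorem laurent_ofPoly (n : ℤ) (p : ℂ[X]) :
    laurent n (ofPoly p) = HahnSeries.ofPowerSeries ℤ ℂ (expandAt n p) :=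
  IsLocalization.lift_eq _ _

theorem laurent_smul (n : ℤ) (c : ℂ) (F : K) : laurent n (c • F) = c • laurent n F := by
  have : algebraMap ℂ K c = ofPoly (C c) := rfl
  rw [Algebra.smul_def, map_mul, this, laurent_ofPoly, expandAt_C, HahnSeries.ofPowerSeries_C,
    HahnSeries.C_mul_eq_smul]

theorem laurent_tau_sub (n m : ℤ) : laurent n (tau - algebraMap ℂ K m) =
    HahnSeries.ofPowerSeries ℤ ℂ (PowerSeries.X + PowerSeries.C ((n : ℂ) - m)) := by
  have : tau - algebraMap ℂ K m = ofPoly (X - C (m : ℂ)) := by rw [map_sub]; rfl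
  rw [this, laurent_ofPoly]
  rw [map_sub, expandAt_X, expandAt_C, add_sub_assoc, ← map_sub]

theorem laurent_pole_ne {n m : ℤ} (h : n ≠ m) : ∃ u : PowerSeries ℂ,
    laurent n (pole m) = (u : LaurentSeries ℂ) := by
  have hne : (n - m : ℂ) ≠ 0 := sub_ne_zero.2 (by exact_mod_cast h)
  refine ⟨PowerSeries.invOfUnit (PowerSeries.X + PowerSeries.C ((n : ℂ) - m)) (Units.mk0 _ hne), ?_⟩
  have h1 := congrArg (laurent n) (mul_pole m)
  rw [map_mul, laurent_tau_sub, map_one] at h1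
  refine mul_left_cancel₀ (left_ne_zero_of_mul_eq_one h1) (h1.trans ?_)
  rw [← map_mul, PowerSeries.mul_invOfUnit _ _ (by simp), map_one]

theorem laurent_pole_self (n : ℤ) : laurent n (pole n) = HahnSeries.single (-1) 1 := by
  have h1 := congrArg (laurent n) (mul_pole n)
  rw [map_mul, laurent_tau_sub, map_one] at h1
  refine mul_left_cancel₀ (left_ne_zero_of_mul_eq_one h1) (h1.trans ?_)
  simp

theorem coeff_neg_coe (u : PowerSeries ℂ) (k : ℕ) :
    ((u : LaurentSeries ℂ)).coeff (-(k + 1 : ℤ)) = 0 := by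
  rw [PowerSeries.coeff_coe, if_pos (by omega)]

theorem laurent_alpha (n : ℤ) (k : ℕ) (h : HatHT) :
    (laurent n (alpha h)).coeff (-(k + 1 : ℤ)) = k.factorial * h.coeff (n, k) := by
  induction h using AddMonoidAlgebra.induction_linear with
  | zero => simp
  | add f g hf hg => rw [map_add, map_add, HahnSeries.coeff_add, hf, hg]; simp [mul_add]
  | single a r =>
    obtain ⟨m, j⟩ := a
    rw [alpha_single, laurent_smul, map_pow]
    by_cases hnm : n = m
    · subst hnm
      rw [laurent_pole_self, HahnSeries.single_pow]
      by_cases hjk : j = k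
      · subst hjk
        simp [mul_comm]
      · have : (-(k + 1 : ℤ)) ≠ (j + 1) • (-1 : ℤ) := by simp; omega
        rw [HahnSeries.coeff_smul, HahnSeries.coeff_single_of_ne this]
        simp [hjk]
    · obtain ⟨u, hu⟩ := laurent_pole_ne hnm
      rw [hu, ← map_pow, HahnSeries.coeff_smul, coeff_neg_coe]
      simp [Ne.symm hnm]

theorem decompMap_injective : Function.Injective decompMap := by
  rw [← LinearMap.ker_eq_bot, LinearMap.ker_eq_bot']
  rintro ⟨p, h⟩ hph
  have e : ofPoly p + alpha h = 0 := by simpa [decompMap] using hph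
  have h0 : h = 0 := by
    ext ⟨n, k⟩
    have h1 := laurent_alpha n k h
    have hu := laurent_ofPoly n p
    have h2 := congrArg (fun F => (laurent n F).coeff (-(k + 1 : ℤ))) e
    simp only [map_add, hu, HahnSeries.coeff_add, coeff_neg_coe, h1, zero_add, map_zero,
      HahnSeries.coeff_zero] at h2
    simpa [Nat.factorial_ne_zero] using h2
  subst h0
  simp only [map_zero, add_zero] at e
  rw [ofPoly_injective (e.trans (map_zero ofPoly).symm)]
  rfl

/-- The decomposition `K = ℂ[τ] ⊕ K_Sing`, with `K_Sing = α(Ĥ_T)`. -/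
def decomp : (ℂ[X] × HatHT) ≃ₗ[ℂ] K :=
  LinearEquiv.ofBijective decompMap ⟨decompMap_injective, decompMap_surjective⟩

/-- `α⁻¹ ∘ Sing : K → Ĥ_T`. -/
def singCoord : K →ₗ[ℂ] HatHT := LinearMap.snd ℂ _ _ ∘ₗ decomp.symm.toLinearMap

/-- The trace `Tr = ε ∘ α⁻¹ ∘ Sing` on `K`. -/
def trace : K →ₗ[ℂ] ℂ := counit.toLinearMap ∘ₗ singCoord

/-- The divided powers `Δ[n] = Δⁿ/n!` for `n ≥ 0`, with `Δ = T - 1`, and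
`Δ[-k] = Δ̄ᵏ/k!` for `k > 0`, with `Δ̄ = 1 - T⁻¹`. -/
def Delta : ℤ → HatHT
  | Int.ofNat n => ((n.factorial : ℂ)⁻¹) • (T 1 - 1) ^ n
  | Int.negSucc k => (((k + 1).factorial : ℂ)⁻¹) • (1 - T (-1)) ^ (k + 1)

/-- The elements `e_{n,k} = Δ[n] ∂^{(k)}`, `∂^{(k)} = ∂ᵏ/k!`. -/
def e (p : ℤ × ℕ) : HatHT := Delta p.1 * ((p.2.factorial : ℂ)⁻¹ • del ^ p.2)

theorem T_add (m n : ℤ) : T (m + n) = T m * T n := by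
  simp [T, AddMonoidAlgebra.single_mul_single]

theorem T_zero : T 0 = 1 := rfl

theorem T_mul_nat (s : ℤ) (i : ℕ) : T s ^ i = T (s * i) := by
  induction i with
  | zero => simp [T_zero]
  | succ i ih => rw [pow_succ, ih, ← T_add]; congr 1; push_cast; ring

theorem T_mul_del_pow (n : ℤ) (k : ℕ) : T n * del ^ k = AddMonoidAlgebra.single (n, k) 1 := by
  have : del ^ k = AddMonoidAlgebra.single (0, k) 1 := by
    induction k with
    | zero => rfl
    | succ k ih => rw [pow_succ, ih, del, AddMonoidAlgebra.single_mul_single]; simp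
  rw [this, T, AddMonoidAlgebra.single_mul_single]; simp

theorem coeff_aeval_T (s : ℤ) (p : ℂ[X]) (k : ℕ) (a : ℤ × ℕ) :
    (aeval (T s) p * del ^ k).coeff a =
      ∑ i ∈ p.support, if (s * i, k) = a then p.coeff i else 0 := by
  rw [aeval_eq_sum_range' (lt_add_one _), Finset.sum_mul]
  rw [AddMonoidAlgebra.coeff_sum, Finset.sum_apply']
  have : ∀ i : ℕ, (p.coeff i • T s ^ i * del ^ k).coeff a =
      if (s * i, k) = a then p.coeff i else 0 := by
    intro i
    rw [T_mul_nat, smul_mul_assoc, T_mul_del_pow]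
    simp [Finsupp.single_apply]
  simp only [this]
  symm
  apply Finset.sum_subset
  · intro i hi; simp only [Finset.mem_range]; exact Nat.lt_succ_of_le (le_natDegree_of_mem_supp i hi)
  · intro i _ hi
    simp [notMem_support_iff.1 hi]

theorem e_eq (p : ℤ × ℕ) : ∃ c : ℂ, ∃ s : ℤ, c ≠ 0 ∧ (s = 1 ∨ s = -1) ∧ p.1 = s * p.1.natAbs ∧
    e p = c • (aeval (T s) ((X - C (1 : ℂ)) ^ p.1.natAbs) * del ^ p.2) := by
  obtain ⟨n, k⟩ := p
  have hk : ((k.factorial : ℂ)⁻¹) ≠ 0 := inv_ne_zero (by exact_mod_cast k.factorial_ne_zero)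
  cases n with
  | ofNat n =>
    refine ⟨(n.factorial : ℂ)⁻¹ * (k.factorial : ℂ)⁻¹, 1,
      mul_ne_zero (inv_ne_zero (by exact_mod_cast n.factorial_ne_zero)) hk, Or.inl rfl, by simp, ?_⟩
    simp [e, Delta, smul_smul, mul_comm]
  | negSucc n =>
    refine ⟨(((n + 1).factorial : ℂ)⁻¹ * (k.factorial : ℂ)⁻¹) * (-1) ^ (n + 1), -1,
      mul_ne_zero (mul_ne_zero (inv_ne_zero (by exact_mod_cast (n + 1).factorial_ne_zero)) hk)
        (pow_ne_zero _ (by norm_num)), Or.inr rfl, by simp only [Int.natAbs_negSucc]; omega, ?_⟩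
    have h1 : (1 - T (-1)) ^ (n + 1) = ((-1 : ℂ) ^ (n + 1)) • (T (-1) - 1) ^ (n + 1) := by
      rw [← _root_.smul_pow]; congr 1; simp
    simp only [e, Delta, h1, Int.natAbs_negSucc, map_pow, map_sub, aeval_X, map_one]
    simp [smul_smul, mul_comm, mul_left_comm]

theorem coeff_e_ne (p q : ℤ × ℕ) (hpq : p ≠ q) (hle : p.1.natAbs ≤ q.1.natAbs) :
    (e p).coeff q = 0 := by
  obtain ⟨c, s, hc, hs, hp, he⟩ := e_eq p
  rw [he]
  simp only [AddMonoidAlgebra.coeff_smul, Finsupp.smul_apply, coeff_aeval_T]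
  rw [Finset.sum_eq_zero, smul_zero]
  intro i hi
  rw [if_neg]
  rintro rfl
  have hi' : i ≤ p.1.natAbs := by
    have := le_natDegree_of_mem_supp i hi
    rwa [natDegree_pow, natDegree_X_sub_C, mul_one] at this
  apply hpq
  have : (s * (i : ℤ)).natAbs = i := by rcases hs with rfl | rfl <;> simp
  have hii : i = p.1.natAbs := le_antisymm hi' (by simpa [this] using hle)
  ext
  · show p.1 = s * i
    rw [hii]; exact hp
  · rfl

theorem coeff_e_self (p : ℤ × ℕ) : (e p).coeff p ≠ 0 := by
  obtain ⟨c, s, hc, hs, hp, he⟩ := e_eq p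
  rw [he]
  simp only [AddMonoidAlgebra.coeff_smul, Finsupp.smul_apply, coeff_aeval_T]
  have hco : ((X - C (1 : ℂ)) ^ p.1.natAbs).coeff p.1.natAbs = 1 := by
    have := ((monic_X_sub_C (1 : ℂ)).pow p.1.natAbs).coeff_natDegree
    rwa [natDegree_pow, natDegree_X_sub_C, mul_one] at this
  rw [Finset.sum_eq_single p.1.natAbs, if_pos (by rw [← hp]), hco]
  · simpa using hc
  · intro i _ hne
    rw [if_neg]
    intro h
    have h1 : s * (i : ℤ) = p.1 := congrArg Prod.fst h
    apply hne
    rw [← h1]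
    rcases hs with rfl | rfl <;> simp
  · intro h
    rw [notMem_support_iff.1 h]; simp

theorem linearIndependent_e : LinearIndependent ℂ e := by
  rw [linearIndependent_iff']
  intro s g hg
  by_contra hcon
  push Not at hcon
  obtain ⟨i, hi, hgi⟩ := hcon
  obtain ⟨q, hq, hmax⟩ := (s.filter fun i => g i ≠ 0).exists_max_image (fun p => p.1.natAbs)
    ⟨i, by simp [hi, hgi]⟩
  rw [Finset.mem_filter] at hq
  have h1 := congrArg (fun x : HatHT => x.coeff q) hg
  simp only [AddMonoidAlgebra.coeff_sum, Finset.sum_apply', AddMonoidAlgebra.coeff_smul,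
    Finsupp.smul_apply] at h1
  rw [Finset.sum_eq_single q] at h1
  · have h2 : g q • (e q).coeff q = 0 := by simpa using h1
    exact (smul_ne_zero hq.2 (coeff_e_self q)) h2
  · intro p hp hpq
    by_cases hgp : g p = 0
    · rw [hgp, zero_smul]
    · rw [coeff_e_ne p q hpq (hmax p (by simp [hp, hgp])), smul_zero]
  · intro h; exact absurd hq.1 h

theorem span_e : ⊤ ≤ Submodule.span ℂ (Set.range e) := by
  have key : ∀ (s : ℤ) (f : ℕ → ℤ), (∀ j k : ℕ, ∃ c : ℂ,
      (T s - 1) ^ j * del ^ k = c • e (f j, k)) → ∀ m k : ℕ,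
      T s ^ m * del ^ k ∈ Submodule.span ℂ (Set.range e) := by
    intro s f hf m k
    have : T s ^ m = ∑ j ∈ Finset.range (m + 1), ((m.choose j : ℂ)) • (T s - 1) ^ j := by
      conv_lhs => rw [show T s = (T s - 1) + 1 by ring, add_pow]
      refine Finset.sum_congr rfl fun j _ => ?_
      rw [one_pow, mul_one, mul_comm, Algebra.smul_def]; simp
    rw [this, Finset.sum_mul]
    refine Submodule.sum_mem _ fun j _ => ?_
    obtain ⟨c, hc⟩ := hf j k
    rw [smul_mul_assoc, hc]
    exact Submodule.smul_mem _ _ (Submodule.smul_mem _ _ (Submodule.subset_span ⟨_, rfl⟩))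
  have hfac : ∀ k : ℕ, (k.factorial : ℂ) ≠ 0 := fun k => by exact_mod_cast k.factorial_ne_zero
  have hf : ∀ s : ℤ, (s = 1 ∨ s = -1) → ∀ j k : ℕ, ∃ c : ℂ,
      (T s - 1) ^ j * del ^ k = c • e (s * j, k) := by
    intro s hs j k
    obtain ⟨c, s', hc, hs', hp, he⟩ := e_eq (s * j, k)
    have hj : (s * (j : ℤ)).natAbs = j := by rcases hs with rfl | rfl <;> simp
    simp only [hj] at hp he
    refine ⟨c⁻¹, ?_⟩
    rw [he, smul_smul, inv_mul_cancel₀ hc, one_smul]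
    rcases Nat.eq_zero_or_pos j with rfl | hjp
    · simp
    · have : s = s' := by
        have hj0 : (j : ℤ) ≠ 0 := by omega
        exact mul_right_cancel₀ hj0 hp
      subst this
      simp
  rintro h -
  induction h using AddMonoidAlgebra.induction_linear with
  | zero => exact Submodule.zero_mem _
  | add f g hf hg => exact Submodule.add_mem _ hf hg
  | single a r =>
    obtain ⟨n, k⟩ := a
    have h1 : (AddMonoidAlgebra.single (n, k) r : HatHT) = r • (T n * del ^ k) := by
      rw [T_mul_del_pow]; simp
    rw [h1]
    refine Submodule.smul_mem _ _ ?_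
    rcases le_total 0 n with hn | hn
    · have := key 1 _ (hf 1 (Or.inl rfl)) n.natAbs k
      rw [T_mul_nat] at this
      convert this using 3
      omega
    · have := key (-1) _ (hf (-1) (Or.inr rfl)) n.natAbs k
      rw [T_mul_nat] at this
      convert this using 3
      omega

/-- The basis `e_{n,k}` of `Ĥ_T`. -/
def eBasis : Module.Basis (ℤ × ℕ) ℂ HatHT := Module.Basis.mk linearIndependent_e span_e

/-- The dual functions `e*_{n,k}` on `Ĥ_T`. -/
def eStar (p : ℤ × ℕ) : Module.Dual ℂ HatHT := eBasis.coord p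

theorem trace_ofPoly (p : ℂ[X]) : trace (ofPoly p) = 0 := by
  have : ofPoly p = decomp (p, 0) := by simp [decomp, decompMap]
  rw [this]; simp [trace, singCoord]

theorem trace_alpha (h : HatHT) : trace (alpha h) = counit h := by
  have : alpha h = decomp (0, h) := by simp [decomp, decompMap]
  rw [this]; simp [trace, singCoord]

theorem trace_pole (n : ℤ) : trace (pole n) = 1 := by
  have : pole n = alpha (AddMonoidAlgebra.single (n, 0) 1) := by simp [alpha_single]
  rw [this, trace_alpha]; simp [counit]

/-- The pairing of `K_Sing` and `ℂ[τ]` given by the trace is nondegenerate on `K_Sing`. -/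
theorem eq_zero_of_trace {h : HatHT} (hh : ∀ p : ℂ[X], trace (alpha h * ofPoly p) = 0) : h = 0 := by
  have key : ∀ m ∈ translates, ∀ F : K, (∀ p : ℂ[X], trace (F * ofPoly p) = 0) →
      ofPoly m * F ∈ Set.range ofPoly → F ∈ Set.range ofPoly := by
    intro m hm
    induction hm using Submonoid.closure_induction with
    | mem a ha =>
      obtain ⟨n, rfl⟩ := ha
      rintro F hF ⟨p, hp⟩
      have hX : ofPoly (X + C (n : ℂ)) = tau - algebraMap ℂ K ((-n : ℤ) : ℂ) := by
        rw [map_add, Int.cast_neg, map_neg, sub_neg_eq_add]; rfl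
      have h2 := mul_pole (-n)
      have h3 : F = ofPoly p * pole (-n) := by
        rw [hp, hX]; linear_combination -F * h2
      have hp' : p = (X + C (n : ℂ)) * (p /ₘ (X - C (-n : ℂ))) + C (p.eval (-n : ℂ)) := by
        have h5 := modByMonic_add_div p (X - C (-n : ℂ))
        rw [modByMonic_X_sub_C_eq_C_eval] at h5
        conv_lhs => rw [← h5]
        rw [C_neg]; ring
      have hC : ofPoly (C (p.eval (-n : ℂ))) = algebraMap ℂ K (p.eval (-n : ℂ)) := rfl
      have h4 : F = ofPoly (p /ₘ (X - C (-n : ℂ))) + (p.eval (-n : ℂ)) • pole (-n) := by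
        rw [h3]
        conv_lhs => rw [hp']
        rw [map_add, map_mul, hX, hC, Algebra.smul_def]
        linear_combination ofPoly (p /ₘ (X - C (-n : ℂ))) * h2
      have h5 := hF 1
      rw [map_one, mul_one, h4, map_add, trace_ofPoly, map_smul, trace_pole] at h5
      have h6 : p.eval (-n : ℂ) = 0 := by simpa using h5
      exact ⟨_, by rw [h4, h6, zero_smul, add_zero]⟩
    | one => intro F _ h; simpa using h
    | mul a b _ _ ha hb =>
      intro F hF h
      rw [map_mul, mul_assoc] at h
      refine hb F hF (ha _ (fun p => ?_) h)
      have h7 : F * ofPoly (b * p) = ofPoly b * F * ofPoly p := by rw [map_mul]; ring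
      rw [← h7]; exact hF (b * p)
  obtain ⟨p, m, hm⟩ := IsLocalization.exists_mk'_eq translates (alpha h)
  obtain ⟨q, hq⟩ := key m.1 m.2 (alpha h) hh ⟨p, by
    rw [← hm]; exact (IsLocalization.mk'_spec' K p m).symm⟩
  have : ((0, h) : ℂ[X] × HatHT) = (q, 0) := decompMap_injective (by simp [decompMap, hq])
  exact (Prod.ext_iff.1 this).2

/-- `W`-valued distributions on `K`. -/
abbrev Dist (W : Type*) [AddCommGroup W] [Module ℂ W] : Type _ := K →ₗ[ℂ] W

section Distributions

variable {W : Type*} [AddCommGroup W] [Module ℂ W]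

/-- The product of a distribution and an element of `K`: `(G D)(F) = D(G F)`. -/
def mulDist (G : K) (D : Dist W) : Dist W := D ∘ₗ LinearMap.mulLeft ℂ G

theorem mulDist_add_left (G G' : K) (D : Dist W) :
    mulDist (G + G') D = mulDist G D + mulDist G' D := by
  ext; simp [mulDist, add_mul]

theorem mulDist_smul_left (c : ℂ) (G : K) (D : Dist W) : mulDist (c • G) D = c • mulDist G D := by
  ext; simp [mulDist]

theorem mulDist_add_right (G : K) (D D' : Dist W) :
    mulDist G (D + D') = mulDist G D + mulDist G D' := rfl

theorem mulDist_smul_right (c : ℂ) (G : K) (D : Dist W) : mulDist G (c • D) = c • mulDist G D := rfl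

variable (W) in
/-- The distribution on `ℂ[τ]` with the rational kernel `w ⊗ α(h)`: `p ↦ Tr(α(h) p) w`. -/
def singPairing : W ⊗[ℂ] HatHT →ₗ[ℂ] (ℂ[X] →ₗ[ℂ] W) :=
  TensorProduct.lift (LinearMap.mk₂ ℂ
    (fun w h => (trace ∘ₗ LinearMap.mulLeft ℂ (alpha h) ∘ₗ ofPoly.toLinearMap).smulRight w)
    (fun w w' h => by ext; simp)
    (fun c w h => LinearMap.ext fun p => smul_comm _ c w)
    (fun w h h' => by ext; simp [add_mul, add_smul])
    (fun c w h => by ext; simp [mul_smul]))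

theorem singPairing_tmul (w : W) (h : HatHT) (p : ℂ[X]) :
    singPairing W (w ⊗ₜ h) p = trace (alpha h * ofPoly p) • w := by
  simp [singPairing]

theorem singPairing_injective : Function.Injective (singPairing W) := by
  rw [← LinearMap.ker_eq_bot, LinearMap.ker_eq_bot']
  classical
  intro κ hκ
  let b := Module.Basis.ofVectorSpace ℂ W
  have hpair : ∀ (i) (p : ℂ[X]) (κ : W ⊗[ℂ] HatHT), b.coord i (singPairing W κ p) =
      trace (alpha (TensorProduct.equivFinsuppOfBasisLeft b κ i) * ofPoly p) := by
    intro i p κ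
    induction κ using TensorProduct.induction_on with
    | zero => simp
    | tmul w h => simp [singPairing_tmul, mul_comm (b.repr w i)]
    | add x y hx hy =>
      rw [map_add, LinearMap.add_apply, map_add, hx, hy]
      rw [map_add, Finsupp.add_apply, map_add, add_mul, map_add]
  apply (TensorProduct.equivFinsuppOfBasisLeft b).injective
  rw [map_zero]
  ext1 i
  refine eq_zero_of_trace fun p => ?_
  rw [← hpair, hκ]; simp

/-- A distribution on `K` has a rational singularity if its restriction to `ℂ[τ]` has a kernel in
`W ⊗ K_Sing`. -/
def RatSing (D : Dist W) : Prop :=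
  ∃ κ : W ⊗[ℂ] HatHT, D ∘ₗ ofPoly.toLinearMap = singPairing W κ

/-- The element of `W ⊗ Ĥ_T` corresponding (under `α`) to the rational kernel of the singular part
of a distribution. -/
def singKer : Dist W →ₗ[ℂ] W ⊗[ℂ] HatHT :=
  (singPairing W).leftInverse ∘ₗ LinearMap.lcomp ℂ W ofPoly.toLinearMap

theorem singKer_spec {D : Dist W} (hD : RatSing D) :
    D ∘ₗ ofPoly.toLinearMap = singPairing W (singKer D) := by
  obtain ⟨κ, hκ⟩ := hD
  have : singKer D = κ := by
    show (singPairing W).leftInverse (D ∘ₗ ofPoly.toLinearMap) = κ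
    rw [hκ, LinearMap.leftInverse_apply_of_inj (LinearMap.ker_eq_bot.2 singPairing_injective)]
  rw [this, hκ]

end Distributions

/-- The space containing the components of fields: a functional on `Ĥ_T` (a formal holomorphic
function) together with an element of `K`. -/
abbrev Comp : Type := Module.Dual ℂ HatHT × K

/-- `K̂ + K`, where `K̂ = (⊕ ℂ e*_{n,k}) ⊕ K_Sing`: all components for which products are formed. -/
def KHat : Submodule ℂ Comp := (Submodule.span ℂ (Set.range eStar)).prod ⊤

/-- The action of `h ∈ Ĥ_T` on components; on functionals it is `(h φ)(h') = φ(h h')`. -/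
def compAct (h : HatHT) : Comp →ₗ[ℂ] Comp :=
  (LinearMap.mulLeft ℂ h).dualMap.prodMap (actK h)

/-- `F ↦ F(-τ)` on components. -/
def compAntipode : Comp →ₗ[ℂ] Comp :=
  antipode.toLinearMap.dualMap.prodMap antipodeK.toLinearMap

section Fields

variable {W V : Type*} [AddCommGroup W] [Module ℂ W] [AddCommGroup V] [Module ℂ V]

/-- The value of a distribution with rational singularity at `F = (φ, P)`: a functional `φ` is
paired with the kernel `∑ w ⊗ α(h)` of the singular part, giving `∑ φ(h) w`. -/
def evalHat : Dist W →ₗ[ℂ] Comp →ₗ[ℂ] W :=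
  LinearMap.mk₂ ℂ (fun D F => TensorProduct.rid ℂ W (F.1.lTensor W (singKer D)) + D F.2)
    (fun D D' F => by simp only [map_add, LinearMap.add_apply]; abel)
    (fun c D F => by simp only [map_smul, LinearMap.smul_apply, smul_add])
    (fun D F F' => by
      simp only [Prod.fst_add, Prod.snd_add, map_add, LinearMap.lTensor_add, LinearMap.add_apply]
      abel)
    (fun c D F => by
      simp only [Prod.smul_fst, Prod.smul_snd, map_smul, LinearMap.lTensor_smul,
        LinearMap.smul_apply, smul_add])

/-- A field on `V`: each `f(τ)v` has a rational singularity. -/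
def IsField (f : Dist (Module.End ℂ V)) : Prop := ∀ v : V, RatSing (f.flip v)

/-- The component `f_{F}` of a field, `v ↦ Tr(f(τ)v F(τ))`. -/
def component (f : Dist (Module.End ℂ V)) (F : Comp) : Module.End ℂ V :=
  evalHat.flip F ∘ₗ f.flip

/-- `w ⊗ h ↦ Tr_{τ₁} Tr_{τ₂} (f(τ₁)w ⊗ α(h)(τ₂) F(τ₁ - τ₂))`, where `F(τ₁ - τ₂)` is expanded
in `τ₂`. -/
def prodLeft (f : Dist (Module.End ℂ V)) (F : Comp) : V ⊗[ℂ] HatHT →ₗ[ℂ] V :=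
  TensorProduct.lift (LinearMap.mk₂ ℂ
    (fun w h => evalHat (f.flip w) (compAct (antipode h) F))
    (fun w w' h => by simp only [map_add, LinearMap.add_apply])
    (fun c w h => by simp only [map_smul, LinearMap.smul_apply])
    (fun w h h' => by
      rw [← map_add]; congr 1
      refine Prod.ext (LinearMap.ext fun x => ?_) ?_ <;> simp [compAct, add_mul])
    (fun c w h => by
      rw [← map_smul]; congr 1
      refine Prod.ext (LinearMap.ext fun x => ?_) ?_ <;> simp [compAct]))

/-- `w ⊗ h ↦ Tr_{τ₁} (g(τ₂)w α(h)(τ₁) F(τ₁ - τ₂))(G)`, where `F(τ₁ - τ₂)` is expanded in `τ₁`. -/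
def prodRight (g : Dist (Module.End ℂ V)) (F : Comp) (G : K) : V ⊗[ℂ] HatHT →ₗ[ℂ] V :=
  TensorProduct.lift (LinearMap.mk₂ ℂ
    (fun w h => evalHat (mulDist G (g.flip w)) (compAntipode (compAct h F)))
    (fun w w' h => by
      rw [← LinearMap.add_apply, ← map_add]; congr 2; ext; simp [mulDist])
    (fun c w h => by
      rw [← LinearMap.smul_apply, ← map_smul]; congr 2; ext; simp [mulDist])
    (fun w h h' => by
      rw [← map_add]; congr 1
      refine Prod.ext (LinearMap.ext fun x => ?_) ?_ <;>
        simp [compAct, compAntipode, add_mul])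
    (fun c w h => by
      rw [← map_smul]; congr 1
      refine Prod.ext (LinearMap.ext fun x => ?_) ?_ <;> simp [compAct, compAntipode]))

theorem prodRight_add (g : Dist (Module.End ℂ V)) (F : Comp) (G G' : K) :
    prodRight g F (G + G') = prodRight g F G + prodRight g F G' := by
  refine TensorProduct.ext' fun w h => ?_
  simp [prodRight, mulDist_add_left]

theorem prodRight_smul (g : Dist (Module.End ℂ V)) (F : Comp) (c : ℂ) (G : K) :
    prodRight g F (c • G) = c • prodRight g F G := by
  refine TensorProduct.ext' fun w h => ?_
  simp [prodRight, mulDist_smul_left]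

/-- The `F`-th normal ordered product `f(τ)_{F} g(τ)`, i.e. the trace over `τ₁` of
`f(τ₁) g(τ₂) F(τ₁ - τ₂) - g(τ₂) f(τ₁) F(τ₁ - τ₂)`, where `F(τ₁ - τ₂)` is expanded in `τ₂` in the
first and in `τ₁` in the second term. -/
def nprod (f : Dist (Module.End ℂ V)) (F : Comp) (g : Dist (Module.End ℂ V)) :
    Dist (Module.End ℂ V) :=
  LinearMap.mk₂ ℂ
    (fun G v => prodLeft f F (singKer (mulDist G (g.flip v))) - prodRight g F G (singKer (f.flip v)))
    (fun G G' v => by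
      rw [mulDist_add_left, map_add, map_add, prodRight_add, LinearMap.add_apply]; abel)
    (fun c G v => by
      rw [mulDist_smul_left, map_smul, map_smul, prodRight_smul, LinearMap.smul_apply, smul_sub])
    (fun G v v' => by
      simp only [map_add, mulDist_add_right]; abel)
    (fun c G v => by
      simp only [map_smul, mulDist_smul_right, smul_sub])

/-- The identity field `Y(1_V, τ)`: the trace times the identity operator. -/
def idField : Dist (Module.End ℂ V) := trace.smulRight 1

/-- The exponential operator `R(τ)` of an `Ĥ_T`-action on `V`, acting on distributions: if the
singular part of `G D` has kernel `∑ w ⊗ α(h)` then `(R(τ) D)(G) = ∑ h.w`. -/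
def expDist (act : HatHT →ₗ[ℂ] Module.End ℂ V) (D : Dist V) : Dist V where
  toFun G := TensorProduct.lift act.flip (singKer (mulDist G D))
  map_add' G G' := by
    rw [← map_add, ← map_add]; congr 2; ext; simp [mulDist, add_mul]
  map_smul' c G := by
    rw [← map_smul, RingHom.id_apply, ← map_smul]; congr 2; ext; simp [mulDist]

/-- The distribution with kernel `D(-τ)`. Since `Tr(F(-τ)) = -Tr(F)`, it is
`F ↦ -D(F(-τ))`. -/
def antipodal (D : Dist W) : Dist W := -(D ∘ₗ antipodeK.toLinearMap)

/-- The commutator distribution on `K ⊗ K`: `F ⊗ G ↦ f(F) g(G) - g(G) f(F)`. -/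
def commutator (f g : Dist (Module.End ℂ V)) : K ⊗[ℂ] K →ₗ[ℂ] Module.End ℂ V :=
  TensorProduct.lift ((LinearMap.mul ℂ (Module.End ℂ V)).compl₁₂ f g -
    ((LinearMap.mul ℂ (Module.End ℂ V)).compl₁₂ g f).flip)

/-- `p ↦ p(τ₁ - τ₂)`. -/
def polyDiff : ℂ[X] →ₐ[ℂ] K ⊗[ℂ] K := aeval (tau ⊗ₜ 1 - 1 ⊗ₜ tau)

/-- Mutual rationality: the commutator is killed by `p(τ₁ - τ₂)` for some nonzero `p`. -/
def MutuallyRational (f g : Dist (Module.End ℂ V)) : Prop :=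
  ∃ p : ℂ[X], p ≠ 0 ∧ ∀ z : K ⊗[ℂ] K, commutator f g (polyDiff p * z) = 0

/-- The distribution `D(τ₂) h₂ δ(τ₁, τ₂)` on `K ⊗ K`, where `δ(A ⊗ B) = Tr(A B)`; its value at
`A ⊗ B` is `D(h(A) B)`. -/
def mulDelta (D : Dist W) (h : HatHT) : K ⊗[ℂ] K →ₗ[ℂ] W :=
  D ∘ₗ TensorProduct.lift ((LinearMap.mul ℂ K) ∘ₗ actK h)

/-- `∑ i, s i = w`, a sum with finitely many nonzero terms. -/
def HasFinSum {ι : Type*} (s : ι → W) (w : W) : Prop :=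
  (Function.support s).Finite ∧ ∑ᶠ i, s i = w

end Fields

/-- The operators `h_V : f ↦ Y(f, τ)_{S(h)(1/τ)} 1_V` defined by a state-field correspondence. -/
def stateAct {V : Type*} [AddCommGroup V] [Module ℂ V] (Y : V →ₗ[ℂ] Dist (Module.End ℂ V))
    (vac : V) : HatHT →ₗ[ℂ] Module.End ℂ V :=
  LinearMap.mk₂ ℂ (fun h f => Y f (alpha h) vac) (fun h h' f => by simp) (fun c h f => by simp)
    (fun h f f' => by simp) (fun c h f => by simp)

/-- An `H_T`-vertex algebra. -/
structure HTVertexAlgebra (V : Type*) [AddCommGroup V] [Module ℂ V] where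
  /-- the vacuum `1_V` -/
  vac : V
  /-- the state-field correspondence -/
  Y : V →ₗ[ℂ] Dist (Module.End ℂ V)
  isField : ∀ f : V, IsField (Y f)
  Y_vac : Y vac = idField
  /-- `Y(f,τ)1_V` is holomorphic -/
  Y_poly_vac : ∀ (f : V) (p : ℂ[X]), Y f (ofPoly p) vac = 0
  /-- the constant term of `Y(f,τ)1_V` is `f` -/
  Y_const_vac : ∀ f : V, Y f (Ring.inverse tau) vac = f
  /-- `h ↦ h_V` is an `Ĥ_T`-module structure on `V` -/
  act_mul : ∀ h h' : HatHT, stateAct Y vac (h * h') = stateAct Y vac h * stateAct Y vac h'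
  /-- `H_T`-covariance, `h_K Y(f,τ) = Y(h_V f,τ)` -/
  covariance : ∀ h ∈ HT, ∀ (f : V) (F : K),
    Y f (actK (antipode h) F) = Y (stateAct Y vac h f) F
  /-- skew-symmetry, `Y(f,τ)g = R_V(τ) Y^S(g,τ)f` -/
  skew : ∀ f g : V, (Y f).flip g = expDist (stateAct Y vac) (antipodal ((Y g).flip f))
  /-- any two vertex operators are mutually rational -/
  rational : ∀ f g : V, MutuallyRational (Y f) (Y g)

end
end HTVertex

namespace HTVertex

noncomputable section

/-! A field that is mutually rational with all vertex operators is determined by its values on the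
vacuum (`eq_Y_of_apply_vac`, Goddard's argument). For F in K, associativity is this principle
applied to the product f(τ)_{F} g(τ): the product is a field (`isField_nprod`), Dong's lemma
(`MutuallyRational.nprod`) makes it mutually rational with every Y(h,τ), and on the vacuum it agrees
with Y(f_{F}g,τ) (`nprod_apply_vac`). The vacuum computation needs covariance in the right-hand
argument of Y, which comes from skew-symmetry together with covariance under ∂; the latter is itself
a consequence of uniqueness.

Locality arguments rest on one fact of linear algebra (`exists_aeval_sub_eq_zero`): if commuting
operators x, y each satisfy a nonzero polynomial on a vector, so does x - y. It is applied to
multiplications by τ in the separate variables, for instance to τ₂ - τ₃ = (τ₁ - τ₃) - (τ₁ - τ₂).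

A functional on Ĥ_T as component reduces to a polynomial. Rationality and mutual rationality confine
all relevant kernels to the elements of Ĥ_T killed by a fixed polynomial. These form a
finite-dimensional space, on which pairing with polynomials yields every functional
(`exists_pairing_eq`, `exists_ofPoly_of_functional`). Iterated products follow by induction.

For the commutator, components at polynomials q are the commutator multiplied by q(τ₁ - τ₂)
(`nprod_ofPoly`). Newton's expansion of a(τ₁) in falling factorials of τ₁ - τ₂ (`exists_newton`)
then gives the formula on ℂ[τ] ⊗ K, and pairing the falling factorials with the basis e_{n,k} turns
it into the other formula. Both extend to K ⊗ K because a distribution killed by some p(τ₁ - τ₂) and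
rational in τ₂ is determined by its values on ℂ[τ] ⊗ K (`LocalRational.eq_zero`). -/

/-! ### The Hopf algebra Ĥ_T, its action on K, and the trace form. -/

theorem hatHT_induction {P : HatHT → Prop} (hT : ∀ n, P (T n)) (hdel : P del)
    (hadd : ∀ x y, P x → P y → P (x + y)) (hmul : ∀ x y, P x → P y → P (x * y))
    (hsmul : ∀ (c : ℂ) x, P x → P (c • x)) (h : HatHT) : P h := by
  have hpow : ∀ k : ℕ, P (del ^ k) := by
    intro k
    induction k with
    | zero => rw [pow_zero, ← T_zero]; exact hT 0
    | succ k ih => rw [pow_succ]; exact hmul _ _ ih hdel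
  induction h using AddMonoidAlgebra.induction_linear with
  | zero => rw [← zero_smul ℂ (T 0)]; exact hsmul _ _ (hT 0)
  | add f g hf hg => exact hadd _ _ hf hg
  | single a r =>
    obtain ⟨n, k⟩ := a
    have : (AddMonoidAlgebra.single (n, k) r : HatHT) = r • (T n * del ^ k) := by
      rw [T_mul_del_pow]; simp
    rw [this]
    exact hsmul _ _ (hmul _ _ (hT n) (hpow k))

theorem actK_T (n : ℤ) (F : K) : actK (T n) F = shift n F := by
  simp [actK, T]

theorem actK_del (F : K) : actK del F = derivK F := by
  simp [actK, del, shift_zero]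

theorem antipode_T (n : ℤ) : antipode (T n) = T (-n) := by
  simp [antipode, T]

theorem antipode_del : antipode del = -del := by
  simp [antipode, del]

theorem counit_T (n : ℤ) : counit (T n) = 1 := by
  simp [counit, T]

theorem counit_del : counit del = 0 := by
  simp [counit, del]

theorem antipode_antipode (h : HatHT) : antipode (antipode h) = h := by
  induction h using hatHT_induction with
  | hT n => simp [antipode_T]
  | hdel => simp [antipode_del]
  | hadd x y hx hy => rw [map_add, map_add, hx, hy]
  | hmul x y hx hy => rw [map_mul, map_mul, hx, hy]
  | hsmul c x hx => rw [map_smul, map_smul, hx]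

theorem counit_antipode (h : HatHT) : counit (antipode h) = counit h := by
  induction h using hatHT_induction with
  | hT n => simp [antipode_T, counit_T]
  | hdel => simp [antipode_del, counit_del]
  | hadd x y hx hy => rw [map_add, map_add, map_add, hx, hy]
  | hmul x y hx hy => rw [map_mul, map_mul, map_mul, hx, hy]
  | hsmul c x hx => rw [map_smul, map_smul, map_smul, hx]

theorem actK_mul (h h' : HatHT) (F : K) : actK (h * h') F = actK h (actK h' F) := by
  rw [map_mul]; rfl

theorem alpha_eq (h : HatHT) : alpha h = actK (antipode h) (Ring.inverse tau) := rfl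

theorem alpha_one : alpha 1 = Ring.inverse tau := by
  simp [alpha_eq]

theorem alpha_mul (h h' : HatHT) : alpha (h * h') = actK (antipode h) (alpha h') := by
  rw [alpha_eq, map_mul, actK_mul, alpha_eq]

theorem alpha_T (n : ℤ) : alpha (T n) = pole n := by
  simp [T, alpha_single]

theorem decomp_eq (p : ℂ[X]) (h : HatHT) : decomp (p, h) = ofPoly p + alpha h := by
  simp [decomp, decompMap]

theorem singCoord_ofPoly (p : ℂ[X]) : singCoord (ofPoly p) = 0 := by
  have : ofPoly p = decomp (p, 0) := by simp [decomp_eq]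
  rw [this]; simp [singCoord]

theorem singCoord_alpha (h : HatHT) : singCoord (alpha h) = h := by
  have : alpha h = decomp (0, h) := by simp [decomp_eq]
  rw [this]; simp [singCoord]

theorem exists_eq_ofPoly_add_alpha (F : K) : ∃ p : ℂ[X], F = ofPoly p + alpha (singCoord F) := by
  obtain ⟨⟨p, h⟩, rfl⟩ := decomp.surjective F
  refine ⟨p, ?_⟩
  rw [decomp_eq, map_add, singCoord_ofPoly, singCoord_alpha, zero_add]

theorem exists_ofPoly_mul_eq (F : K) : ∃ m ∈ translates, ∃ p : ℂ[X], ofPoly m * F = ofPoly p := by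
  obtain ⟨p, m, rfl⟩ := IsLocalization.exists_mk'_eq translates F
  exact ⟨m, m.2, p, IsLocalization.mk'_spec' K p m⟩

theorem isUnit_ofPoly {m : ℂ[X]} (hm : m ∈ translates) : IsUnit (ofPoly m) :=
  IsLocalization.map_units K (⟨m, hm⟩ : translates)

theorem ne_zero_of_mem_translates {m : ℂ[X]} (hm : m ∈ translates) : m ≠ 0 := by
  rintro rfl
  have := (isUnit_ofPoly hm).mul_left_cancel
    (show ofPoly 0 * ofPoly 1 = ofPoly 0 * ofPoly 0 by rw [map_zero, zero_mul, zero_mul])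
  exact one_ne_zero (ofPoly_injective this)

theorem ofPoly_X_sub_C (n : ℤ) : ofPoly (X - C (n : ℂ)) = tau - algebraMap ℂ K n := by
  rw [map_sub]; rfl

/-- A derivation of `K` is determined by its value at `τ`. -/
theorem eq_of_leibniz {d d' : K →ₗ[ℂ] K} (hd : ∀ F G, d (F * G) = F * d G + G * d F)
    (hd' : ∀ F G, d' (F * G) = F * d' G + G * d' F) (h : d tau = d' tau) : d = d' := by
  have h1 : ∀ d : K →ₗ[ℂ] K, (∀ F G, d (F * G) = F * d G + G * d F) → d 1 = 0 := by
    intro d hd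
    have := hd 1 1
    simpa using this
  have hp : ∀ p : ℂ[X], d (ofPoly p) = d' (ofPoly p) := by
    intro p
    induction p using Polynomial.induction_on' with
    | add p q hp hq => simp only [map_add, hp, hq]
    | monomial n a =>
      have : ofPoly (monomial n a) = a • tau ^ n := by
        rw [← C_mul_X_pow_eq_monomial, map_mul, map_pow, Algebra.smul_def]; rfl
      rw [this, map_smul, map_smul]
      congr 1
      induction n with
      | zero => rw [pow_zero, h1 d hd, h1 d' hd']
      | succ n ih =>
        have ih' := ih (by
          rw [← C_mul_X_pow_eq_monomial, map_mul, map_pow, Algebra.smul_def]; rfl)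
        rw [pow_succ, hd, hd', h, ih']
  ext F
  obtain ⟨m, hm, p, hmp⟩ := exists_ofPoly_mul_eq F
  have e1 := congrArg d hmp
  have e2 := congrArg d' hmp
  rw [hd] at e1
  rw [hd'] at e2
  refine (isUnit_ofPoly hm).mul_left_cancel ?_
  have e3 := hp m
  have e4 := hp p
  rw [e3] at e1
  linear_combination e1 - e2 + e4

theorem antipodeK_tau : antipodeK tau = -tau := liftK_tau _ _

theorem antipodeK_antipodeK (F : K) : antipodeK (antipodeK F) = F := by
  have : antipodeK.comp antipodeK = AlgHom.id ℂ K := by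
    apply algHom_ext_tau; simp [antipodeK_tau]
  exact DFunLike.congr_fun this F

theorem antipodeK_shift (n : ℤ) (F : K) : antipodeK (shift n F) = shift (-n) (antipodeK F) := by
  have : antipodeK.comp (shift n) = (shift (-n)).comp antipodeK := by
    apply algHom_ext_tau; simp [antipodeK_tau, shift, liftK_tau]; ring
  exact DFunLike.congr_fun this F

/-- Conjugating ∂ by τ ↦ -τ gives a derivation again, so only the values at τ need comparing. -/
theorem antipodeK_derivK (F : K) : antipodeK (derivK F) = -derivK (antipodeK F) := by
  have : derivK = -(antipodeK.toLinearMap ∘ₗ derivK ∘ₗ antipodeK.toLinearMap) := by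
    refine eq_of_leibniz derivK_mul (fun F G => ?_) ?_
    · simp [derivK_mul, antipodeK_antipodeK]; ring
    · simp [derivK_tau, antipodeK_tau]
  have := DFunLike.congr_fun this (antipodeK F)
  rw [this]
  simp [antipodeK_antipodeK]

theorem antipodeK_actK (h : HatHT) (F : K) :
    antipodeK (actK h F) = actK (antipode h) (antipodeK F) := by
  induction h using hatHT_induction generalizing F with
  | hT n => rw [actK_T, antipode_T, actK_T, antipodeK_shift]
  | hdel => rw [actK_del, antipode_del, antipodeK_derivK, map_neg, LinearMap.neg_apply, actK_del]
  | hadd x y hx hy => simp only [map_add, LinearMap.add_apply, hx, hy]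
  | hmul x y hx hy => rw [actK_mul, hx, hy, map_mul, actK_mul]
  | hsmul c x hx => simp only [map_smul, LinearMap.smul_apply, hx]

theorem ofPoly_comp_neg (p : ℂ[X]) : antipodeK (ofPoly p) = ofPoly (p.comp (-X)) := by
  have : antipodeK.comp ofPoly = ofPoly.comp (aeval (-X) : ℂ[X] →ₐ[ℂ] ℂ[X]) := by
    apply Polynomial.algHom_ext
    simp only [AlgHom.comp_apply, aeval_X, map_neg]
    exact antipodeK_tau
  exact DFunLike.congr_fun this p

theorem antipodeK_alpha (h : HatHT) : antipodeK (alpha h) = -alpha (antipode h) := by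
  have : antipodeK (Ring.inverse tau) = -Ring.inverse tau := by
    have hu : IsUnit tau := by simpa using isUnit_tau_add 0
    refine hu.mul_left_cancel ?_
    have := congrArg antipodeK (Ring.mul_inverse_cancel tau hu)
    rw [map_mul, antipodeK_tau, map_one] at this
    linear_combination -this + Ring.mul_inverse_cancel tau hu
  rw [alpha_eq, antipodeK_actK, this, map_neg, alpha_eq]

theorem trace_antipodeK (F : K) : trace (antipodeK F) = -trace F := by
  obtain ⟨p, hp⟩ := exists_eq_ofPoly_add_alpha F
  rw [hp, map_add, map_add, ofPoly_comp_neg, trace_ofPoly, antipodeK_alpha, map_neg, trace_alpha,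
    map_add, trace_ofPoly, trace_alpha, counit_antipode]
  ring

theorem derivK_ofPoly (p : ℂ[X]) : derivK (ofPoly p) = ofPoly (derivative p) := by
  have hm : ∀ (n : ℕ) (a : ℂ), ofPoly (monomial n a) = a • tau ^ n := by
    intro n a
    rw [← C_mul_X_pow_eq_monomial, map_mul, map_pow, Algebra.smul_def]; rfl
  induction p using Polynomial.induction_on' with
  | add p q hp hq => simp only [map_add, hp, hq]
  | monomial n a =>
    rw [derivative_monomial, hm, hm, map_smul]
    cases n with
    | zero => simp [derivK_one]
    | succ n =>
      rw [derivK_pow, derivK_tau]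
      simp [Algebra.smul_def]; ring

theorem exists_actK_ofPoly (h : HatHT) (p : ℂ[X]) : ∃ q : ℂ[X], actK h (ofPoly p) = ofPoly q := by
  induction h using hatHT_induction generalizing p with
  | hT n =>
    refine ⟨p.comp (X + C (n : ℂ)), ?_⟩
    have : (shift n).comp ofPoly = ofPoly.comp (aeval (X + C (n : ℂ)) : ℂ[X] →ₐ[ℂ] ℂ[X]) := by
      apply Polynomial.algHom_ext
      simp only [AlgHom.comp_apply, aeval_X, map_add]
      exact liftK_tau _ _
    rw [actK_T]
    exact DFunLike.congr_fun this p
  | hdel =>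
    exact ⟨derivative p, by rw [actK_del, derivK_ofPoly]⟩
  | hadd x y hx hy =>
    obtain ⟨q, hq⟩ := hx p
    obtain ⟨r, hr⟩ := hy p
    exact ⟨q + r, by rw [map_add, LinearMap.add_apply, hq, hr, map_add]⟩
  | hmul x y hx hy =>
    obtain ⟨q, hq⟩ := hy p
    obtain ⟨r, hr⟩ := hx q
    exact ⟨r, by rw [actK_mul, hq, hr]⟩
  | hsmul c x hx =>
    obtain ⟨q, hq⟩ := hx p
    exact ⟨c • q, by rw [map_smul, LinearMap.smul_apply, hq, map_smul]⟩

/-- Ĥ_T preserves polynomials, which have trace 0; on K_Sing the element h acts as multiplication by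
S(h) on Ĥ_T, and ε is multiplicative with ε ∘ S = ε. -/
theorem trace_actK (h : HatHT) (F : K) : trace (actK h F) = counit h * trace F := by
  obtain ⟨p, hp⟩ := exists_eq_ofPoly_add_alpha F
  obtain ⟨q, hq⟩ := exists_actK_ofPoly h p
  have := alpha_mul (antipode h) (singCoord F)
  rw [antipode_antipode] at this
  rw [hp, map_add, map_add, hq, ← this, trace_ofPoly, map_add, trace_ofPoly, trace_alpha,
    trace_alpha, map_mul, counit_antipode]
  ring

/-- The operators `S(h)` and `h` are adjoint for the trace form. -/
theorem trace_actK_antipode_mul (h : HatHT) (F G : K) :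
    trace (actK (antipode h) F * G) = trace (F * actK h G) := by
  induction h using hatHT_induction generalizing F G with
  | hT n =>
    -- Translation invariance of the trace.
    have h1 := trace_actK (T n) (actK (T (-n)) F * G)
    rw [counit_T, one_mul] at h1
    rw [antipode_T, ← h1]
    simp only [actK_T, map_mul]
    rw [← AlgHom.comp_apply, ← shift_add, add_neg_cancel, shift_zero]; rfl
  | hdel =>
    -- Integration by parts: a derivative has trace 0.
    have h1 := trace_actK del (F * G)
    rw [counit_del, zero_mul, actK_del, derivK_mul, map_add] at h1
    have h2 : actK (antipode del) F * G = -(G * derivK F) := by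
      rw [antipode_del, map_neg, LinearMap.neg_apply, actK_del]; ring
    rw [h2, map_neg, actK_del]
    linear_combination -h1
  | hadd x y hx hy => simp only [map_add, LinearMap.add_apply, add_mul, mul_add, hx, hy]
  | hmul x y hx hy =>
    rw [map_mul antipode, actK_mul, hx, hy, ← actK_mul, mul_comm y x]
  | hsmul c x hx => simp only [map_smul, LinearMap.smul_apply, smul_mul_assoc, mul_smul_comm, hx]

/-- The operator on `Ĥ_T` corresponding to multiplication by `τ` on `K_Sing`. -/
def lam : HatHT →ₗ[ℂ] HatHT := singCoord ∘ₗ LinearMap.mulLeft ℂ tau ∘ₗ alpha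

theorem lam_apply (h : HatHT) : lam h = singCoord (tau * alpha h) := rfl

theorem tau_mul_pole (n : ℤ) : tau * pole n = 1 + (n : ℂ) • pole n := by
  rw [Algebra.smul_def]; linear_combination mul_pole n

/-- Here τ/(τ - n) = 1 + n/(τ - n), and `singCoord` discards the constant. With the next formulas, λ
has the single generalized eigenvalue n on the span of the Tⁿ∂ᵏ. -/
theorem lam_single_zero (n : ℤ) (c : ℂ) : lam (AddMonoidAlgebra.single (n, 0) c) =
    (n : ℂ) • AddMonoidAlgebra.single (n, 0) c := by
  have : tau * alpha (AddMonoidAlgebra.single (n, 0) c) = ofPoly (C c) +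
      alpha ((n : ℂ) • AddMonoidAlgebra.single (n, 0) c) := by
    have hC : ofPoly (C c) = algebraMap ℂ K c := rfl
    rw [map_smul, alpha_single, hC]
    simp only [zero_add, pow_one, Nat.factorial_zero, Nat.cast_one, mul_one, mul_smul_comm,
      tau_mul_pole, smul_add, Algebra.algebraMap_eq_smul_one]
    rw [smul_comm]
  rw [lam_apply, this, map_add, singCoord_ofPoly, singCoord_alpha, zero_add]

theorem lam_one : lam 1 = 0 := by
  have := lam_single_zero 0 1
  rw [Int.cast_zero, zero_smul] at this
  exact this

theorem lam_single_succ (n : ℤ) (k : ℕ) (c : ℂ) : lam (AddMonoidAlgebra.single (n, k + 1) c) =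
    (n : ℂ) • AddMonoidAlgebra.single (n, k + 1) c +
      (k + 1 : ℂ) • AddMonoidAlgebra.single (n, k) c := by
  have : tau * alpha (AddMonoidAlgebra.single (n, k + 1) c) =
      alpha ((n : ℂ) • AddMonoidAlgebra.single (n, k + 1) c +
        (k + 1 : ℂ) • AddMonoidAlgebra.single (n, k) c) := by
    rw [map_add, map_smul, map_smul, alpha_single, alpha_single, pow_succ, mul_smul_comm,
      mul_left_comm, tau_mul_pole, mul_add, mul_one, mul_smul_comm, smul_add, smul_smul, smul_smul,
      smul_smul, add_comm]
    congr 2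
    · ring
    · push_cast [Nat.factorial_succ]; ring
  rw [lam_apply, this, singCoord_alpha]

theorem actK_single (n : ℤ) (k : ℕ) (c : ℂ) (F : K) :
    actK (AddMonoidAlgebra.single (n, k) c) F = c • shift n ((derivK ^ k) F) := by
  simp [actK]

theorem derivK_pow_tau_mul (k : ℕ) (F : K) : (derivK ^ (k + 1)) (tau * F) =
    tau * (derivK ^ (k + 1)) F + (k + 1 : ℂ) • (derivK ^ k) F := by
  induction k with
  | zero => simp [derivK_mul, derivK_tau]
  | succ k ih =>
    rw [pow_succ', Module.End.mul_apply, ih, map_add, derivK_mul, derivK_tau, map_smul]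
    rw [← Module.End.mul_apply derivK (derivK ^ (k + 1)), ← pow_succ',
      ← Module.End.mul_apply derivK (derivK ^ k), ← pow_succ']
    push_cast
    simp only [add_smul, one_smul]; ring

/-- The commutation rule `h ∘ τ = τ ∘ h + λ(h)` of operators on `K`. -/
theorem actK_tau_mul (h : HatHT) (F : K) : actK h (tau * F) = tau * actK h F + actK (lam h) F := by
  have hs : ∀ n : ℤ, shift n tau = tau + algebraMap ℂ K n := fun n => liftK_tau _ _
  induction h using AddMonoidAlgebra.induction_linear with
  | zero => simp
  | add f g hf hg => simp only [map_add, LinearMap.add_apply, hf, hg]; ring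
  | single a r =>
    obtain ⟨n, k⟩ := a
    cases k with
    | zero =>
      rw [lam_single_zero, map_smul, LinearMap.smul_apply, actK_single, actK_single]
      simp [hs, Algebra.smul_def]; ring
    | succ k =>
      rw [lam_single_succ, map_add, map_smul, map_smul, LinearMap.add_apply, LinearMap.smul_apply,
        LinearMap.smul_apply, actK_single, actK_single, actK_single, derivK_pow_tau_mul, map_add,
        map_mul, map_smul, hs]
      simp only [Algebra.smul_def]; ring

/-- Under τ ↦ -τ both τ and α change sign, so τ α(h) goes to τ α(S(h)), whereas its singular part
α(λ(h)) changes sign. -/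
theorem lam_antipode (h : HatHT) : lam (antipode h) = -antipode (lam h) := by
  obtain ⟨p, hp⟩ := exists_eq_ofPoly_add_alpha (tau * alpha h)
  have h1 : tau * alpha (antipode h) = ofPoly (p.comp (-X)) + alpha (-antipode (lam h)) := by
    have h2 := congrArg antipodeK hp
    rw [map_mul, map_add, antipodeK_tau, antipodeK_alpha, antipodeK_alpha, ofPoly_comp_neg,
      ← lam_apply] at h2
    rw [map_neg]; linear_combination h2
  rw [lam_apply, h1, map_add, singCoord_ofPoly, singCoord_alpha, zero_add]

theorem trace_alpha_mul_tau_mul (h : HatHT) (p : ℂ[X]) :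
    trace (alpha h * ofPoly (X * p)) = trace (alpha (lam h) * ofPoly p) := by
  obtain ⟨q, hq⟩ := exists_eq_ofPoly_add_alpha (tau * alpha h)
  have : alpha h * ofPoly (X * p) = ofPoly (q * p) + alpha (lam h) * ofPoly p := by
    rw [map_mul, map_mul, lam_apply]
    have : ofPoly X = tau := rfl
    rw [this]
    linear_combination ofPoly p * hq
  rw [this, map_add, trace_ofPoly, zero_add]

theorem trace_alpha_mul_actK (h h' : HatHT) (F : K) :
    trace (alpha h' * actK h F) = trace (alpha (h * h') * F) := by
  rw [alpha_mul, trace_actK_antipode_mul]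

/-- The pairing `(h, p) ↦ Tr(α(h) p) = (h p)(0)` of `Ĥ_T` and `ℂ[τ]`. -/
def pairing : HatHT →ₗ[ℂ] Module.Dual ℂ ℂ[X] :=
  LinearMap.mk₂ ℂ (fun h p => trace (alpha h * ofPoly p)) (fun h h' p => by simp [add_mul])
    (fun c h p => by simp) (fun h p p' => by simp [mul_add]) (fun c h p => by simp)

theorem pairing_apply (h : HatHT) (p : ℂ[X]) : pairing h p = trace (alpha h * ofPoly p) := rfl

theorem pairing_one (h : HatHT) : pairing h 1 = counit h := by
  rw [pairing_apply, map_one, mul_one, trace_alpha]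

theorem pairing_X_mul (h : HatHT) (p : ℂ[X]) : pairing h (X * p) = pairing (lam h) p :=
  trace_alpha_mul_tau_mul h p

theorem pairing_eq_zero {h : HatHT} (hh : ∀ p, pairing h p = 0) : h = 0 := eq_zero_of_trace hh

theorem pairing_singCoord (F : K) (p : ℂ[X]) :
    pairing (singCoord F) p = trace (F * ofPoly p) := by
  obtain ⟨q, hq⟩ := exists_eq_ofPoly_add_alpha F
  conv_rhs => rw [hq, add_mul, ← map_mul, map_add, trace_ofPoly, zero_add]
  rfl

/-! ### Torsion in Ĥ_T under multiplication by a polynomial. -/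

section Torsion

/-- The elements of `Ĥ_T` whose pairing with all multiples of `p` vanishes. -/
def torsion (p : ℂ[X]) : Submodule ℂ HatHT where
  carrier := {h | ∀ r, pairing h (p * r) = 0}
  zero_mem' := by intro r; simp
  add_mem' := by intro a b ha hb r; rw [map_add, LinearMap.add_apply, ha, hb, add_zero]
  smul_mem' := by intro c a ha r; rw [map_smul, LinearMap.smul_apply, ha, smul_zero]

/-- Division by p leaves a remainder of degree below deg p, so a torsion element is determined by
its pairings with Xⁱ, i < deg p. -/
theorem finiteDimensional_torsion {p : ℂ[X]} (hp : p ≠ 0) : FiniteDimensional ℂ (torsion p) := by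
  let L : torsion p →ₗ[ℂ] (Fin p.natDegree → ℂ) :=
    LinearMap.pi fun i => (pairing.flip (X ^ (i : ℕ))) ∘ₗ (torsion p).subtype
  refine FiniteDimensional.of_injective L ?_
  rw [← LinearMap.ker_eq_bot, LinearMap.ker_eq_bot']
  rintro ⟨h, hh⟩ hL
  refine Subtype.ext (pairing_eq_zero fun a => ?_)
  have h1 : ∀ i < p.natDegree, pairing h (X ^ i) = 0 := fun i hi => congrFun hL ⟨i, hi⟩
  rw [← EuclideanDomain.mod_add_div a p, map_add]
  have h2 : (a % p) = ∑ i ∈ Finset.range p.natDegree, C ((a % p).coeff i) * X ^ i := by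
    by_cases h0 : a % p = 0
    · simp [h0]
    · refine as_sum_range_C_mul_X_pow' _ ?_
      exact natDegree_lt_natDegree h0 (EuclideanDomain.mod_lt a hp)
  show pairing h (a % p) + pairing h (p * (a / p)) = 0
  rw [hh, add_zero, h2, map_sum]
  refine Finset.sum_eq_zero fun i hi => ?_
  rw [← smul_eq_C_mul, map_smul, h1 i (Finset.mem_range.1 hi), smul_zero]

/-- Every functional on `Ĥ_T` agrees on the `p`-torsion with the pairing with a polynomial. -/
theorem exists_pairing_eq {p : ℂ[X]} (hp : p ≠ 0) (φ : Module.Dual ℂ HatHT) :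
    ∃ q : ℂ[X], ∀ h ∈ torsion p, φ h = pairing h q := by
  have := finiteDimensional_torsion hp
  let B : torsion p →ₗ[ℂ] ℂ[X] →ₗ[ℂ] ℂ := pairing ∘ₗ (torsion p).subtype
  have hB : Function.Injective B := by
    rw [← LinearMap.ker_eq_bot, LinearMap.ker_eq_bot']
    intro h hh
    exact Subtype.ext (pairing_eq_zero fun a => LinearMap.congr_fun hh a)
  -- An injective map from a finite-dimensional space into the dual of ℂ[X] has a surjective
  -- transpose.
  obtain ⟨q, hq⟩ := LinearMap.flip_surjective_iff₁.2 hB (φ ∘ₗ (torsion p).subtype)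
  exact ⟨q, fun h hh => (LinearMap.congr_fun hq ⟨h, hh⟩).symm⟩

end Torsion

/-! ### Rational distributions and their kernels. -/

section RationalDistributions

variable {W W' : Type*} [AddCommGroup W] [Module ℂ W] [AddCommGroup W'] [Module ℂ W']

theorem singPairing_tmul' (w : W) (h : HatHT) (p : ℂ[X]) :
    singPairing W (w ⊗ₜ h) p = pairing h p • w := singPairing_tmul w h p

theorem singPairing_eq (κ : W ⊗[ℂ] HatHT) (p : ℂ[X]) :
    singPairing W κ p = TensorProduct.rid ℂ W ((pairing.flip p).lTensor W κ) := by
  induction κ using TensorProduct.induction_on with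
  | zero => simp
  | tmul w h => simp [singPairing_tmul']
  | add x y hx hy => simp only [map_add, LinearMap.add_apply, hx, hy]

/-- In coordinates of W this is the statement for elements of Ĥ_T. The polynomial q is chosen before
κ; this uniformity is essential for products of fields, where κ varies with the test function and
the vector. -/
theorem exists_rid_lTensor_eq_singPairing {p : ℂ[X]} (hp : p ≠ 0) (φ : Module.Dual ℂ HatHT) :
    ∃ q : ℂ[X], ∀ κ : W ⊗[ℂ] HatHT, (∀ r, singPairing W κ (p * r) = 0) →
      TensorProduct.rid ℂ W (φ.lTensor W κ) = singPairing W κ q := by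
  classical
  obtain ⟨q, hq⟩ := exists_pairing_eq hp φ
  refine ⟨q, fun κ hκ => ?_⟩
  let b := Module.Basis.ofVectorSpace ℂ W
  have hc : ∀ (i) (ψ : Module.Dual ℂ HatHT) (κ : W ⊗[ℂ] HatHT),
      b.coord i (TensorProduct.rid ℂ W (ψ.lTensor W κ)) =
        ψ (TensorProduct.equivFinsuppOfBasisLeft b κ i) := by
    intro i ψ κ
    induction κ using TensorProduct.induction_on with
    | zero => simp
    | tmul w h => simp [mul_comm (b.repr w i)]
    | add x y hx hy => simp only [map_add, Finsupp.add_apply, hx, hy]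
  rw [singPairing_eq]
  refine b.ext_elem fun i => ?_
  have h1 := hc i φ κ
  have h2 := hc i (pairing.flip q) κ
  simp only [Module.Basis.coord_apply] at h1 h2
  rw [h1, h2]
  refine hq _ fun r => ?_
  have h3 := hc i (pairing.flip (p * r)) κ
  rw [← singPairing_eq, hκ, map_zero] at h3
  exact h3.symm

theorem singKer_apply_of_eq {D : Dist W} {κ : W ⊗[ℂ] HatHT}
    (h : ∀ p, D (ofPoly p) = singPairing W κ p) : singKer D = κ := by
  have hκ : D ∘ₗ ofPoly.toLinearMap = singPairing W κ := LinearMap.ext h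
  exact singPairing_injective ((singKer_spec ⟨κ, hκ⟩).symm.trans hκ)

theorem RatSing.of_eq {D : Dist W} {κ : W ⊗[ℂ] HatHT}
    (h : ∀ p, D (ofPoly p) = singPairing W κ p) : RatSing D := ⟨κ, LinearMap.ext h⟩

theorem RatSing.apply {D : Dist W} (hD : RatSing D) (p : ℂ[X]) :
    D (ofPoly p) = singPairing W (singKer D) p := LinearMap.congr_fun (singKer_spec hD) p

theorem singKer_eq_zero {D : Dist W} (h : ∀ p, D (ofPoly p) = 0) : singKer D = 0 :=
  singKer_apply_of_eq fun p => by rw [h, map_zero, LinearMap.zero_apply]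

theorem exists_clear_singCoord (h : HatHT) : ∃ m ∈ translates, ∀ q, pairing h (m * q) = 0 := by
  obtain ⟨m, hm, p, hp⟩ := exists_ofPoly_mul_eq (alpha h)
  refine ⟨m, hm, fun q => ?_⟩
  rw [pairing_apply, map_mul ofPoly, ← mul_assoc, mul_comm (alpha h), hp, ← map_mul, trace_ofPoly]

theorem RatSing.exists_clear {D : Dist W} (hD : RatSing D) :
    ∃ m ∈ translates, ∀ q, D (ofPoly (m * q)) = 0 := by
  simp only [hD.apply]
  generalize singKer D = κ
  induction κ using TensorProduct.induction_on with
  | zero => exact ⟨1, one_mem _, fun q => by simp⟩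
  | tmul w h =>
    obtain ⟨m, hm, hq⟩ := exists_clear_singCoord h
    exact ⟨m, hm, fun q => by rw [singPairing_tmul', hq, zero_smul]⟩
  | add x y hx hy =>
    obtain ⟨m, hm, hq⟩ := hx
    obtain ⟨m', hm', hq'⟩ := hy
    refine ⟨m * m', mul_mem hm hm', fun q => ?_⟩
    rw [map_add, LinearMap.add_apply, mul_assoc, hq, mul_left_comm, hq', add_zero]

/-- A functional killed by multiples of τ + n is a multiple of evaluation at -n, which is the trace
against the simple pole 1/(τ + n). Products of translates are handled one factor at a time. -/
theorem exists_singPairing_eq {m : ℂ[X]} (hm : m ∈ translates) :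
    ∀ D : ℂ[X] →ₗ[ℂ] W, (∀ q, D (m * q) = 0) → ∃ κ, D = singPairing W κ := by
  rw [translates] at hm
  induction hm using Submonoid.closure_induction with
  | mem a ha =>
    obtain ⟨n, rfl⟩ := ha
    intro D hD
    refine ⟨D 1 ⊗ₜ T (-n), LinearMap.ext fun p => ?_⟩
    have hX : (X + C (n : ℂ)) = X - C ((-n : ℤ) : ℂ) := by simp
    dsimp only at hD
    rw [hX] at hD
    have hp : p = (X - C ((-n : ℤ) : ℂ)) * (p /ₘ (X - C ((-n : ℤ) : ℂ))) +
        C (p.eval ((-n : ℤ) : ℂ)) := by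
      have h5 := modByMonic_add_div p (X - C ((-n : ℤ) : ℂ))
      rw [modByMonic_X_sub_C_eq_C_eval, add_comm] at h5
      exact h5.symm
    have h1 : ∀ c : ℂ, D (C c) = c • D 1 := by
      intro c; rw [← map_smul, smul_eq_C_mul, mul_one]
    have h2 : ∀ q, pairing (T (-n)) ((X - C ((-n : ℤ) : ℂ)) * q) = 0 := by
      intro q
      rw [pairing_apply, alpha_T, map_mul ofPoly, ofPoly_X_sub_C, ← mul_assoc, mul_comm (pole _), mul_pole,
        one_mul, trace_ofPoly]
    rw [singPairing_tmul']
    conv_lhs => rw [hp, map_add, hD, zero_add, h1]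
    conv_rhs => rw [hp, map_add, h2, zero_add]
    have h3 : pairing (T (-n)) (C (p.eval ((-n : ℤ) : ℂ))) = p.eval ((-n : ℤ) : ℂ) := by
      rw [← mul_one (C _), ← smul_eq_C_mul, map_smul, pairing_one, counit_T, smul_eq_mul, mul_one]
    rw [h3]
  | one =>
    intro D hD
    exact ⟨0, LinearMap.ext fun p => by simpa using hD p⟩
  | mul a b ha hb iha ihb =>
    intro D hD
    obtain ⟨κ', hκ'⟩ := ihb (D ∘ₗ LinearMap.mulLeft ℂ a) (fun q => by
      rw [LinearMap.comp_apply, LinearMap.mulLeft_apply, ← mul_assoc]; exact hD q)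
    obtain ⟨u, hu⟩ := isUnit_ofPoly ha
    -- θ is division by a on K_Sing, so θ(h) pairs with aq as h pairs with q.
    let θ : HatHT →ₗ[ℂ] HatHT := singCoord ∘ₗ LinearMap.mulRight ℂ ((u⁻¹ : Kˣ) : K) ∘ₗ alpha
    have hθ : ∀ (κ : W ⊗[ℂ] HatHT) (q : ℂ[X]),
        singPairing W (θ.lTensor W κ) (a * q) = singPairing W κ q := by
      intro κ q
      induction κ using TensorProduct.induction_on with
      | zero => simp
      | tmul w h =>
        rw [LinearMap.lTensor_tmul, singPairing_tmul', singPairing_tmul']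
        congr 1
        show pairing (singCoord (alpha h * ((u⁻¹ : Kˣ) : K))) (a * q) = _
        rw [pairing_singCoord, map_mul ofPoly, ← hu, mul_assoc, Units.inv_mul_cancel_left, pairing_apply]
      | add x y hx hy => simp only [map_add, LinearMap.add_apply, hx, hy]
    -- Once a kernel for D(a · ) has been divided by a and subtracted, the rest of D is killed by a
    -- alone.
    obtain ⟨κ'', hκ''⟩ := iha (D - singPairing W (θ.lTensor W κ')) (fun q => by
      rw [LinearMap.sub_apply, hθ, ← hκ']; exact sub_self _)
    exact ⟨κ'' + θ.lTensor W κ', by rw [map_add, ← hκ'', sub_add_cancel]⟩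

/-- A distribution is rational if and only if its restriction to `ℂ[τ]` is killed by a product of
translates of `τ`. -/
theorem ratSing_iff {D : Dist W} : RatSing D ↔ ∃ m ∈ translates, ∀ q, D (ofPoly (m * q)) = 0 :=
  ⟨RatSing.exists_clear, fun ⟨_, hm, h⟩ => exists_singPairing_eq hm _ h⟩

theorem mulDist_apply (G : K) (D : Dist W) (F : K) : mulDist G D F = D (G * F) := rfl

theorem RatSing.mulDist {D : Dist W} (hD : RatSing D) (G : K) : RatSing (mulDist G D) := by
  obtain ⟨m, hm, h⟩ := hD.exists_clear
  obtain ⟨m', hm', a, ha⟩ := exists_ofPoly_mul_eq G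
  refine ratSing_iff.2 ⟨m' * m, mul_mem hm' hm, fun q => ?_⟩
  have : G * ofPoly (m' * m * q) = ofPoly (m * (a * q)) := by
    simp only [map_mul]
    linear_combination ofPoly m * ofPoly q * ha
  rw [mulDist_apply, this, h]

theorem RatSing.add {D D' : Dist W} (hD : RatSing D) (hD' : RatSing D') : RatSing (D + D') := by
  refine RatSing.of_eq (κ := singKer D + singKer D') fun p => ?_
  rw [map_add, LinearMap.add_apply, LinearMap.add_apply, hD.apply, hD'.apply]

theorem RatSing.neg {D : Dist W} (hD : RatSing D) : RatSing (-D) := by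
  refine RatSing.of_eq (κ := -singKer D) fun p => ?_
  rw [map_neg, LinearMap.neg_apply, LinearMap.neg_apply, hD.apply]

theorem RatSing.sub {D D' : Dist W} (hD : RatSing D) (hD' : RatSing D') : RatSing (D - D') := by
  rw [sub_eq_add_neg]; exact hD.add hD'.neg

theorem RatSing.zero : RatSing (0 : Dist W) := RatSing.of_eq (κ := 0) fun p => by simp

theorem singPairing_rTensor (L : W →ₗ[ℂ] W') (κ : W ⊗[ℂ] HatHT) (p : ℂ[X]) :
    singPairing W' (L.rTensor HatHT κ) p = L (singPairing W κ p) := by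
  induction κ using TensorProduct.induction_on with
  | zero => simp
  | tmul w h => rw [LinearMap.rTensor_tmul, singPairing_tmul', singPairing_tmul', map_smul]
  | add x y hx hy => simp only [map_add, LinearMap.add_apply, hx, hy]

theorem singKer_comp {D : Dist W} (hD : RatSing D) (L : W →ₗ[ℂ] W') :
    singKer (L ∘ₗ D) = L.rTensor HatHT (singKer D) :=
  singKer_apply_of_eq fun p => by rw [singPairing_rTensor, LinearMap.comp_apply, hD.apply]

theorem RatSing.comp {D : Dist W} (hD : RatSing D) (L : W →ₗ[ℂ] W') : RatSing (L ∘ₗ D) :=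
  RatSing.of_eq (κ := L.rTensor HatHT (singKer D)) fun p => by
    rw [LinearMap.comp_apply, hD.apply, singPairing_rTensor]

theorem singKer_mulDist_tau {D : Dist W} (hD : RatSing D) :
    singKer (HTVertex.mulDist tau D) = lam.lTensor W (singKer D) := by
  refine singKer_apply_of_eq fun p => ?_
  have : tau * ofPoly p = ofPoly (X * p) := (map_mul _ _ _).symm
  rw [mulDist_apply, this, hD.apply]
  generalize singKer D = κ
  induction κ using TensorProduct.induction_on with
  | zero => simp
  | tmul w h => rw [LinearMap.lTensor_tmul, singPairing_tmul', singPairing_tmul', pairing_X_mul]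
  | add x y hx hy => simp only [map_add, LinearMap.add_apply, hx, hy]

/-- A nonzero polynomial is not a zero divisor on rational distributions. -/
theorem RatSing.eq_zero_of_mul {E : Dist W} (hE : RatSing E) {p : ℂ[X]} (hp : p ≠ 0)
    (h : ∀ A, E (ofPoly p * A) = 0) : E = 0 := by
  induction hd : p.natDegree using Nat.strong_induction_on generalizing p with
  | _ d ih =>
    -- Factors τ + n are units of K and can be cancelled; what then remains of p is coprime to every
    -- product of translates.
    by_cases hn : ∃ n : ℤ, X + C (n : ℂ) ∣ p
    · obtain ⟨n, p', rfl⟩ := hn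
      have hp' : p' ≠ 0 := right_ne_zero_of_mul hp
      have hm : X + C (n : ℂ) ∈ translates := Submonoid.subset_closure ⟨n, rfl⟩
      refine ih p'.natDegree ?_ hp' (fun A => ?_) rfl
      · rw [← hd, natDegree_mul (X_add_C_ne_zero _) hp', natDegree_X_add_C]; omega
      · obtain ⟨u, hu⟩ := isUnit_ofPoly hm
        have := h (((u⁻¹ : Kˣ) : K) * A)
        rwa [map_mul ofPoly, ← hu, mul_mul_mul_comm, Units.mul_inv, one_mul] at this
    · have hcop : ∀ m ∈ translates, IsCoprime m p := by
        intro m hm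
        rw [translates] at hm
        induction hm using Submonoid.closure_induction with
        | mem a ha =>
          obtain ⟨n, rfl⟩ := ha
          exact (irreducible_of_degree_eq_one (degree_X_add_C _)).coprime_iff_not_dvd.2 fun hd => hn ⟨n, hd⟩
        | one => exact isCoprime_one_left
        | mul a b _ _ ha hb => exact ha.mul_left hb
      obtain ⟨m₀, hm₀, h₀⟩ := hE.exists_clear
      ext A
      obtain ⟨m, hm, a, ha⟩ := exists_ofPoly_mul_eq A
      obtain ⟨u, v, huv⟩ := hcop _ (mul_mem hm₀ hm)
      -- Bézout: m₀ clears the singular part of E and m the denominator of A. The first summand is a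
      -- polynomial multiple of m₀, the second a multiple of p, and E kills both.
      have h1 : A = ofPoly (m₀ * (u * a)) + ofPoly p * (ofPoly v * A) := by
        have := congrArg ofPoly huv
        simp only [map_add, map_mul, map_one] at this ⊢
        linear_combination (-A) * this + ofPoly u * ofPoly m₀ * ha
      rw [h1, map_add, h₀, h, add_zero, LinearMap.zero_apply]

end RationalDistributions

/-! ### Polynomials in commuting operators. -/

section Operators

variable {M N : Type*} [AddCommGroup M] [Module ℂ M] [AddCommGroup N] [Module ℂ N]

theorem map_aeval_end {x : Module.End ℂ M} {y : Module.End ℂ N} (L : M →ₗ[ℂ] N)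
    (h : ∀ m, L (x m) = y (L m)) (p : ℂ[X]) (m : M) : L (aeval x p m) = aeval y p (L m) := by
  induction p using Polynomial.induction_on generalizing m with
  | C a => simp
  | add p q hp hq => simp only [map_add, LinearMap.add_apply, hp, hq]
  | monomial n a ih =>
    rw [pow_succ, ← mul_assoc, map_mul (aeval x) (_ * _), map_mul (aeval y) (_ * _),
      Module.End.mul_apply, Module.End.mul_apply, ih, aeval_X, aeval_X, h]

theorem Commute.aeval_apply {x y : Module.End ℂ M} (h : Commute x y) (p : ℂ[X]) (m : M) :
    y (aeval x p m) = aeval x p (y m) :=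
  map_aeval_end y (fun m => LinearMap.congr_fun h.symm m) p m

/-- The b-eigenspace of y is stable under x, and on it x - y + b is x. -/
theorem aeval_add_algebraMap_apply {x y : Module.End ℂ M} (hxy : Commute x y) {b : ℂ} {r : M}
    (hr : y r = b • r) (q : ℂ[X]) : aeval (x - y + algebraMap ℂ _ b) q r = aeval x q r := by
  induction q using Polynomial.induction_on with
  | C a => simp
  | add p q hp hq => simp only [map_add, LinearMap.add_apply, hp, hq]
  | monomial n a ih =>
    have h1 : ∀ z : Module.End ℂ M, aeval z (C a * X ^ (n + 1)) r = z (aeval z (C a * X ^ n) r) := by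
      intro z
      rw [pow_succ, mul_left_comm, mul_comm, mul_assoc, mul_comm, mul_assoc, mul_comm (X ^ n),
        map_mul, Module.End.mul_apply, aeval_X]
    rw [h1, h1, ih]
    have h2 := Commute.aeval_apply hxy (C a * X ^ n) r
    rw [hr, map_smul] at h2
    rw [LinearMap.add_apply, LinearMap.sub_apply, h2, Module.algebraMap_end_apply, sub_add_cancel]

/-- If commuting operators `x`, `y` are algebraic at `t`, then so is `x - y`. -/
theorem exists_aeval_sub_eq_zero {x y : Module.End ℂ M} (hxy : Commute x y) {p s : ℂ[X]}
    (hp : p ≠ 0) (hs : s ≠ 0) {t : M} (hpt : aeval x p t = 0) (hst : aeval y s t = 0) :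
    ∃ R : ℂ[X], R ≠ 0 ∧ aeval (x - y) R t = 0 := by
  induction hd : s.natDegree generalizing s t with
  | zero =>
    obtain ⟨c, rfl⟩ := natDegree_eq_zero.1 hd
    have hc : c ≠ 0 := by rintro rfl; simp at hs
    refine ⟨1, one_ne_zero, ?_⟩
    rw [aeval_C, Module.algebraMap_end_apply] at hst
    simpa using (smul_eq_zero.1 hst).resolve_left hc
  | succ d ih =>
    obtain ⟨b, hb⟩ := IsAlgClosed.exists_root s (by
      rw [degree_eq_natDegree hs, hd]; exact_mod_cast Nat.succ_ne_zero d)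
    obtain ⟨s', rfl⟩ := dvd_iff_isRoot.2 hb
    have hs' : s' ≠ 0 := right_ne_zero_of_mul hs
    have hcomm : ∀ m, aeval y (X - C b) (aeval x p m) = aeval x p (aeval y (X - C b) m) := by
      intro m
      simp only [map_sub, aeval_X, aeval_C, LinearMap.sub_apply, Module.algebraMap_end_apply,
        Commute.aeval_apply hxy, map_smul]
    -- The vector (y - b)t is killed by the polynomial s', of degree one less, and still by p(x).
    obtain ⟨R, hR, hRt⟩ := ih (s := s') (t := aeval y (X - C b) t) hs'
      (by rw [← hcomm, hpt, map_zero])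
      (by rwa [← Module.End.mul_apply, ← map_mul, mul_comm])
      (by rw [natDegree_mul (X_sub_C_ne_zero b) hs', natDegree_X_sub_C] at hd; omega)
    -- Since R(x - y)t is an eigenvector of y with eigenvalue b, evaluating p(X + b) at x - y acts
    -- on it as p(x), which commutes past R(x - y) and kills t.
    refine ⟨p.comp (X + C b) * R, mul_ne_zero (comp_X_add_C_ne_zero_iff.2 hp) hR, ?_⟩
    · have hyz : Commute (x - y) y := hxy.sub_left (Commute.refl y)
      have hxz : Commute (x - y) x := (Commute.refl x).sub_left hxy.symm
      have hr : y (aeval (x - y) R t) = b • aeval (x - y) R t := by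
        have h1 := hRt
        simp only [map_sub, aeval_X, aeval_C, LinearMap.sub_apply, Module.algebraMap_end_apply,
          map_smul] at h1
        rw [← Commute.aeval_apply hyz] at h1
        exact sub_eq_zero.1 h1
      rw [map_mul, Module.End.mul_apply, aeval_comp, map_add, aeval_X, aeval_C,
        aeval_add_algebraMap_apply hxy hr]
      have h2 := map_aeval_end (x := x - y) (y := x - y) (aeval x p)
        (fun m => (map_aeval_end (x - y) (fun m => LinearMap.congr_fun hxz m) p m).symm) R t
      rw [h2, hpt, map_zero]

variable {ι W : Type*} [AddCommGroup W] [Module ℂ W]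

theorem commute_funLeft {σ τ : ι → ι} (h : ∀ i, σ (τ i) = τ (σ i)) :
    Commute (LinearMap.funLeft ℂ W σ) (LinearMap.funLeft ℂ W τ) :=
  LinearMap.ext fun t => funext fun i => congrArg t (h i).symm

theorem polyDiff_X_mul (q : ℂ[X]) (A B : K) : polyDiff (X * q) * (A ⊗ₜ[ℂ] B) =
    polyDiff q * ((tau * A) ⊗ₜ[ℂ] B) - polyDiff q * (A ⊗ₜ[ℂ] (tau * B)) := by
  have : polyDiff X = tau ⊗ₜ 1 - 1 ⊗ₜ tau := aeval_X _
  have h : polyDiff X * (A ⊗ₜ[ℂ] B) = (tau * A) ⊗ₜ[ℂ] B - A ⊗ₜ[ℂ] (tau * B) := by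
    rw [this]
    refine (sub_mul (α := K ⊗[ℂ] K) _ _ _).trans ?_
    rw [Algebra.TensorProduct.tmul_mul_tmul, Algebra.TensorProduct.tmul_mul_tmul, one_mul, one_mul]
  rw [map_mul, mul_comm _ (polyDiff q), mul_assoc, h]
  exact mul_sub (α := K ⊗[ℂ] K) _ _ _

/-- On functions given by a linear map on `K ⊗ K`, differences of multiplication operators act
through `polyDiff`. -/
theorem aeval_funLeft_sub_apply {σ₁ σ₂ : ι → ι} (j : K → K → ι)
    (h₁ : ∀ A B, σ₁ (j A B) = j (tau * A) B) (h₂ : ∀ A B, σ₂ (j A B) = j A (tau * B))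
    (H : K ⊗[ℂ] K →ₗ[ℂ] W) (t : ι → W) (ht : ∀ A B, t (j A B) = H (A ⊗ₜ B)) (p : ℂ[X]) (A B : K) :
    aeval (LinearMap.funLeft ℂ W σ₁ - LinearMap.funLeft ℂ W σ₂) p t (j A B) =
      H (polyDiff p * (A ⊗ₜ B)) := by
  induction p using Polynomial.induction_on generalizing A B with
  | C a => simp [ht, polyDiff, Algebra.algebraMap_eq_smul_one]
  | add p q hp hq => simp only [map_add, LinearMap.add_apply, Pi.add_apply, add_mul, hp, hq]
  | monomial n a ih =>
    rw [pow_succ, ← mul_assoc, mul_comm _ X, polyDiff_X_mul, map_mul (aeval _) X,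
      Module.End.mul_apply, aeval_X, map_sub, ← ih, ← ih]
    simp only [LinearMap.sub_apply, Pi.sub_apply, LinearMap.funLeft_apply, h₁, h₂]

end Operators

/-! ### Normal ordered products as components of two-variable distributions. -/

section FieldProducts

variable {W V : Type*} [AddCommGroup W] [Module ℂ W] [AddCommGroup V] [Module ℂ V]

theorem evalHat_inr (D : Dist W) (F : K) : evalHat D (0, F) = D F := by
  simp [evalHat]

theorem evalHat_inl (D : Dist W) (φ : Module.Dual ℂ HatHT) :
    evalHat D (φ, 0) = TensorProduct.rid ℂ W (φ.lTensor W (singKer D)) := by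
  simp [evalHat]

theorem compAct_inr (h : HatHT) (F : K) : compAct h (0, F) = (0, actK h F) := by
  simp [compAct]

theorem compAct_inl (h : HatHT) (φ : Module.Dual ℂ HatHT) :
    compAct h (φ, 0) = (φ ∘ₗ LinearMap.mulLeft ℂ h, 0) := by
  simp [compAct, LinearMap.dualMap_def]; rfl

theorem compAntipode_inr (F : K) : compAntipode (0, F) = (0, antipodeK F) := by
  simp [compAntipode]

theorem compAntipode_inl (φ : Module.Dual ℂ HatHT) :
    compAntipode (φ, 0) = (φ ∘ₗ antipode.toLinearMap, 0) := by
  simp [compAntipode, LinearMap.dualMap_def]; rfl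

theorem component_apply (f : Dist (Module.End ℂ V)) (F : Comp) (v : V) :
    component f F v = evalHat (f.flip v) F := rfl

theorem component_inr (f : Dist (Module.End ℂ V)) (F : K) : component f (0, F) = f F :=
  LinearMap.ext fun _ => evalHat_inr _ _

theorem prodLeft_tmul (f : Dist (Module.End ℂ V)) (F : Comp) (w : V) (h : HatHT) :
    prodLeft f F (w ⊗ₜ h) = evalHat (f.flip w) (compAct (antipode h) F) := rfl

theorem prodRight_tmul (g : Dist (Module.End ℂ V)) (F : Comp) (G : K) (w : V) (h : HatHT) :
    prodRight g F G (w ⊗ₜ h) = evalHat (mulDist G (g.flip w)) (compAntipode (compAct h F)) := rfl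

theorem prodLeft_inr_tmul (f : Dist (Module.End ℂ V)) (F : K) (w : V) (h : HatHT) :
    prodLeft f (0, F) (w ⊗ₜ h) = f (actK (antipode h) F) w := by
  rw [prodLeft_tmul, compAct_inr, evalHat_inr]; rfl

theorem prodRight_inr_tmul (g : Dist (Module.End ℂ V)) (F G : K) (w : V) (h : HatHT) :
    prodRight g (0, F) G (w ⊗ₜ h) = g (G * antipodeK (actK h F)) w := by
  rw [prodRight_tmul, compAct_inr, compAntipode_inr, evalHat_inr]; rfl

theorem nprod_apply (f g : Dist (Module.End ℂ V)) (F : Comp) (G : K) (v : V) :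
    nprod f F g G v =
      prodLeft f F (singKer (mulDist G (g.flip v))) - prodRight g F G (singKer (f.flip v)) := rfl

theorem prodLeft_add_right (f : Dist (Module.End ℂ V)) (F F' : Comp) :
    prodLeft f (F + F') = prodLeft f F + prodLeft f F' :=
  TensorProduct.ext' fun w h => by simp [prodLeft_tmul]

theorem prodRight_add_right (g : Dist (Module.End ℂ V)) (F F' : Comp) (G : K) :
    prodRight g (F + F') G = prodRight g F G + prodRight g F' G :=
  TensorProduct.ext' fun w h => by simp [prodRight_tmul]

theorem nprod_add_right (f g : Dist (Module.End ℂ V)) (F F' : Comp) :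
    nprod f (F + F') g = nprod f F g + nprod f F' g := by
  ext G v
  simp only [LinearMap.add_apply, nprod_apply, prodLeft_add_right, prodRight_add_right]
  abel

theorem component_add (f : Dist (Module.End ℂ V)) (F F' : Comp) :
    component f (F + F') = component f F + component f F' :=
  LinearMap.ext fun v => map_add (evalHat (f.flip v)) F F'

theorem commutator_tmul (f g : Dist (Module.End ℂ V)) (A B : K) (v : V) :
    commutator f g (A ⊗ₜ B) v = f A (g B v) - g B (f A v) := rfl

theorem flip_mulDist (A : K) (f : Dist (Module.End ℂ V)) (v : V) :
    (mulDist A f).flip v = mulDist A (f.flip v) := rfl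

theorem mulDist_one (D : Dist W) : mulDist 1 D = D := by
  ext F; rw [mulDist_apply, one_mul]

theorem mulDist_mulDist (A B : K) (D : Dist W) : mulDist A (mulDist B D) = mulDist (B * A) D := by
  ext F; simp only [mulDist_apply, mul_assoc]

theorem IsField.mulDist {f : Dist (Module.End ℂ V)} (hf : IsField f) (A : K) :
    IsField (mulDist A f) := fun v => (hf v).mulDist A

theorem IsField.sub {f g : Dist (Module.End ℂ V)} (hf : IsField f) (hg : IsField g) :
    IsField (f - g) := fun v => (hf v).sub (hg v)

theorem mutuallyRational_iff {f g : Dist (Module.End ℂ V)} : MutuallyRational f g ↔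
    ∃ p : ℂ[X], p ≠ 0 ∧ ∀ (A B : K) (v : V), commutator f g (polyDiff p * (A ⊗ₜ B)) v = 0 := by
  constructor
  · rintro ⟨p, hp, h⟩
    exact ⟨p, hp, fun A B v => by rw [h, LinearMap.zero_apply]⟩
  · rintro ⟨p, hp, h⟩
    refine ⟨p, hp, fun z => ?_⟩
    induction z using TensorProduct.induction_on with
    | zero => rw [mul_zero, map_zero]
    | tmul A B => exact LinearMap.ext (h A B)
    | add x y hx hy => rw [mul_add, map_add, hx, hy, add_zero]

/-- The factor τ becomes τ₁ - τ₂. Moving S(h) past τ leaves λ(S(h)) = -S(λ(h)), and λ on the kernel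
is multiplication by τ₂. -/
theorem prodLeft_inr_tau_mul (f : Dist (Module.End ℂ V)) (F : K) (κ : V ⊗[ℂ] HatHT) :
    prodLeft f (0, tau * F) κ =
      prodLeft (mulDist tau f) (0, F) κ - prodLeft f (0, F) (lam.lTensor V κ) := by
  induction κ using TensorProduct.induction_on with
  | zero => simp
  | tmul w h =>
    rw [LinearMap.lTensor_tmul, prodLeft_inr_tmul, prodLeft_inr_tmul, prodLeft_inr_tmul,
      actK_tau_mul, lam_antipode, map_neg, LinearMap.neg_apply, map_add, map_neg, mulDist_apply,
      LinearMap.add_apply, LinearMap.neg_apply, sub_eq_add_neg]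
  | add x y hx hy => simp only [map_add, hx, hy]; abel

theorem prodRight_inr_tau_mul (g : Dist (Module.End ℂ V)) (F G : K) (κ : V ⊗[ℂ] HatHT) :
    prodRight g (0, tau * F) G κ =
      prodRight g (0, F) G (lam.lTensor V κ) - prodRight g (0, F) (tau * G) κ := by
  induction κ using TensorProduct.induction_on with
  | zero => simp
  | tmul w h =>
    have : G * antipodeK (actK h (tau * F)) =
        G * antipodeK (actK (lam h) F) - tau * G * antipodeK (actK h F) := by
      rw [actK_tau_mul, map_add, map_mul, antipodeK_tau]; ring
    rw [LinearMap.lTensor_tmul, prodRight_inr_tmul, prodRight_inr_tmul, prodRight_inr_tmul, this,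
      map_sub, LinearMap.sub_apply]
  | add x y hx hy => simp only [map_add, hx, hy]; abel

variable {f g h : Dist (Module.End ℂ V)}

/-- The factor τ of F(τ) is τ₁ - τ₂ in both expansions of F(τ₁ - τ₂). Iterating this turns
multiplication of F by a polynomial into an operator on products. -/
theorem nprod_inr_tau_mul (hf : IsField f) (hg : IsField g) (F G : K) :
    nprod f (0, tau * F) g G = nprod (mulDist tau f) (0, F) g G - nprod f (0, F) g (tau * G) := by
  ext v
  have h1 : mulDist (tau * G) (g.flip v) = mulDist tau (mulDist G (g.flip v)) := by
    rw [mulDist_mulDist, mul_comm]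
  rw [LinearMap.sub_apply, nprod_apply, nprod_apply, nprod_apply, prodLeft_inr_tau_mul,
    prodRight_inr_tau_mul, h1, singKer_mulDist_tau ((hg v).mulDist G), flip_mulDist,
    singKer_mulDist_tau (hf v)]
  abel

theorem actK_one (h : HatHT) : actK h 1 = algebraMap ℂ K (counit h) := by
  induction h using hatHT_induction with
  | hT n => rw [actK_T, counit_T, map_one, map_one]
  | hdel => rw [actK_del, counit_del, derivK_one, map_zero]
  | hadd x y hx hy => simp only [map_add, LinearMap.add_apply, hx, hy]
  | hmul x y hx hy =>
    rw [actK_mul, hy, Algebra.algebraMap_eq_smul_one, map_smul, hx, map_mul, map_mul, mul_comm,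
      Algebra.smul_def]
  | hsmul c x hx =>
    rw [map_smul, LinearMap.smul_apply, hx, map_smul, smul_eq_mul, map_mul, Algebra.smul_def]

/-- The constant 1 has the same expansion in either variable, so only the commutator remains;
formally, Ĥ_T acts on 1 through ε. -/
theorem nprod_inr_one (hf : IsField f) (hg : IsField g) (B : K) :
    nprod f (0, 1) g B = commutator f g (1 ⊗ₜ B) := by
  have hL : ∀ κ, prodLeft f (0, 1) κ = f 1 (singPairing V κ 1) := by
    intro κ
    induction κ using TensorProduct.induction_on with
    | zero => simp
    | tmul w x =>
      rw [prodLeft_inr_tmul, actK_one, counit_antipode, singPairing_tmul', pairing_one,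
        Algebra.algebraMap_eq_smul_one, map_smul, map_smul, LinearMap.smul_apply]
    | add x y hx hy => simp only [map_add, LinearMap.add_apply, hx, hy]
  have hR : ∀ κ, prodRight g (0, 1) B κ = g B (singPairing V κ 1) := by
    intro κ
    induction κ using TensorProduct.induction_on with
    | zero => simp
    | tmul w x =>
      rw [prodRight_inr_tmul, actK_one, singPairing_tmul', pairing_one, AlgHom.commutes,
        Algebra.algebraMap_eq_smul_one, mul_smul_comm, mul_one, map_smul, map_smul,
        LinearMap.smul_apply]
    | add x y hx hy => simp only [map_add, LinearMap.add_apply, hx, hy]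
  ext v
  rw [nprod_apply, hL, hR, ← ((hg v).mulDist B).apply, ← (hf v).apply, commutator_tmul, map_one ofPoly,
    mulDist_apply, mul_one]
  rfl

theorem nprod_mulDist_inr_one (hf : IsField f) (hg : IsField g) (A B : K) :
    nprod (mulDist A f) (0, 1) g B = commutator f g (A ⊗ₜ B) := by
  rw [nprod_inr_one (hf.mulDist A) hg]
  ext v
  rw [commutator_tmul, commutator_tmul, mulDist_apply, mul_one]

/-- Multiplication by `τ` in the first factor of `K × K × γ`. -/
def mulFst (γ : Type*) (z : K × K × γ) : K × K × γ := (tau * z.1, z.2)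

/-- Multiplication by `τ` in the second factor of `K × K × γ`. -/
def mulSnd (γ : Type*) (z : K × K × γ) : K × K × γ := (z.1, tau * z.2.1, z.2.2)

/-- The operator of multiplication by `τ₁ - τ₂` on functions of two elements of `K`. -/
def mulDiff (γ W : Type*) [AddCommGroup W] [Module ℂ W] : Module.End ℂ (K × K × γ → W) :=
  LinearMap.funLeft ℂ W (mulFst γ) - LinearMap.funLeft ℂ W (mulSnd γ)

theorem mulDiff_apply {γ : Type*} (t : K × K × γ → W) (A B : K) (c : γ) :
    mulDiff γ W t (A, B, c) = t (tau * A, B, c) - t (A, tau * B, c) := rfl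

theorem aeval_mulDiff_apply {γ : Type*} (c : γ) (H : K ⊗[ℂ] K →ₗ[ℂ] W) (t : K × K × γ → W)
    (ht : ∀ A B, t (A, B, c) = H (A ⊗ₜ B)) (p : ℂ[X]) (A B : K) :
    aeval (mulDiff γ W) p t (A, B, c) = H (polyDiff p * (A ⊗ₜ B)) :=
  aeval_funLeft_sub_apply (fun A B => (A, B, c)) (fun _ _ => rfl) (fun _ _ => rfl) H t ht p A B

/-- The function `(A, B, v) ↦ (A f)_{F} (B g) v`. -/
def nprodFun (f g : Dist (Module.End ℂ V)) (F : K) (z : K × K × V) : V :=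
  nprod (mulDist z.1 f) (0, F) g z.2.1 z.2.2

/-- Products are treated as plain functions of (A, B, v): only multiplications by τ in A and B act,
and polynomials in them are then polynomials in endomorphisms of a function space. -/
theorem nprodFun_ofPoly_mul (hf : IsField f) (hg : IsField g) (q : ℂ[X]) (F : K) :
    nprodFun f g (ofPoly q * F) = aeval (mulDiff V V) q (nprodFun f g F) := by
  have hsmul : ∀ (c : ℂ) (F : K), nprodFun f g (c • F) = c • nprodFun f g F := by
    intro c F
    have hL : ∀ (f' : Dist (Module.End ℂ V)) κ,
        prodLeft f' (0, c • F) κ = c • prodLeft f' (0, F) κ := by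
      intro f' κ
      induction κ using TensorProduct.induction_on with
      | zero => simp
      | tmul w x => simp [prodLeft_inr_tmul]
      | add x y hx hy => simp only [map_add, hx, hy, smul_add]
    have hR : ∀ (G : K) κ, prodRight g (0, c • F) G κ = c • prodRight g (0, F) G κ := by
      intro G κ
      induction κ using TensorProduct.induction_on with
      | zero => simp
      | tmul w x => simp [prodRight_inr_tmul]
      | add x y hx hy => simp only [map_add, hx, hy, smul_add]
    funext z
    simp only [nprodFun, Pi.smul_apply, nprod_apply, hL, hR, smul_sub]
  have hadd : ∀ F F' : K, nprodFun f g (F + F') = nprodFun f g F + nprodFun f g F' := by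
    intro F F'
    funext z
    have : ((0, F + F') : Comp) = (0, F) + (0, F') := by simp
    simp only [nprodFun, Pi.add_apply, this, nprod_add_right, LinearMap.add_apply]
  induction q using Polynomial.induction_on with
  | C a =>
    have : ofPoly (C a) = algebraMap ℂ K a := rfl
    rw [this, ← Algebra.smul_def, hsmul, aeval_C, Module.algebraMap_end_apply]
  | add p q hp hq => rw [map_add, add_mul, hadd, hp, hq, map_add, LinearMap.add_apply]
  | monomial n a ih =>
    have hX : ofPoly X = tau := rfl
    rw [pow_succ, ← mul_assoc, mul_comm _ X, map_mul (aeval _) X, Module.End.mul_apply, aeval_X,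
      ← ih, map_mul ofPoly X, hX, mul_assoc]
    funext ⟨A, B, v⟩
    rw [mulDiff_apply, nprodFun, nprod_inr_tau_mul (hf.mulDist A) hg, mulDist_mulDist, mul_comm A,
      LinearMap.sub_apply]
    rfl

theorem nprodFun_one (hf : IsField f) (hg : IsField g) (A B : K) (v : V) :
    nprodFun f g 1 (A, B, v) = LinearMap.applyₗ v (commutator f g (A ⊗ₜ B)) := by
  rw [nprodFun, nprod_mulDist_inr_one hf hg]; rfl

theorem nprodFun_ofPoly (hf : IsField f) (hg : IsField g) (q : ℂ[X]) (A B : K) (v : V) :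
    nprodFun f g (ofPoly q) (A, B, v) = commutator f g (polyDiff q * (A ⊗ₜ B)) v := by
  rw [← mul_one (ofPoly q), nprodFun_ofPoly_mul hf hg,
    aeval_mulDiff_apply v (LinearMap.applyₗ v ∘ₗ commutator f g) _
      (fun A B => nprodFun_one hf hg A B v)]
  rfl

/-- For polynomials the normal ordered product is a component of the commutator. -/
theorem nprod_ofPoly (hf : IsField f) (hg : IsField g) (q : ℂ[X]) (B : K) :
    nprod f (0, ofPoly q) g B = commutator f g (polyDiff q * (1 ⊗ₜ B)) := by
  ext v
  rw [← nprodFun_ofPoly hf hg, nprodFun, mulDist_one]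

/-- If m clears the denominator of F and p(τ₁ - τ₂) kills the commutator, then pmF is a polynomial
divisible by p, whose product is a component of the commutator multiplied by p(τ₁ - τ₂). -/
theorem exists_aeval_nprodFun_eq_zero (hf : IsField f) (hg : IsField g)
    (hfg : MutuallyRational f g) (F : K) :
    ∃ s : ℂ[X], s ≠ 0 ∧ aeval (mulDiff V V) s (nprodFun f g F) = 0 := by
  obtain ⟨p, hp, h⟩ := hfg
  obtain ⟨m, hm, a, ha⟩ := exists_ofPoly_mul_eq F
  refine ⟨p * m, mul_ne_zero hp (ne_zero_of_mem_translates hm), ?_⟩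
  funext ⟨A, B, v⟩
  rw [← nprodFun_ofPoly_mul hf hg, map_mul, mul_assoc, ha, ← map_mul, nprodFun_ofPoly hf hg,
    map_mul polyDiff, mul_assoc, h]
  rfl

/-- The first term is cleared together with g(τ)v; the second involves only finitely many g(τ)w,
where the w come from the kernel of f(τ)v. A product of the clearing denominators serves for both.
-/
theorem isField_nprod (hg : IsField g) (F : K) : IsField (nprod f (0, F) g) := by
  intro v
  have hR : ∀ κ, ∃ m ∈ translates, ∀ q, prodRight g (0, F) (ofPoly (m * q)) κ = 0 := by
    intro κ
    induction κ using TensorProduct.induction_on with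
    | zero => exact ⟨1, one_mem _, fun q => map_zero _⟩
    | tmul w x =>
      obtain ⟨m, hm, h⟩ := ((hg w).mulDist (antipodeK (actK x F))).exists_clear
      refine ⟨m, hm, fun q => ?_⟩
      rw [prodRight_inr_tmul, mul_comm]
      exact h q
    | add x y hx hy =>
      obtain ⟨m, hm, h⟩ := hx
      obtain ⟨m', hm', h'⟩ := hy
      refine ⟨m * m', mul_mem hm hm', fun q => ?_⟩
      rw [map_add, mul_assoc, h, mul_left_comm, h', add_zero]
  obtain ⟨m, hm, h⟩ := hR (singKer (f.flip v))
  obtain ⟨m', hm', h'⟩ := (hg v).exists_clear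
  refine ratSing_iff.2 ⟨m * m', mul_mem hm hm', fun q => ?_⟩
  show nprod f (0, F) g (ofPoly (m * m' * q)) v = 0
  rw [nprod_apply, singKer_eq_zero (fun r => ?_), map_zero, mul_assoc, h, sub_zero]
  rw [mulDist_apply, ← map_mul, show m * m' * q * r = m' * (m * q * r) by ring, h']

end FieldProducts

/-! ### Dong's lemma. -/

section Locality

variable {V : Type*} [AddCommGroup V] [Module ℂ V] {f g h : Dist (Module.End ℂ V)}

/-- Multiplication by `τ` in the third factor of `K × K × K × γ`. -/
def mulThd (γ : Type*) (z : K × K × K × γ) : K × K × K × γ := (z.1, z.2.1, tau * z.2.2.1, z.2.2.2)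

theorem mul_polyDiff_mul (p : ℂ[X]) (y z : K ⊗[ℂ] K) :
    y * (polyDiff p * z) = polyDiff p * (y * z) :=
  mul_left_comm (G := K ⊗[ℂ] K) _ _ _

/-- The singular part in `τ₂` of `τ₂ ↦ [f(τ₂), h(τ₃)]v` for components of the commutator. -/
def commutatorKer (f h : Dist (Module.End ℂ V)) (v : V) : K ⊗[ℂ] K →ₗ[ℂ] V ⊗[ℂ] HatHT :=
  singKer ∘ₗ LinearMap.mk₂ ℂ (fun z (b : K) => commutator f h ((b ⊗ₜ 1) * z) v)
    (fun z z' b => by rw [mul_add, map_add, LinearMap.add_apply])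
    (fun c z b => by rw [mul_smul_comm, map_smul, LinearMap.smul_apply])
    (fun z b b' => by rw [TensorProduct.add_tmul, add_mul, map_add, LinearMap.add_apply])
    (fun c z b => by
      rw [← TensorProduct.smul_tmul', smul_mul_assoc, map_smul, LinearMap.smul_apply])

theorem commutatorKer_tmul (hf : IsField f) (A C : K) (v : V) :
    commutatorKer f h v (A ⊗ₜ C) = singKer (mulDist A (f.flip (h C v))) -
      (h C).rTensor HatHT (singKer (mulDist A (f.flip v))) := by
  rw [← singKer_comp ((hf v).mulDist A), ← map_sub]
  refine congrArg singKer (LinearMap.ext fun b => ?_)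
  show commutator f h ((b ⊗ₜ 1) * (A ⊗ₜ C)) v = _
  rw [Algebra.TensorProduct.tmul_mul_tmul, one_mul, commutator_tmul, mul_comm b A]
  rfl

theorem commutatorKer_eq_zero {p : ℂ[X]} (hp : ∀ z, commutator f h (polyDiff p * z) = 0)
    (v : V) (z : K ⊗[ℂ] K) : commutatorKer f h v (polyDiff p * z) = 0 := by
  refine singKer_eq_zero fun q => ?_
  show commutator f h ((ofPoly q ⊗ₜ 1) * (polyDiff p * z)) v = 0
  rw [mul_polyDiff_mul, hp, LinearMap.zero_apply]

/-- For κ = w ⊗ x the difference is the commutator of f and h at (S(x)F · A) ⊗ C applied to w, and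
multiplication by S(x)F ⊗ 1 commutes with multiplication by p(τ₁ - τ₃). -/
theorem exists_prodLeft_comm {p : ℂ[X]} (hp : ∀ z, commutator f h (polyDiff p * z) = 0) (F : K)
    (κ : V ⊗[ℂ] HatHT) : ∃ H : K ⊗[ℂ] K →ₗ[ℂ] V, (∀ A C, H (A ⊗ₜ C) =
      prodLeft (mulDist A f) (0, F) ((h C).rTensor HatHT κ) -
        h C (prodLeft (mulDist A f) (0, F) κ)) ∧ ∀ z, H (polyDiff p * z) = 0 := by
  induction κ using TensorProduct.induction_on with
  | zero => exact ⟨0, by simp, by simp⟩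
  | tmul w x =>
    refine ⟨LinearMap.applyₗ w ∘ₗ commutator f h ∘ₗ
      LinearMap.mulLeft ℂ (actK (antipode x) F ⊗ₜ[ℂ] (1 : K)), fun A C => ?_, fun z => ?_⟩
    · rw [LinearMap.rTensor_tmul, prodLeft_inr_tmul, prodLeft_inr_tmul, mulDist_apply]
      show commutator f h ((actK (antipode x) F ⊗ₜ[ℂ] (1 : K)) * (A ⊗ₜ C)) w = _
      rw [Algebra.TensorProduct.tmul_mul_tmul, one_mul, commutator_tmul, mul_comm A]
    · show commutator f h ((actK (antipode x) F ⊗ₜ[ℂ] (1 : K)) * (polyDiff p * z)) w = 0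
      rw [mul_polyDiff_mul, hp, LinearMap.zero_apply]
  | add x y hx hy =>
    obtain ⟨H, h1, h2⟩ := hx
    obtain ⟨H', h1', h2'⟩ := hy
    refine ⟨H + H', fun A C => ?_, fun z => ?_⟩
    · rw [LinearMap.add_apply, h1, h1']
      simp only [map_add]; abel
    · rw [LinearMap.add_apply, h2, h2', add_zero]

theorem exists_prodRight_comm {p : ℂ[X]} (hp : ∀ z, commutator g h (polyDiff p * z) = 0) (F : K)
    (κ : V ⊗[ℂ] HatHT) : ∃ H : K ⊗[ℂ] K →ₗ[ℂ] V, (∀ B C, H (B ⊗ₜ C) =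
      prodRight g (0, F) B ((h C).rTensor HatHT κ) - h C (prodRight g (0, F) B κ)) ∧
        ∀ z, H (polyDiff p * z) = 0 := by
  induction κ using TensorProduct.induction_on with
  | zero => exact ⟨0, by simp, by simp⟩
  | tmul w x =>
    refine ⟨LinearMap.applyₗ w ∘ₗ commutator g h ∘ₗ
      LinearMap.mulLeft ℂ (antipodeK (actK x F) ⊗ₜ[ℂ] (1 : K)), fun B C => ?_, fun z => ?_⟩
    · rw [LinearMap.rTensor_tmul, prodRight_inr_tmul, prodRight_inr_tmul]
      show commutator g h ((antipodeK (actK x F) ⊗ₜ[ℂ] (1 : K)) * (B ⊗ₜ C)) w = _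
      rw [Algebra.TensorProduct.tmul_mul_tmul, one_mul, commutator_tmul, mul_comm B]
    · show commutator g h ((antipodeK (actK x F) ⊗ₜ[ℂ] (1 : K)) * (polyDiff p * z)) w = 0
      rw [mul_polyDiff_mul, hp, LinearMap.zero_apply]
  | add x y hx hy =>
    obtain ⟨H, h1, h2⟩ := hx
    obtain ⟨H', h1', h2'⟩ := hy
    refine ⟨H + H', fun A C => ?_, fun z => ?_⟩
    · rw [LinearMap.add_apply, h1, h1']
      simp only [map_add]; abel
    · rw [LinearMap.add_apply, h2, h2', add_zero]

/-- Dong's lemma: normal ordered products of mutually rational fields are mutually rational with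
every field that both factors are mutually rational with. -/
theorem MutuallyRational.nprod (hf : IsField f) (hg : IsField g) (hfg : MutuallyRational f g)
    (hfh : MutuallyRational f h) (hgh : MutuallyRational g h) (F : K) :
    MutuallyRational (nprod f (0, F) g) h := by
  obtain ⟨s, hs, hst⟩ := exists_aeval_nprodFun_eq_zero hf hg hfg F
  obtain ⟨p, hp, hfh⟩ := hfh
  obtain ⟨q, hq, hgh⟩ := hgh
  let ι := K × K × K × V
  let M₁ : Module.End ℂ (ι → V) := LinearMap.funLeft ℂ V (mulFst (K × V))
  let M₂ : Module.End ℂ (ι → V) := LinearMap.funLeft ℂ V (mulSnd (K × V))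
  let M₃ : Module.End ℂ (ι → V) := LinearMap.funLeft ℂ V (mulThd V)
  have h12 : Commute M₁ M₂ := commute_funLeft fun i => rfl
  have h13 : Commute M₁ M₃ := commute_funLeft fun i => rfl
  have h23 : Commute M₂ M₃ := commute_funLeft fun i => rfl
  -- The commutator of the product with h(C) splits into four: in the term expanded in τ₂, h passes
  -- g (U) and f (W); in the term expanded in τ₁, it passes f (U') and g (W').
  let U : ι → V := fun ⟨A, B, C, v⟩ =>
    prodLeft (mulDist A f) (0, F) (commutatorKer g h v (B ⊗ₜ C))
  let W : ι → V := fun ⟨A, B, C, v⟩ =>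
    prodLeft (mulDist A f) (0, F) ((h C).rTensor HatHT (singKer (mulDist B (g.flip v)))) -
      h C (prodLeft (mulDist A f) (0, F) (singKer (mulDist B (g.flip v))))
  let U' : ι → V := fun ⟨A, B, C, v⟩ => prodRight g (0, F) B (commutatorKer f h v (A ⊗ₜ C))
  let W' : ι → V := fun ⟨A, B, C, v⟩ =>
    prodRight g (0, F) B ((h C).rTensor HatHT (singKer (mulDist A (f.flip v)))) -
      h C (prodRight g (0, F) B (singKer (mulDist A (f.flip v))))
  let t : ι → V := fun ⟨A, B, C, v⟩ =>
    nprodFun f g F (A, B, h C v) - h C (nprodFun f g F (A, B, v))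
  have ht : t = U + W - U' - W' := by
    funext ⟨A, B, C, v⟩
    show nprodFun f g F (A, B, h C v) - h C (nprodFun f g F (A, B, v)) =
      U (A, B, C, v) + W (A, B, C, v) - U' (A, B, C, v) - W' (A, B, C, v)
    simp only [nprodFun, nprod_apply, flip_mulDist, U, W, U', W', commutatorKer_tmul hf,
      commutatorKer_tmul hg, map_sub]
    abel
  have hU : aeval (M₂ - M₃) q U = 0 := by
    funext ⟨A, B, C, v⟩
    refine (aeval_funLeft_sub_apply (fun B C => (A, B, C, v)) (fun _ _ => rfl) (fun _ _ => rfl)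
      (prodLeft (mulDist A f) (0, F) ∘ₗ commutatorKer g h v) U (fun _ _ => rfl) q B C).trans ?_
    rw [LinearMap.comp_apply, commutatorKer_eq_zero hgh, map_zero]; rfl
  have hW : aeval (M₁ - M₃) p W = 0 := by
    funext ⟨A, B, C, v⟩
    obtain ⟨H, h1, h2⟩ := exists_prodLeft_comm hfh F (singKer (mulDist B (g.flip v)))
    refine (aeval_funLeft_sub_apply (fun A C => (A, B, C, v)) (fun _ _ => rfl) (fun _ _ => rfl)
      H W (fun _ _ => (h1 _ _).symm) p A C).trans ?_
    rw [h2]; rfl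
  have hU' : aeval (M₁ - M₃) p U' = 0 := by
    funext ⟨A, B, C, v⟩
    refine (aeval_funLeft_sub_apply (fun A C => (A, B, C, v)) (fun _ _ => rfl) (fun _ _ => rfl)
      (prodRight g (0, F) B ∘ₗ commutatorKer f h v) U' (fun _ _ => rfl) p A C).trans ?_
    rw [LinearMap.comp_apply, commutatorKer_eq_zero hfh, map_zero]; rfl
  have hW' : aeval (M₂ - M₃) q W' = 0 := by
    funext ⟨A, B, C, v⟩
    obtain ⟨H, h1, h2⟩ := exists_prodRight_comm hgh F (singKer (mulDist A (f.flip v)))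
    refine (aeval_funLeft_sub_apply (fun B C => (A, B, C, v)) (fun _ _ => rfl) (fun _ _ => rfl)
      H W' (fun _ _ => (h1 _ _).symm) q B C).trans ?_
    rw [h2]; rfl
  -- For fixed C, t arises from `nprodFun` by operations on v and on values only, and these commute
  -- with multiplication by τ₁ - τ₂.
  have hS : aeval (M₁ - M₂) s t = 0 := by
    funext ⟨A, B, C, v⟩
    let L : (ι → V) →ₗ[ℂ] (K × K × V → V) := LinearMap.funLeft ℂ V fun z => (z.1, z.2.1, C, z.2.2)
    let Λ₁ : (K × K × V → V) →ₗ[ℂ] (K × K × V → V) :=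
      LinearMap.funLeft ℂ V fun z => (z.1, z.2.1, h C z.2.2)
    let Λ₂ : (K × K × V → V) →ₗ[ℂ] (K × K × V → V) := (h C).compLeft (K × K × V)
    have e1 : L t = (Λ₁ - Λ₂) (nprodFun f g F) := rfl
    have e2 := map_aeval_end (x := M₁ - M₂) (y := mulDiff V V) L (fun m => rfl) s t
    have e3 := map_aeval_end (x := mulDiff V V) (y := mulDiff V V) (Λ₁ - Λ₂) (fun m => by
      funext ⟨A, B, v⟩
      show mulDiff V V m (A, B, h C v) - h C (mulDiff V V m (A, B, v)) =
        (Λ₁ - Λ₂) m (tau * A, B, v) - (Λ₁ - Λ₂) m (A, tau * B, v)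
      rw [mulDiff_apply, mulDiff_apply, map_sub]
      show _ = (m (tau * A, B, h C v) - h C (m (tau * A, B, v))) -
        (m (A, tau * B, h C v) - h C (m (A, tau * B, v)))
      abel) s (nprodFun f g F)
    rw [hst, map_zero] at e3
    rw [e1, ← e3] at e2
    exact congrFun e2 (A, B, v)
  have hcomm : ∀ (x y : Module.End ℂ (ι → V)), Commute x y → ∀ (p q : ℂ[X]) (t : ι → V),
      aeval x p (aeval y q t) = aeval y q (aeval x p t) := fun x y hxy p q t =>
    map_aeval_end (x := y) (y := y) (aeval x p)
      (fun m => (Commute.aeval_apply hxy p m).symm) q t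
  have hc1 : Commute (M₁ - M₃) (M₂ - M₃) :=
    (h12.sub_left h23.symm).sub_right (h13.sub_left (Commute.refl _))
  have hc2 : Commute (M₁ - M₂) (M₂ - M₃) :=
    (h12.sub_left (Commute.refl _)).sub_right (h13.sub_left h23)
  have hc3 : Commute (M₁ - M₃) (M₁ - M₂) :=
    ((Commute.refl _).sub_left h13.symm).sub_right (h12.sub_left h23.symm)
  have hP : aeval (M₁ - M₃) p (aeval (M₂ - M₃) q t) = 0 := by
    have e1 : aeval (M₁ - M₃) p (aeval (M₂ - M₃) q W) = 0 := by
      rw [hcomm _ _ hc1, hW, map_zero]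
    have e2 : aeval (M₁ - M₃) p (aeval (M₂ - M₃) q U') = 0 := by
      rw [hcomm _ _ hc1, hU', map_zero]
    rw [ht]
    simp only [map_add, map_sub, hU, hW', e1, e2, map_zero, add_zero, sub_zero]
  have hS' : aeval (M₁ - M₂) s (aeval (M₂ - M₃) q t) = 0 := by
    rw [hcomm _ _ hc2, hS, map_zero]
  -- The vector q(τ₂ - τ₃)t satisfies polynomials in τ₁ - τ₃ and in τ₁ - τ₂, hence one in their
  -- difference τ₂ - τ₃.
  obtain ⟨R, hR, hRt⟩ := exists_aeval_sub_eq_zero hc3 hp hs hP hS'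
  rw [sub_sub_sub_cancel_left, ← Module.End.mul_apply, ← map_mul] at hRt
  refine mutuallyRational_iff.2 ⟨R * q, mul_ne_zero hR hq, fun B C v => ?_⟩
  have := aeval_funLeft_sub_apply (σ₁ := mulSnd (K × V)) (σ₂ := mulThd V)
    (fun B C => ((1 : K), B, C, v)) (fun _ _ => rfl) (fun _ _ => rfl)
    (LinearMap.applyₗ v ∘ₗ commutator (HTVertex.nprod f (0, F) g) h) t (fun B C => by
      show nprodFun f g F (1, B, h C v) - h C (nprodFun f g F (1, B, v)) =
        commutator (HTVertex.nprod f (0, F) g) h (B ⊗ₜ C) v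
      rw [nprodFun, nprodFun, mulDist_one, commutator_tmul]) (R * q) B C
  refine this.symm.trans ?_
  -- At A = 1 the auxiliary variable disappears.
  exact congrFun hRt (1, B, C, v)

end Locality

/-! ### Functional components, and derivatives of fields. -/

section Functionals

variable {W V : Type*} [AddCommGroup W] [Module ℂ W] [AddCommGroup V] [Module ℂ V]

theorem evalHat_pairing {D : Dist W} (hD : RatSing D) (q : ℂ[X]) :
    evalHat D (pairing.flip q, 0) = D (ofPoly q) := by
  rw [evalHat_inl, ← singPairing_eq, hD.apply]

theorem pairing_mul {h : HatHT} {p q : ℂ[X]} (hq : actK h (ofPoly p) = ofPoly q) (x : HatHT) :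
    pairing (h * x) p = pairing x q := by
  rw [pairing_apply, pairing_apply, ← hq, trace_alpha_mul_actK]

theorem pairing_antipode (h : HatHT) (p : ℂ[X]) :
    pairing (antipode h) p = pairing h (p.comp (-X)) := by
  have h1 := trace_antipodeK (alpha h * antipodeK (ofPoly p))
  have h2 : -alpha (antipode h) * ofPoly p = -(alpha (antipode h) * ofPoly p) := by ring
  rw [map_mul antipodeK, antipodeK_antipodeK, antipodeK_alpha, h2, map_neg, neg_inj] at h1
  rw [pairing_apply, pairing_apply, ← ofPoly_comp_neg, h1]

/-- The point is that one tensor, independent of φ, governs all functionals: φ enters linearly and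
only through its values. -/
theorem exists_prodLeft_inl (f : Dist (Module.End ℂ V)) (κ : V ⊗[ℂ] HatHT) :
    ∃ X : V ⊗[ℂ] HatHT, ∀ φ, prodLeft f (φ, 0) κ = TensorProduct.rid ℂ V (φ.lTensor V X) := by
  induction κ using TensorProduct.induction_on with
  | zero => exact ⟨0, by simp⟩
  | tmul w h =>
    refine ⟨(LinearMap.mulLeft ℂ (antipode h)).lTensor V (singKer (f.flip w)), fun φ => ?_⟩
    rw [prodLeft_tmul, compAct_inl, evalHat_inl, LinearMap.lTensor_comp_apply]
  | add x y hx hy =>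
    obtain ⟨X, hX⟩ := hx
    obtain ⟨Y, hY⟩ := hy
    exact ⟨X + Y, fun φ => by simp only [map_add, hX, hY]⟩

theorem exists_prodRight_inl (g : Dist (Module.End ℂ V)) (G : K) (κ : V ⊗[ℂ] HatHT) :
    ∃ X : V ⊗[ℂ] HatHT, ∀ φ, prodRight g (φ, 0) G κ = TensorProduct.rid ℂ V (φ.lTensor V X) := by
  induction κ using TensorProduct.induction_on with
  | zero => exact ⟨0, by simp⟩
  | tmul w h =>
    refine ⟨(LinearMap.mulLeft ℂ h).lTensor V
      (antipode.toLinearMap.lTensor V (singKer (mulDist G (g.flip w)))), fun φ => ?_⟩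
    rw [prodRight_tmul, compAct_inl, compAntipode_inl, evalHat_inl, LinearMap.lTensor_comp_apply,
      LinearMap.lTensor_comp_apply]
  | add x y hx hy =>
    obtain ⟨X, hX⟩ := hx
    obtain ⟨Y, hY⟩ := hy
    exact ⟨X + Y, fun φ => by simp only [map_add, hX, hY]⟩

variable {f g : Dist (Module.End ℂ V)}

/-- The functional h ↦ ⟨h, q⟩ is the holomorphic expansion of q, compatibly with the action of Ĥ_T
and with τ ↦ -τ. -/
theorem nprod_pairing (hf : IsField f) (hg : IsField g) (q : ℂ[X]) :
    nprod f (pairing.flip q, 0) g = nprod f (0, ofPoly q) g := by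
  have hL : prodLeft f (pairing.flip q, 0) = prodLeft f (0, ofPoly q) := by
    refine TensorProduct.ext' fun w h => ?_
    obtain ⟨q', hq'⟩ := exists_actK_ofPoly (antipode h) q
    have : pairing.flip q ∘ₗ LinearMap.mulLeft ℂ (antipode h) = pairing.flip q' :=
      LinearMap.ext fun x => pairing_mul hq' x
    rw [prodLeft_tmul, prodLeft_tmul, compAct_inl, compAct_inr, this, evalHat_pairing (hf w),
      evalHat_inr, hq']
  have hR : ∀ G, prodRight g (pairing.flip q, 0) G = prodRight g (0, ofPoly q) G := by
    refine fun G => TensorProduct.ext' fun w h => ?_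
    obtain ⟨q', hq'⟩ := exists_actK_ofPoly h q
    have : (pairing.flip q ∘ₗ LinearMap.mulLeft ℂ h) ∘ₗ antipode.toLinearMap =
        pairing.flip (q'.comp (-X)) :=
      LinearMap.ext fun x => (pairing_mul hq' (antipode x)).trans (pairing_antipode x q')
    rw [prodRight_tmul, prodRight_tmul, compAct_inl, compAntipode_inl, compAct_inr,
      compAntipode_inr, this, evalHat_pairing ((hg w).mulDist G), evalHat_inr, hq', ofPoly_comp_neg]
  ext G v
  rw [nprod_apply, nprod_apply, hL, hR]

/-- A functional on `Ĥ_T` may be replaced by a polynomial in given products of mutually rational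
fields. -/
theorem exists_ofPoly_of_functional (hf : IsField f) (hg : IsField g) (hfg : MutuallyRational f g)
    (u : V) (φ : Module.Dual ℂ HatHT) : ∃ q : ℂ[X], component f (φ, 0) u = f (ofPoly q) u ∧
      nprod f (φ, 0) g = nprod f (0, ofPoly q) g := by
  obtain ⟨p, hp, hpc⟩ := hfg
  obtain ⟨m, hm, hmu⟩ := (hf u).exists_clear
  -- The factor m handles the component at u and p handles the product, so a single q replaces φ in
  -- both.
  obtain ⟨q, hq⟩ := exists_rid_lTensor_eq_singPairing (W := V)
    (mul_ne_zero hp (ne_zero_of_mem_translates hm)) φ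
  refine ⟨q, ?_, ?_⟩
  · rw [component_apply, evalHat_inl, hq, ← (hf u).apply]
    · rfl
    · intro r
      rw [← (hf u).apply, mul_assoc, mul_left_comm, hmu]
  · ext G v
    obtain ⟨X, hX⟩ := exists_prodLeft_inl f (singKer (mulDist G (g.flip v)))
    obtain ⟨Y, hY⟩ := exists_prodRight_inl g G (singKer (f.flip v))
    -- The difference X - Y is torsion: its pairing with pr is a component of the commutator
    -- multiplied by p(τ₁ - τ₂).
    have hXY : ∀ φ, nprod f (φ, 0) g G v = TensorProduct.rid ℂ V (φ.lTensor V (X - Y)) := by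
      intro φ
      rw [nprod_apply, hX, hY, map_sub, map_sub]
    have hXY' : ∀ q, singPairing V (X - Y) q = nprod f (0, ofPoly q) g G v := by
      intro q
      rw [singPairing_eq, ← hXY, nprod_pairing hf hg]
    rw [hXY, hq, hXY']
    intro r
    rw [hXY', nprod_ofPoly hf hg, mul_assoc, map_mul polyDiff, mul_assoc, hpc,
      LinearMap.zero_apply]

theorem commutator_sub_left (f f' g : Dist (Module.End ℂ V)) :
    commutator (f - f') g = commutator f g - commutator f' g := by
  refine TensorProduct.ext' fun A B => LinearMap.ext fun v => ?_
  rw [LinearMap.sub_apply, LinearMap.sub_apply]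
  simp only [commutator_tmul, LinearMap.sub_apply, map_sub]
  abel

theorem MutuallyRational.sub_left {f' : Dist (Module.End ℂ V)} (h : MutuallyRational f g)
    (h' : MutuallyRational f' g) : MutuallyRational (f - f') g := by
  obtain ⟨p, hp, h⟩ := h
  obtain ⟨p', hp', h'⟩ := h'
  refine ⟨p * p', mul_ne_zero hp hp', fun z => ?_⟩
  rw [commutator_sub_left, LinearMap.sub_apply, map_mul polyDiff, mul_assoc, h, mul_polyDiff_mul, h', sub_zero]

theorem IsField.comp_derivK (hf : IsField f) : IsField (f ∘ₗ derivK) := by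
  intro v
  obtain ⟨m, hm, h⟩ := (hf v).exists_clear
  -- By the Leibniz rule the derivative of m²q is still divisible by m.
  refine ratSing_iff.2 ⟨m * m, mul_mem hm hm, fun q => ?_⟩
  show f (derivK (ofPoly (m * m * q))) v = 0
  have : derivative (m * m * q) = m * (derivative (m * q) + derivative m * q) := by
    simp only [derivative_mul]; ring
  rw [derivK_ofPoly, this]
  exact h _

theorem rTensor_derivK_mul (x y : K ⊗[ℂ] K) : derivK.rTensor K (x * y) =
    x * derivK.rTensor K y + y * derivK.rTensor K x := by
  induction x using TensorProduct.induction_on with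
  | zero => simp
  | tmul A B =>
    induction y using TensorProduct.induction_on with
    | zero => simp
    | tmul A' B' =>
      simp only [Algebra.TensorProduct.tmul_mul_tmul, LinearMap.rTensor_tmul, derivK_mul,
        TensorProduct.add_tmul, mul_comm B' B]
    | add y y' hy hy' => rw [mul_add, map_add, hy, hy', map_add, mul_add, add_mul]; abel
  | add x x' hx hx' => rw [add_mul, map_add, hx, hx', map_add, mul_add, add_mul]; abel

/-- Differentiating a multiple of p(τ₁ - τ₂)² in τ₁ leaves a multiple of p(τ₁ - τ₂). -/
theorem MutuallyRational.comp_derivK (h : MutuallyRational f g) :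
    MutuallyRational (f ∘ₗ derivK) g := by
  obtain ⟨p, hp, h⟩ := h
  have hc : commutator (f ∘ₗ derivK) g = commutator f g ∘ₗ derivK.rTensor K :=
    TensorProduct.ext' fun A B => rfl
  refine ⟨p * p, mul_ne_zero hp hp, fun z => ?_⟩
  rw [hc, LinearMap.comp_apply, map_mul polyDiff, mul_assoc, rTensor_derivK_mul, map_add, h, mul_assoc, h,
    add_zero]

end Functionals

/-! ### Uniqueness of fields and covariance under Ĥ_T. -/

theorem singCoord_actK_antipode (h : HatHT) (F : K) :
    singCoord (actK (antipode h) F) = h * singCoord F := by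
  obtain ⟨p, hp⟩ := exists_eq_ofPoly_add_alpha F
  obtain ⟨q, hq⟩ := exists_actK_ofPoly (antipode h) p
  conv_lhs => rw [hp, map_add, hq, ← alpha_mul, map_add, singCoord_ofPoly, singCoord_alpha,
    zero_add]

namespace HTVertexAlgebra

variable {V : Type*} [AddCommGroup V] [Module ℂ V] (A : HTVertexAlgebra V)

/-- The action of `Ĥ_T` on an `H_T`-vertex algebra. -/
abbrev act : HatHT →ₗ[ℂ] Module.End ℂ V := stateAct A.Y A.vac

theorem act_apply (h : HatHT) (u : V) : A.act h u = A.Y u (alpha h) A.vac := rfl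

theorem act_mul_apply (h h' : HatHT) (u : V) : A.act (h * h') u = A.act h (A.act h' u) := by
  rw [act, A.act_mul]; rfl

theorem Y_apply_vac (u : V) (F : K) : A.Y u F A.vac = A.act (singCoord F) u := by
  obtain ⟨p, hp⟩ := exists_eq_ofPoly_add_alpha F
  conv_lhs => rw [hp]
  rw [map_add, LinearMap.add_apply, A.Y_poly_vac, zero_add, act_apply]

theorem Y_actK_vac (u : V) (h : HatHT) (F : K) :
    A.Y u (actK (antipode h) F) A.vac = A.act h (A.Y u F A.vac) := by
  rw [Y_apply_vac, Y_apply_vac, singCoord_actK_antipode, act_mul_apply]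

/-- Goddard's uniqueness theorem: a field that is mutually rational with all vertex operators is
determined by its value on the vacuum. -/
theorem eq_Y_of_apply_vac {D : Dist (Module.End ℂ V)} (hD : IsField D)
    (hr : ∀ g, MutuallyRational D (A.Y g)) {u : V} (hu : ∀ F, D F A.vac = A.Y u F A.vac) :
    D = A.Y u := by
  rw [← sub_eq_zero]
  have hδ : IsField (D - A.Y u) := hD.sub (A.isField u)
  have hvac : ∀ F, (D - A.Y u) F A.vac = 0 := fun F => by
    rw [LinearMap.sub_apply, LinearMap.sub_apply, hu, sub_self]
  have hδr : ∀ g, MutuallyRational (D - A.Y u) (A.Y g) := fun g => (hr g).sub_left (A.rational u g)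
  generalize D - A.Y u = δ at hδ hvac hδr
  have hc : ∀ g F G, commutator δ (A.Y g) (F ⊗ₜ G) A.vac = δ F (A.Y g G A.vac) := by
    intro g F G
    rw [commutator_tmul, hvac, map_zero, sub_zero]
  -- Y(g,τ₂)1_V vanishes on polynomials in τ₂, and multiplication by τ₂ preserves these.
  have h1 : ∀ g (q : ℂ[X]) F b,
      commutator δ (A.Y g) (polyDiff q * (F ⊗ₜ ofPoly b)) A.vac = 0 := by
    intro g q
    induction q using Polynomial.induction_on with
    | C a =>
      intro F b
      simp only [polyDiff, aeval_C, ← Algebra.smul_def, map_smul, LinearMap.smul_apply, hc,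
        A.Y_poly_vac, map_zero, smul_zero]
    | add p q hp hq =>
      intro F b
      rw [map_add, add_mul, map_add, LinearMap.add_apply, hp, hq, add_zero]
    | monomial n a ih =>
      intro F b
      have hX : tau * ofPoly b = ofPoly (X * b) := (map_mul _ _ _).symm
      rw [pow_succ, ← mul_assoc, mul_comm _ X, polyDiff_X_mul, map_sub, LinearMap.sub_apply, ih, hX,
        ih, sub_zero]
  -- Against 1/τ₂ the variable τ₂ may be set to 0: τ₂ · 1/τ₂ = 1 is a polynomial and contributes
  -- nothing by `h1`, so q(τ₁ - τ₂) acts as q(τ₁).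
  have h2 : ∀ g (q : ℂ[X]) F,
      commutator δ (A.Y g) (polyDiff q * (F ⊗ₜ Ring.inverse tau)) A.vac = δ (ofPoly q * F) g := by
    intro g q
    induction q using Polynomial.induction_on with
    | C a =>
      intro F
      have : ofPoly (C a) = algebraMap ℂ K a := rfl
      simp only [polyDiff, aeval_C, this, ← Algebra.smul_def, map_smul, LinearMap.smul_apply, hc,
        A.Y_const_vac]
    | add p q hp hq =>
      intro F
      rw [map_add, add_mul, map_add, LinearMap.add_apply, hp, hq, map_add ofPoly, add_mul, map_add,
        LinearMap.add_apply]
    | monomial n a ih =>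
      intro F
      have hu : IsUnit tau := by simpa using isUnit_tau_add 0
      have hX : ofPoly X = tau := rfl
      rw [pow_succ, ← mul_assoc, mul_comm _ X, polyDiff_X_mul, map_sub, LinearMap.sub_apply, ih,
        Ring.mul_inverse_cancel tau hu, ← map_one ofPoly, h1, sub_zero, map_mul ofPoly X, hX,
        mul_left_comm, mul_assoc]
  refine LinearMap.ext fun F => LinearMap.ext fun g => ?_
  obtain ⟨p, hp, hpc⟩ := hδr g
  -- Mutual rationality now says that p(τ) kills the rational distribution δ(τ)g.
  have := (hδ g).eq_zero_of_mul hp (fun B => by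
    show δ (ofPoly p * B) g = 0
    rw [← h2, hpc, LinearMap.zero_apply])
  exact LinearMap.congr_fun this F

/-- Covariance is an axiom only for H_T. For ∂ it follows by uniqueness: the derivative is a field,
mutually rational with all vertex operators, and the module structure on V gives equality on the
vacuum. -/
theorem Y_act_del (f : V) : A.Y f ∘ₗ actK (antipode del) = A.Y (A.act del f) := by
  have : A.Y f ∘ₗ actK (antipode del) = 0 - A.Y f ∘ₗ derivK := by
    ext F v
    simp [antipode_del, actK_del]
  have h0 : IsField (0 : Dist (Module.End ℂ V)) := fun v => RatSing.zero
  have h0' : ∀ g, MutuallyRational (0 : Dist (Module.End ℂ V)) g := fun g =>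
    ⟨1, one_ne_zero, fun z => by
      have : commutator 0 g = 0 := TensorProduct.ext' fun A B => by simp [commutator]
      rw [this, LinearMap.zero_apply]⟩
  refine A.eq_Y_of_apply_vac ?_ (fun g => ?_) fun F => ?_
  · rw [this]; exact h0.sub (A.isField f).comp_derivK
  · rw [this]; exact (h0' _).sub_left (A.rational f g).comp_derivK
  · rw [LinearMap.comp_apply, Y_apply_vac, Y_apply_vac, singCoord_actK_antipode, mul_comm,
      act_mul_apply]

/-- Covariance under the whole Hopf algebra `Ĥ_T`. -/
theorem Y_actK_antipode (h : HatHT) (f : V) (F : K) :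
    A.Y f (actK (antipode h) F) = A.Y (A.act h f) F := by
  induction h using hatHT_induction generalizing f F with
  | hT n => exact A.covariance _ (Algebra.subset_adjoin ⟨n, rfl⟩) f F
  | hdel => exact LinearMap.congr_fun (A.Y_act_del f) F
  | hadd x y hx hy => simp only [map_add, LinearMap.add_apply, hx, hy]
  | hmul x y hx hy => rw [map_mul, actK_mul, hx, hy, mul_comm, ← act_mul_apply]
  | hsmul c x hx => simp only [map_smul, LinearMap.smul_apply, hx]

end HTVertexAlgebra

/-! ### Skew-symmetry and associativity. -/

theorem singPairing_lTensor_mulLeft {W : Type*} [AddCommGroup W] [Module ℂ W] {h : HatHT}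
    {p q : ℂ[X]} (hq : actK h (ofPoly p) = ofPoly q) (κ : W ⊗[ℂ] HatHT) :
    singPairing W ((LinearMap.mulLeft ℂ h).lTensor W κ) p = singPairing W κ q := by
  induction κ using TensorProduct.induction_on with
  | zero => simp
  | tmul w x =>
    rw [LinearMap.lTensor_tmul, singPairing_tmul', singPairing_tmul', LinearMap.mulLeft_apply,
      pairing_mul hq]
  | add x y hx hy => simp only [map_add, LinearMap.add_apply, hx, hy]

theorem RatSing.antipodal {W : Type*} [AddCommGroup W] [Module ℂ W] {D : Dist W}
    (hD : RatSing D) : RatSing (antipodal D) := by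
  have h : ∀ (κ : W ⊗[ℂ] HatHT) (p : ℂ[X]), singPairing W (antipode.toLinearMap.lTensor W κ) p =
      singPairing W κ (p.comp (-X)) := by
    intro κ p
    induction κ using TensorProduct.induction_on with
    | zero => simp
    | tmul w x =>
      rw [LinearMap.lTensor_tmul, singPairing_tmul', singPairing_tmul', AlgHom.toLinearMap_apply,
        pairing_antipode]
    | add x y hx hy => simp only [map_add, LinearMap.add_apply, hx, hy]
  refine RatSing.of_eq (κ := -antipode.toLinearMap.lTensor W (singKer D)) fun p => ?_
  rw [map_neg, LinearMap.neg_apply, h, ← hD.apply, ← ofPoly_comp_neg]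
  rfl

namespace HTVertexAlgebra

variable {V : Type*} [AddCommGroup V] [Module ℂ V] (A : HTVertexAlgebra V)

theorem expDist_act_apply (D : Dist V) (G : K) : expDist A.act D G =
    TensorProduct.lift A.act.flip (singKer (mulDist G D)) := rfl

theorem lift_act_lTensor_mulLeft (h : HatHT) (κ : V ⊗[ℂ] HatHT) :
    TensorProduct.lift A.act.flip ((LinearMap.mulLeft ℂ h).lTensor V κ) =
      A.act h (TensorProduct.lift A.act.flip κ) := by
  induction κ using TensorProduct.induction_on with
  | zero => simp
  | tmul w x => exact A.act_mul_apply h x w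
  | add x y hx hy => simp only [map_add, hx, hy]

/-- Since D(Tⁿ(Gp)) = D(TⁿG · Tⁿp), the kernel of the left side is that of (TⁿG)D with its Ĥ_T
factor multiplied by Tⁿ, and R(τ) lets that factor act on V. For ∂ the Leibniz rule adds a second
term. -/
theorem expDist_comp_shift {D : Dist V} (hD : RatSing D) (n : ℤ) (G : K) :
    expDist A.act (D ∘ₗ (shift n).toLinearMap) G = A.act (T n) (expDist A.act D (shift n G)) := by
  rw [expDist_act_apply, expDist_act_apply, ← lift_act_lTensor_mulLeft]
  congr 1
  refine singKer_apply_of_eq fun p => ?_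
  obtain ⟨q, hq⟩ := exists_actK_ofPoly (T n) p
  rw [singPairing_lTensor_mulLeft hq, ← (hD.mulDist _).apply, ← hq, actK_T]
  show D (shift n (G * ofPoly p)) = D (shift n G * shift n (ofPoly p))
  rw [map_mul]

theorem expDist_comp_derivK {D : Dist V} (hD : RatSing D) (G : K) :
    expDist A.act (D ∘ₗ derivK) G =
      expDist A.act D (derivK G) + A.act del (expDist A.act D G) := by
  rw [expDist_act_apply, expDist_act_apply, expDist_act_apply, ← lift_act_lTensor_mulLeft,
    ← map_add]
  congr 1
  refine singKer_apply_of_eq fun p => ?_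
  obtain ⟨q, hq⟩ := exists_actK_ofPoly del p
  rw [map_add, LinearMap.add_apply, singPairing_lTensor_mulLeft hq, ← (hD.mulDist _).apply,
    ← (hD.mulDist _).apply, ← hq, actK_del]
  show D (derivK (G * ofPoly p)) = D (derivK G * ofPoly p) + D (G * derivK (ofPoly p))
  rw [derivK_mul, map_add, add_comm, mul_comm (ofPoly p)]

theorem Y_apply_eq (f g : V) (F : K) :
    A.Y f F g = expDist A.act (antipodal ((A.Y g).flip f)) F :=
  LinearMap.congr_fun (A.skew f g) F

theorem antipodal_flip_act (h : HatHT) (f g : V) :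
    antipodal ((A.Y (A.act h g)).flip f) = antipodal ((A.Y g).flip f) ∘ₗ actK h := by
  ext F
  show -(A.Y (A.act h g) (antipodeK F) f) = -(A.Y g (antipodeK (actK h F)) f)
  rw [antipodeK_actK, Y_actK_antipode]

/-- Skew-symmetry exchanges the two arguments and so carries covariance from the left one to the
right one. -/
theorem Y_apply_act_T (f g : V) (n : ℤ) (F : K) :
    A.Y f F (A.act (T n) g) = A.act (T n) (A.Y f (shift n F) g) := by
  rw [Y_apply_eq, antipodal_flip_act, A.Y_apply_eq f g,
    ← A.expDist_comp_shift (A.isField g f).antipodal]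
  congr 2
  ext G
  exact congrArg (antipodal ((A.Y g).flip f)) (actK_T n G)

theorem Y_apply_act_del (f g : V) (F : K) :
    A.Y f F (A.act del g) = A.Y f (derivK F) g + A.act del (A.Y f F g) := by
  rw [Y_apply_eq, antipodal_flip_act, A.Y_apply_eq f g, A.Y_apply_eq f g,
    ← A.expDist_comp_derivK (A.isField g f).antipodal]
  congr 2
  ext G
  exact congrArg (antipodal ((A.Y g).flip f)) (actK_del G)

/-- The kernel of the singular part of `α(h) Y(g,τ) 1_V`. -/
def vacKer (g : V) : HatHT →ₗ[ℂ] V ⊗[ℂ] HatHT where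
  toFun h := singKer (mulDist (alpha h) ((A.Y g).flip A.vac))
  map_add' h h' := by rw [map_add, mulDist_add_left, map_add]
  map_smul' c h := by rw [map_smul, mulDist_smul_left, map_smul, RingHom.id_apply]

theorem singPairing_vacKer (g : V) (h : HatHT) (p : ℂ[X]) :
    singPairing V (A.vacKer g h) p = A.Y g (alpha h * ofPoly p) A.vac :=
  ((A.isField g A.vac).mulDist (alpha h)).apply p |>.symm

/-- Tⁿ acts on both tensor factors and ∂, below, by the Leibniz rule. Thus `vacKer` is equivariant
for the coproduct, hence determined by its value at 1. -/
theorem vacKer_T_mul (g : V) (n : ℤ) (h : HatHT) : A.vacKer g (T n * h) =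
    (A.act (T n)).rTensor HatHT ((LinearMap.mulLeft ℂ (T n)).lTensor V (A.vacKer g h)) := by
  refine singPairing_injective (LinearMap.ext fun p => ?_)
  obtain ⟨q, hq⟩ := exists_actK_ofPoly (T n) p
  rw [singPairing_rTensor, singPairing_lTensor_mulLeft hq, singPairing_vacKer, singPairing_vacKer,
    ← Y_actK_vac, ← hq, alpha_mul, antipode_T, actK_T, actK_T, actK_T]
  congr 2
  rw [map_mul, ← AlgHom.comp_apply (shift (-n)) (shift n), ← shift_add, neg_add_cancel, shift_zero]
  rfl

theorem vacKer_del_mul (g : V) (h : HatHT) : A.vacKer g (del * h) =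
    (A.act del).rTensor HatHT (A.vacKer g h) +
      (LinearMap.mulLeft ℂ del).lTensor V (A.vacKer g h) := by
  refine singPairing_injective (LinearMap.ext fun p => ?_)
  obtain ⟨q, hq⟩ := exists_actK_ofPoly del p
  rw [map_add, LinearMap.add_apply, singPairing_rTensor, singPairing_lTensor_mulLeft hq,
    singPairing_vacKer, singPairing_vacKer, singPairing_vacKer, ← Y_actK_vac, ← hq,
    ← LinearMap.add_apply, ← map_add, alpha_mul, antipode_del, map_neg, LinearMap.neg_apply,
    LinearMap.neg_apply, actK_del, actK_del, actK_del, derivK_mul]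
  congr 2
  ring

/-- Up to a polynomial p/τ equals p(0)/τ, while Y(g,τ)1_V vanishes on polynomials and has value g at
1/τ. -/
theorem vacKer_one (g : V) : A.vacKer g 1 = g ⊗ₜ 1 := by
  refine singPairing_injective (LinearMap.ext fun p => ?_)
  have hu : IsUnit tau := by simpa using isUnit_tau_add 0
  have hC : ∀ c : ℂ, ofPoly (C c) = algebraMap ℂ K c := fun c => rfl
  have hX : ofPoly X = tau := rfl
  rw [singPairing_vacKer, singPairing_tmul', ← divX_mul_X_add p, alpha_one, map_add, map_add,
    mul_comm (divX p), pairing_X_mul, lam_one, map_zero, LinearMap.zero_apply, zero_add, mul_add,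
    map_mul ofPoly, hX, ← mul_assoc, Ring.inverse_mul_cancel tau hu, one_mul, map_add,
    LinearMap.add_apply, A.Y_poly_vac, zero_add, hC, mul_comm, ← Algebra.smul_def, map_smul,
    LinearMap.smul_apply, A.Y_const_vac, ← mul_one (C _), ← smul_eq_C_mul, map_smul, pairing_one,
    map_one, smul_eq_mul, mul_one]

/-- Translating τ₁ and τ₂ simultaneously leaves F(τ₁ - τ₂) unchanged; `prodLeft_del` is the
infinitesimal form. -/
theorem prodLeft_T (f : V) (F : K) (n : ℤ) (κ : V ⊗[ℂ] HatHT) :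
    prodLeft (A.Y f) (0, F)
      ((A.act (T n)).rTensor HatHT ((LinearMap.mulLeft ℂ (T n)).lTensor V κ)) =
      A.act (T n) (prodLeft (A.Y f) (0, F) κ) := by
  induction κ using TensorProduct.induction_on with
  | zero => simp
  | tmul w h =>
    rw [LinearMap.lTensor_tmul, LinearMap.rTensor_tmul, prodLeft_inr_tmul, prodLeft_inr_tmul,
      Y_apply_act_T, LinearMap.mulLeft_apply, map_mul, actK_mul, antipode_T, actK_T,
      ← AlgHom.comp_apply, ← shift_add, add_neg_cancel, shift_zero]
    rfl
  | add x y hx hy => simp only [map_add, hx, hy]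

theorem prodLeft_del (f : V) (F : K) (κ : V ⊗[ℂ] HatHT) :
    prodLeft (A.Y f) (0, F) ((A.act del).rTensor HatHT κ + (LinearMap.mulLeft ℂ del).lTensor V κ) =
      A.act del (prodLeft (A.Y f) (0, F) κ) := by
  induction κ using TensorProduct.induction_on with
  | zero => simp
  | tmul w h =>
    rw [LinearMap.lTensor_tmul, LinearMap.rTensor_tmul, map_add, prodLeft_inr_tmul,
      prodLeft_inr_tmul, prodLeft_inr_tmul, Y_apply_act_del, LinearMap.mulLeft_apply,
      map_mul antipode, actK_mul, antipode_del, map_neg, LinearMap.neg_apply, actK_del, map_neg,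
      LinearMap.neg_apply]
    abel
  | add x y hx hy =>
    simp only [map_add] at hx hy ⊢
    rw [← hx, ← hy]; abel

theorem prodLeft_vacKer_mul (f g : V) (F : K) (h h' : HatHT) :
    prodLeft (A.Y f) (0, F) (A.vacKer g (h * h')) =
      A.act h (prodLeft (A.Y f) (0, F) (A.vacKer g h')) := by
  induction h using hatHT_induction generalizing h' with
  | hT n => rw [vacKer_T_mul, prodLeft_T]
  | hdel => rw [vacKer_del_mul, prodLeft_del]
  | hadd x y hx hy => simp only [add_mul, map_add, LinearMap.add_apply, hx, hy]
  | hmul x y hx hy => rw [mul_assoc, hx, hy, act_mul_apply]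
  | hsmul c x hx => simp only [smul_mul_assoc, map_smul, LinearMap.smul_apply, hx]

/-- Since f(τ)1_V has no singular part, the second term of the product drops out. A polynomial G
gives 0 on both sides; for G = α(h), equivariance reduces to h = 1, where the kernel g ⊗ 1 yields
f_{F}g. -/
theorem nprod_apply_vac (f g : V) (F G : K) :
    nprod (A.Y f) (0, F) (A.Y g) G A.vac = A.Y (A.Y f F g) G A.vac := by
  obtain ⟨p, hp⟩ := exists_eq_ofPoly_add_alpha G
  have h0 : singKer ((A.Y f).flip A.vac) = 0 := singKer_eq_zero (A.Y_poly_vac f)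
  have h1 : singKer (mulDist (ofPoly p) ((A.Y g).flip A.vac)) = 0 := singKer_eq_zero fun q => by
    rw [mulDist_apply, ← map_mul]; exact A.Y_poly_vac g _
  have h2 := A.prodLeft_vacKer_mul f g F (singCoord G) 1
  rw [mul_one, vacKer_one, prodLeft_inr_tmul, map_one antipode, map_one actK,
    Module.End.one_apply] at h2
  rw [nprod_apply, h0, map_zero, sub_zero, Y_apply_vac, ← h2]
  conv_lhs => rw [hp, mulDist_add_left, map_add, h1, zero_add]
  rfl

/-- Associativity for components in `K`. -/
theorem Y_Y_apply (f g : V) (F : K) : A.Y (A.Y f F g) = nprod (A.Y f) (0, F) (A.Y g) :=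
  (A.eq_Y_of_apply_vac (isField_nprod (A.isField g) F)
    (fun h => (A.rational f g).nprod (A.isField f) (A.isField g) (A.rational f h) (A.rational g h) F)
    (A.nprod_apply_vac f g F)).symm

/-- The vertex operator of a component is the normal ordered product. -/
theorem Y_component (f g : V) (F : Comp) :
    A.Y (component (A.Y f) F g) = nprod (A.Y f) F (A.Y g) := by
  have hF : F = (F.1, 0) + (0, F.2) := by simp
  -- One polynomial replaces the functional part both in the component at g and in the product.
  obtain ⟨q, hq, hq'⟩ := exists_ofPoly_of_functional (A.isField f) (A.isField g) (A.rational f g) g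
    F.1
  rw [hF, component_add, LinearMap.add_apply, map_add, nprod_add_right, component_inr, hq, hq',
    Y_Y_apply, Y_Y_apply]

theorem Y_foldr_component (L : List (V × KHat)) :
    A.Y (L.foldr (fun p v => component (A.Y p.1) p.2 v) A.vac) =
      L.foldr (fun p D => nprod (A.Y p.1) p.2 D) idField := by
  induction L with
  | nil => exact A.Y_vac
  | cons p L ih => rw [List.foldr_cons, List.foldr_cons, Y_component, ih]

end HTVertexAlgebra

/-! ### The delta distribution and Newton's expansion. -/

section Delta

/-- `A ⊗ B ↦ h(A) B`. -/
def actMul (h : HatHT) : K ⊗[ℂ] K →ₗ[ℂ] K := TensorProduct.lift ((LinearMap.mul ℂ K) ∘ₗ actK h)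

theorem actMul_tmul (h : HatHT) (A B : K) : actMul h (A ⊗ₜ B) = actK h A * B := rfl

theorem mulDelta_apply {W : Type*} [AddCommGroup W] [Module ℂ W] (D : Dist W) (h : HatHT)
    (z : K ⊗[ℂ] K) : mulDelta D h z = D (actMul h z) := rfl

theorem aeval_X_mul_apply {M : Type*} [AddCommGroup M] [Module ℂ M] (x : Module.End ℂ M)
    (q : ℂ[X]) (m : M) : aeval x (X * q) m = x (aeval x q m) := by
  rw [map_mul, Module.End.mul_apply, aeval_X]

theorem actMul_polyDiff_mul_tmul (h : HatHT) (q : ℂ[X]) (A B : K) :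
    actMul h (polyDiff q * (A ⊗ₜ B)) = actMul (aeval lam q h) (A ⊗ₜ B) := by
  induction q using Polynomial.induction_on generalizing A B with
  | C a =>
    simp only [polyDiff, aeval_C, ← Algebra.smul_def, map_smul, Module.algebraMap_end_apply,
      actMul_tmul, LinearMap.smul_apply, smul_mul_assoc]
  | add p q hp hq =>
    rw [map_add polyDiff, add_mul, map_add, hp, hq, map_add, LinearMap.add_apply]
    simp only [actMul_tmul, map_add, LinearMap.add_apply, add_mul]
  | monomial n a ih =>
    rw [pow_succ, ← mul_assoc, mul_comm _ X, polyDiff_X_mul, map_sub, ih, ih, aeval_X_mul_apply,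
      actMul_tmul, actMul_tmul, actMul_tmul, actK_tau_mul]
    ring

theorem actMul_polyDiff_mul (h : HatHT) (q : ℂ[X]) (z : K ⊗[ℂ] K) :
    actMul h (polyDiff q * z) = actMul (aeval lam q h) z := by
  induction z using TensorProduct.induction_on with
  | zero => rw [mul_zero, map_zero, map_zero]
  | tmul A B => exact actMul_polyDiff_mul_tmul h q A B
  | add x y hx hy => rw [mul_add, map_add, hx, hy, map_add]

/-- Tⁿ∂ᵏ lies in a Jordan block of λ with eigenvalue n and size k + 1. Hence each h₂δ(τ₁,τ₂) is
killed by a polynomial in τ₁ - τ₂. -/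
theorem exists_aeval_lam_eq_zero (h : HatHT) : ∃ p : ℂ[X], p ≠ 0 ∧ aeval lam p h = 0 := by
  induction h using AddMonoidAlgebra.induction_linear with
  | zero => exact ⟨1, one_ne_zero, map_zero _⟩
  | add f g hf hg =>
    obtain ⟨p, hp, h⟩ := hf
    obtain ⟨p', hp', h'⟩ := hg
    refine ⟨p * p', mul_ne_zero hp hp', ?_⟩
    have e1 : aeval lam (p * p') f = 0 := by
      rw [mul_comm, map_mul, Module.End.mul_apply, h, map_zero]
    have e2 : aeval lam (p * p') g = 0 := by rw [map_mul, Module.End.mul_apply, h', map_zero]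
    rw [map_add, e1, e2, add_zero]
  | single a r =>
    obtain ⟨n, k⟩ := a
    refine ⟨(X - C (n : ℂ)) ^ (k + 1), pow_ne_zero _ (X_sub_C_ne_zero _), ?_⟩
    induction k generalizing r with
    | zero => simp [lam_single_zero]
    | succ k ih =>
      rw [pow_succ, map_mul, Module.End.mul_apply]
      have : aeval lam (X - C (n : ℂ)) (AddMonoidAlgebra.single (n, k + 1) r) =
          (k + 1 : ℂ) • AddMonoidAlgebra.single (n, k) r := by
        rw [map_sub, LinearMap.sub_apply, aeval_X, aeval_C, Module.algebraMap_end_apply,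
          lam_single_succ, add_sub_cancel_left]
      rw [this, map_smul, ih, smul_zero]

theorem pairing_mul_eq (h : HatHT) (q r : ℂ[X]) :
    pairing h (q * r) = pairing (aeval lam q h) r := by
  induction q using Polynomial.induction_on generalizing h with
  | C a => rw [← smul_eq_C_mul, map_smul, aeval_C, Module.algebraMap_end_apply, map_smul]; rfl
  | add p q hp hq => rw [add_mul, map_add, hp, hq, map_add, LinearMap.add_apply, map_add]; rfl
  | monomial n a ih =>
    rw [pow_succ, ← mul_assoc, mul_comm _ X, mul_assoc, pairing_X_mul, aeval_X_mul_apply, ih,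
      Commute.aeval_apply (Commute.refl lam)]

theorem lam_T_one_mul (h : HatHT) : lam (T 1 * h) = T 1 * lam h + T 1 * h := by
  have : tau * alpha (T 1 * h) =
      actK (antipode (T 1)) (tau * alpha h) + actK (antipode (T 1)) (alpha h) := by
    have hs : shift (-1) tau = tau + algebraMap ℂ K (-1 : ℤ) := liftK_tau _ _
    rw [alpha_mul, antipode_T, actK_T, actK_T, map_mul, hs, Int.cast_neg, Int.cast_one, map_neg,
      map_one]
    ring
  rw [lam_apply, this, map_add, singCoord_actK_antipode, singCoord_actK_antipode, singCoord_alpha]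
  rfl

/-- λ behaves as a derivation with λ(T) = T, so Δ^{l+1} goes to (l + 1) T Δ^l, and T = Δ + 1. -/
theorem lam_pow_succ (l : ℕ) : lam ((T 1 - 1) ^ (l + 1)) =
    (l + 1 : ℂ) • ((T 1 - 1) ^ (l + 1) + (T 1 - 1) ^ l) := by
  have h1 : ∀ h, lam ((T 1 - 1) * h) = (T 1 - 1) * lam h + T 1 * h := by
    intro h
    rw [sub_mul, map_sub, lam_T_one_mul, one_mul]; ring
  have h2 : ∀ l : ℕ, (T 1 - 1) ^ (l + 1) + (T 1 - 1) ^ l = T 1 * (T 1 - 1) ^ l := fun l => by ring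
  induction l with
  | zero => rw [zero_add, pow_one, ← mul_one (T 1 - 1), h1, lam_one]; simp
  | succ l ih =>
    rw [pow_succ' _ (l + 1), h1, ih, h2, mul_smul_comm, ← pow_succ' _ (l + 1), h2, mul_left_comm,
      ← pow_succ', Nat.cast_succ]
    module

theorem Delta_natCast (l : ℕ) : Delta l = ((l.factorial : ℂ)⁻¹) • (T 1 - 1) ^ l := rfl

theorem Delta_zero : Delta ((0 : ℕ) : ℤ) = 1 := by
  rw [Delta_natCast]; simp

theorem lam_Delta_succ (l : ℕ) : lam (Delta ((l + 1 : ℕ) : ℤ)) =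
    (l + 1 : ℂ) • Delta ((l + 1 : ℕ) : ℤ) + Delta l := by
  have h1 : (l + 1 : ℂ) ≠ 0 := by exact_mod_cast Nat.succ_ne_zero l
  rw [Delta_natCast, Delta_natCast, map_smul, lam_pow_succ, Nat.factorial_succ, Nat.cast_mul,
    Nat.cast_succ, mul_inv, smul_add, smul_add, smul_smul, smul_smul, smul_smul]
  congr 2
  · ring
  · field_simp

theorem counit_Delta_succ (l : ℕ) : counit (Delta ((l + 1 : ℕ) : ℤ)) = 0 := by
  rw [Delta_natCast, map_smul, map_pow, map_sub, counit_T, map_one, sub_self, pow_succ, mul_zero,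
    smul_zero]

/-- This is the recursion τ(l + 1) = (τ - l) τ(l) at τ₁ - τ₂, with the negative terms moved across.
-/
theorem polyDiff_descPochhammer_succ (l : ℕ) (A B : K) :
    polyDiff (descPochhammer ℂ (l + 1)) * (A ⊗ₜ[ℂ] B) + polyDiff (descPochhammer ℂ l) *
      (A ⊗ₜ[ℂ] (tau * B + (l : ℂ) • B)) =
      polyDiff (descPochhammer ℂ l) * ((tau * A) ⊗ₜ[ℂ] B) := by
  have : descPochhammer ℂ (l + 1) = X * descPochhammer ℂ l - C (l : ℂ) * descPochhammer ℂ l := by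
    rw [descPochhammer_succ_right]; simp; ring
  rw [this, ← smul_eq_C_mul, TensorProduct.tmul_add, TensorProduct.tmul_smul, mul_add,
    mul_smul_comm, map_sub, map_smul]
  have h2 : (polyDiff (X * descPochhammer ℂ l) - (l : ℂ) • polyDiff (descPochhammer ℂ l)) *
      (A ⊗ₜ[ℂ] B) = polyDiff (X * descPochhammer ℂ l) * (A ⊗ₜ[ℂ] B) -
        (l : ℂ) • (polyDiff (descPochhammer ℂ l) * (A ⊗ₜ[ℂ] B)) := by
    rw [← smul_mul_assoc]; exact sub_mul (α := K ⊗[ℂ] K) _ _ _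
  rw [h2, polyDiff_X_mul]
  abel

/-- The partial sums of Newton's expansion of `(τ F)(τ₁)` in powers of `τ₁ - τ₂`. -/
theorem newton_sum_tau_mul (F : K) (N : ℕ) :
    (∑ l ∈ Finset.range (N + 1),
      polyDiff (descPochhammer ℂ l) * (1 ⊗ₜ[ℂ] actK (Delta l) (tau * F))) +
        polyDiff (descPochhammer ℂ (N + 1)) * (1 ⊗ₜ[ℂ] actK (Delta N) F) =
    (tau ⊗ₜ[ℂ] 1) * ∑ l ∈ Finset.range (N + 1),
      polyDiff (descPochhammer ℂ l) * (1 ⊗ₜ[ℂ] actK (Delta l) F) := by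
  have h : ∀ (l : ℕ) (B : K), (tau ⊗ₜ[ℂ] 1) * (polyDiff (descPochhammer ℂ l) * (1 ⊗ₜ[ℂ] B)) =
      polyDiff (descPochhammer ℂ l) * ((tau * 1) ⊗ₜ[ℂ] B) := by
    intro l B
    rw [mul_polyDiff_mul, Algebra.TensorProduct.tmul_mul_tmul, one_mul]
  induction N with
  | zero =>
    rw [zero_add, Finset.sum_range_one, Finset.sum_range_one, h, ← polyDiff_descPochhammer_succ,
      Delta_zero, map_one, Module.End.one_apply, Module.End.one_apply]
    simp [add_comm]
  | succ N ih =>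
    -- Of the two terms of λ(Δ[N+1]), the multiple of Δ[N+1] enters the recursion for falling
    -- factorials, and Δ[N] is the remainder in the induction hypothesis.
    rw [Finset.sum_range_succ, Finset.sum_range_succ _ (N + 1), mul_add, ← ih, h,
      ← polyDiff_descPochhammer_succ, actK_tau_mul (Delta ((N + 1 : ℕ) : ℤ)), lam_Delta_succ,
      map_add, map_smul, LinearMap.add_apply, LinearMap.smul_apply, ← add_assoc,
      TensorProduct.tmul_add _ _ (actK (Delta N) F), mul_add]
    push_cast
    abel

/-- Newton's expansion of a polynomial. -/
theorem exists_newton (a : ℂ[X]) : ∃ N₀ : ℕ, ∀ N ≥ N₀, actK (Delta N) (ofPoly a) = 0 ∧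
    ofPoly a ⊗ₜ[ℂ] (1 : K) = ∑ l ∈ Finset.range N,
      polyDiff (descPochhammer ℂ l) * (1 ⊗ₜ[ℂ] actK (Delta l) (ofPoly a)) := by
  induction a using Polynomial.induction_on with
  | C c =>
    have h0 : ∀ l : ℕ, actK (Delta ((l + 1 : ℕ) : ℤ)) (ofPoly (C c)) = 0 := by
      intro l
      have : ofPoly (C c) = c • 1 := Algebra.algebraMap_eq_smul_one c
      rw [this, map_smul, actK_one, counit_Delta_succ, map_zero, smul_zero]
    refine ⟨1, fun N hN => ?_⟩
    obtain ⟨N, rfl⟩ := Nat.exists_eq_add_of_le' hN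
    refine ⟨h0 N, ?_⟩
    rw [Finset.sum_range_succ', Finset.sum_eq_zero fun l _ => by
      rw [h0, TensorProduct.tmul_zero, mul_zero]]
    have : ofPoly (C c) = c • 1 := Algebra.algebraMap_eq_smul_one c
    rw [zero_add, Delta_zero, descPochhammer_zero, map_one, map_one, one_mul,
      Module.End.one_apply, this, TensorProduct.smul_tmul]
  | add p q hp hq =>
    obtain ⟨N₁, h₁⟩ := hp
    obtain ⟨N₂, h₂⟩ := hq
    refine ⟨max N₁ N₂, fun N hN => ?_⟩
    obtain ⟨e1, e2⟩ := h₁ N (le_of_max_le_left hN)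
    obtain ⟨e3, e4⟩ := h₂ N (le_of_max_le_right hN)
    refine ⟨by rw [map_add, map_add, e1, e3, add_zero], ?_⟩
    rw [map_add, TensorProduct.add_tmul, e2, e4, ← Finset.sum_add_distrib]
    refine Finset.sum_congr rfl fun l _ => ?_
    rw [map_add, TensorProduct.tmul_add, mul_add]
  | monomial n c ih =>
    obtain ⟨N₀, h⟩ := ih
    have hX : ofPoly X = tau := rfl
    -- A factor τ raises the degree, hence the bound, by one. The vanishing of Δ[N] is carried along
    -- because it removes the remainder of the Newton sum.
    refine ⟨N₀ + 1, fun N hN => ?_⟩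
    obtain ⟨N, rfl⟩ := Nat.exists_eq_add_of_le' (Nat.one_le_of_lt hN)
    obtain ⟨e1, -⟩ := h N (by omega)
    obtain ⟨e2, e3⟩ := h (N + 1) (by omega)
    rw [pow_succ, ← mul_assoc, mul_comm _ X, map_mul ofPoly X, hX]
    refine ⟨?_, ?_⟩
    · rw [actK_tau_mul, lam_Delta_succ, map_add, map_smul, LinearMap.add_apply,
        LinearMap.smul_apply, e1, e2, mul_zero, smul_zero, add_zero, add_zero]
    · have := newton_sum_tau_mul (ofPoly (C c * X ^ n)) N
      rw [e1, TensorProduct.tmul_zero, mul_zero, add_zero, ← e3,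
        Algebra.TensorProduct.tmul_mul_tmul, one_mul] at this
      exact this.symm

/-- On the diagonal, h acting in τ₁ on q(τ₁ - τ₂) leaves the constant (hq)(0) = ⟨h, q⟩. -/
theorem actMul_polyDiff_one_tmul (h : HatHT) (q : ℂ[X]) (B : K) :
    actMul h (polyDiff q * (1 ⊗ₜ B)) = pairing h q • B := by
  rw [actMul_polyDiff_mul, actMul_tmul, actK_one, ← Algebra.smul_def, ← mul_one q, pairing_mul_eq,
    pairing_one, mul_one]

/-- Newton's expansion of the action of `Ĥ_T` on polynomials. -/
theorem actK_eq_sum_Delta (h : HatHT) {a : ℂ[X]} {N : ℕ} (hN : ofPoly a ⊗ₜ[ℂ] (1 : K) =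
    ∑ l ∈ Finset.range N,
      polyDiff (descPochhammer ℂ l) * (1 ⊗ₜ[ℂ] actK (Delta l) (ofPoly a))) :
    actK h (ofPoly a) =
      ∑ l ∈ Finset.range N, pairing h (descPochhammer ℂ l) • actK (Delta l) (ofPoly a) := by
  have := congrArg (actMul h) hN
  rw [actMul_tmul, mul_one, map_sum] at this
  simpa only [actMul_polyDiff_one_tmul] using this

end Delta

/-! ### Local distributions are determined on ℂ[τ] ⊗ K. -/

section Uniqueness

variable {V : Type*} [AddCommGroup V] [Module ℂ V]

theorem aeval_funLeft_apply {ι W : Type*} [AddCommGroup W] [Module ℂ W] {σ : ι → ι} (j : K → ι)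
    (h : ∀ A, σ (j A) = j (tau * A)) (H : K →ₗ[ℂ] W) (t : ι → W) (ht : ∀ A, t (j A) = H A)
    (p : ℂ[X]) (A : K) : aeval (LinearMap.funLeft ℂ W σ) p t (j A) = H (ofPoly p * A) := by
  induction p using Polynomial.induction_on generalizing A with
  | C a =>
    have : ofPoly (C a) = algebraMap ℂ K a := rfl
    simp [ht, this, ← Algebra.smul_def]
  | add p q hp hq =>
    simp only [map_add, LinearMap.add_apply, Pi.add_apply, hp, hq, add_mul]
  | monomial n a ih =>
    have hX : ofPoly X = tau := rfl
    rw [pow_succ, ← mul_assoc, mul_comm _ X, aeval_X_mul_apply, LinearMap.funLeft_apply, h, ih,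
      map_mul ofPoly X, hX, mul_left_comm, mul_assoc]

/-- Distributions on `K ⊗ K` that are supported at finitely many diagonals `τ₁ - τ₂ = a` and are
rational in the second variable. -/
def LocalRational (E : K ⊗[ℂ] K →ₗ[ℂ] Module.End ℂ V) : Prop :=
  (∃ p : ℂ[X], p ≠ 0 ∧ ∀ z, E (polyDiff p * z) = 0) ∧
    ∀ A v, RatSing (LinearMap.applyₗ v ∘ₗ E ∘ₗ TensorProduct.mk ℂ K K A)

theorem LocalRational.sub {E E' : K ⊗[ℂ] K →ₗ[ℂ] Module.End ℂ V} (h : LocalRational E)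
    (h' : LocalRational E') : LocalRational (E - E') := by
  obtain ⟨⟨p, hp, hpE⟩, hr⟩ := h
  obtain ⟨⟨p', hp', hpE'⟩, hr'⟩ := h'
  refine ⟨⟨p * p', mul_ne_zero hp hp', fun z => ?_⟩, fun A v => (hr A v).sub (hr' A v)⟩
  rw [LinearMap.sub_apply, map_mul polyDiff, mul_assoc, hpE, mul_polyDiff_mul, hpE', sub_zero]

theorem LocalRational.add {E E' : K ⊗[ℂ] K →ₗ[ℂ] Module.End ℂ V} (h : LocalRational E)
    (h' : LocalRational E') : LocalRational (E + E') := by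
  obtain ⟨⟨p, hp, hpE⟩, hr⟩ := h
  obtain ⟨⟨p', hp', hpE'⟩, hr'⟩ := h'
  refine ⟨⟨p * p', mul_ne_zero hp hp', fun z => ?_⟩, fun A v => (hr A v).add (hr' A v)⟩
  rw [LinearMap.add_apply, map_mul polyDiff, mul_assoc, hpE, mul_polyDiff_mul, hpE', add_zero]

theorem LocalRational.sum {ι : Type*} {s : Finset ι} {E : ι → K ⊗[ℂ] K →ₗ[ℂ] Module.End ℂ V}
    (h : ∀ i, LocalRational (E i)) : LocalRational (∑ i ∈ s, E i) := by
  classical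
  induction s using Finset.induction_on with
  | empty => exact ⟨⟨1, one_ne_zero, fun z => rfl⟩, fun A v => RatSing.zero⟩
  | insert i s hi ih => rw [Finset.sum_insert hi]; exact (h i).add ih

theorem localRational_commutator {f g : Dist (Module.End ℂ V)} (hg : IsField g)
    (hfg : MutuallyRational f g) : LocalRational (commutator f g) :=
  ⟨hfg, fun A v => ((hg v).comp (f A)).sub (hg (f A v))⟩

theorem localRational_mulDelta {D : Dist (Module.End ℂ V)} (hD : IsField D) (h : HatHT) :
    LocalRational (mulDelta D h) := by
  obtain ⟨p, hp, hph⟩ := exists_aeval_lam_eq_zero h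
  have h0 : ∀ z, actMul 0 z = 0 := by
    intro z
    induction z using TensorProduct.induction_on with
    | zero => rw [map_zero]
    | tmul A B => rw [actMul_tmul, map_zero, LinearMap.zero_apply, zero_mul]
    | add x y hx hy => rw [map_add, hx, hy, add_zero]
  refine ⟨⟨p, hp, fun z => ?_⟩, fun A v => (hD v).mulDist (actK h A)⟩
  rw [mulDelta_apply, actMul_polyDiff_mul, hph, h0, map_zero]

/-- A local rational distribution on `K ⊗ K` is determined by its values on `ℂ[τ] ⊗ K`. -/
theorem LocalRational.eq_zero {E : K ⊗[ℂ] K →ₗ[ℂ] Module.End ℂ V} (hE : LocalRational E)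
    (h0 : ∀ (a : ℂ[X]) (B : K), E (ofPoly a ⊗ₜ B) = 0) : E = 0 := by
  obtain ⟨⟨p, hp, hpE⟩, hr⟩ := hE
  refine TensorProduct.ext' fun A₀ B₀ => LinearMap.ext fun v₀ => ?_
  obtain ⟨m, hm, b, hb⟩ := exists_ofPoly_mul_eq A₀
  let t₀ : K × K × V → V := fun z => E (z.1 ⊗ₜ z.2.1) z.2.2
  -- The first argument is restricted to polynomial multiples of A₀; multiplying these by m gives
  -- polynomials, where E vanishes.
  let L : (K × K × V → V) →ₗ[ℂ] (ℂ[X] × K × V → V) :=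
    LinearMap.funLeft ℂ V fun z => (ofPoly z.1 * A₀, z.2)
  let M₁ : Module.End ℂ (ℂ[X] × K × V → V) := LinearMap.funLeft ℂ V fun z => (X * z.1, z.2)
  let M₂ : Module.End ℂ (ℂ[X] × K × V → V) :=
    LinearMap.funLeft ℂ V fun z => (z.1, tau * z.2.1, z.2.2)
  have hL₁ : ∀ t, L (LinearMap.funLeft ℂ V (mulFst V) t) = M₁ (L t) := by
    intro t
    funext ⟨a, B, v⟩
    have hX : ofPoly X = tau := rfl
    show t (tau * (ofPoly a * A₀), B, v) = t (ofPoly (X * a) * A₀, B, v)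
    rw [map_mul, hX, mul_assoc]
  have hL₂ : ∀ t, L (LinearMap.funLeft ℂ V (mulSnd V) t) = M₂ (L t) := fun t => rfl
  have h1 : aeval M₁ m (L t₀) = 0 := by
    rw [← map_aeval_end L hL₁]
    funext ⟨a, B, v⟩
    refine (aeval_funLeft_apply (fun A => (A, B, v)) (fun _ => rfl)
      (LinearMap.applyₗ v ∘ₗ E ∘ₗ (TensorProduct.mk ℂ K K).flip B) t₀ (fun _ => rfl) m
      (ofPoly a * A₀)).trans ?_
    show E ((ofPoly m * (ofPoly a * A₀)) ⊗ₜ B) v = 0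
    rw [mul_left_comm, hb, ← map_mul, h0, LinearMap.zero_apply]
  have h2 : aeval (M₁ - M₂) p (L t₀) = 0 := by
    rw [← map_aeval_end (x := mulDiff V V) L (fun t => by
      rw [mulDiff, LinearMap.sub_apply, map_sub, hL₁, hL₂]; rfl)]
    have : aeval (mulDiff V V) p t₀ = 0 := by
      funext ⟨A, B, v⟩
      rw [aeval_mulDiff_apply v (LinearMap.applyₗ v ∘ₗ E) t₀ (fun _ _ => rfl), LinearMap.comp_apply,
        hpE, map_zero]
      rfl
    rw [this, map_zero]
  have hcomm : Commute M₁ (M₁ - M₂) :=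
    (Commute.refl _).sub_right (commute_funLeft fun i => rfl)
  -- From polynomials in τ₁ and in τ₁ - τ₂ comes one in τ₂ = τ₁ - (τ₁ - τ₂), and rationality in τ₂
  -- then forces vanishing.
  obtain ⟨R, hR, hRt⟩ := exists_aeval_sub_eq_zero hcomm (ne_zero_of_mem_translates hm) hp h1 h2
  rw [sub_sub_cancel, ← map_aeval_end L hL₂] at hRt
  have h3 := (hr A₀ v₀).eq_zero_of_mul hR fun B => by
    have := congrFun hRt (1, B, v₀)
    have e := aeval_funLeft_apply (σ := mulSnd V) (fun B => (ofPoly 1 * A₀, B, v₀)) (fun _ => rfl)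
      (LinearMap.applyₗ v₀ ∘ₗ E ∘ₗ TensorProduct.mk ℂ K K (ofPoly 1 * A₀)) t₀ (fun _ => rfl) R B
    rw [map_one ofPoly, one_mul] at e
    rw [← e]
    have e' : (L (aeval (LinearMap.funLeft ℂ V (mulSnd V)) R t₀)) (1, B, v₀) =
      aeval (LinearMap.funLeft ℂ V (mulSnd V)) R t₀ (ofPoly 1 * A₀, B, v₀) := rfl
    rw [map_one ofPoly, one_mul] at e'
    rw [← e', this]; rfl
  exact LinearMap.congr_fun h3 B₀

theorem LocalRational.ext {E E' : K ⊗[ℂ] K →ₗ[ℂ] Module.End ℂ V} (hE : LocalRational E)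
    (hE' : LocalRational E') (h : ∀ (a : ℂ[X]) (B : K), E (ofPoly a ⊗ₜ B) = E' (ofPoly a ⊗ₜ B)) :
    E = E' :=
  sub_eq_zero.1 ((hE.sub hE').eq_zero fun a B => by rw [LinearMap.sub_apply, h, sub_self])

end Uniqueness

/-! ### The commutator formulas. -/

theorem hasFinSum_of_eq_sum {ι W : Type*} [AddCommGroup W] {s : ι → W} {w : W} (t : Finset ι)
    (hs : ∀ i ∉ t, s i = 0) (hw : w = ∑ i ∈ t, s i) : HasFinSum s w := by
  have h : Function.support s ⊆ t := fun i hi => by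
    by_contra hc
    exact hi (hs i hc)
  exact ⟨t.finite_toSet.subset h, by rw [hw, finsum_eq_sum_of_support_subset s h]⟩

/-- This is the expansion of κ in the basis e_{n,k}. Allowing every t ⊇ s makes sums easy: the
supports of two summands are enlarged to their union. -/
theorem exists_singPairing_eq_sum {W : Type*} [AddCommGroup W] [Module ℂ W] (κ : W ⊗[ℂ] HatHT) :
    ∃ s : Finset (ℤ × ℕ), ∀ t ⊇ s,
      (∀ p ∉ t, TensorProduct.rid ℂ W ((eStar p).lTensor W κ) = 0) ∧
      ∀ q, singPairing W κ q =
        ∑ p ∈ t, pairing (e p) q • TensorProduct.rid ℂ W ((eStar p).lTensor W κ) := by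
  classical
  induction κ using TensorProduct.induction_on with
  | zero => exact ⟨∅, fun t _ => ⟨fun p _ => by simp, fun q => by simp⟩⟩
  | tmul w h =>
    refine ⟨(eBasis.repr h).support, fun t ht => ⟨fun p hp => ?_, fun q => ?_⟩⟩
    · have : eStar p h = 0 := Finsupp.notMem_support_iff.1 fun hc => hp (ht hc)
      rw [LinearMap.lTensor_tmul, this, TensorProduct.tmul_zero, map_zero]
    · have he : h = ∑ p ∈ t, eStar p h • e p := by
        conv_lhs => rw [← eBasis.linearCombination_repr h, Finsupp.linearCombination_apply,
          Finsupp.sum_of_support_subset _ ht (fun p c => c • eBasis p) (fun i _ => zero_smul _ _)]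
        refine Finset.sum_congr rfl fun p _ => ?_
        rw [eBasis, Module.Basis.mk_apply]; rfl
      have h2 : pairing h q = ∑ p ∈ t, eStar p h * pairing (e p) q := by
        conv_lhs => rw [he]
        simp only [map_sum, map_smul, LinearMap.sum_apply, LinearMap.smul_apply, smul_eq_mul]
      rw [singPairing_tmul', h2, Finset.sum_smul]
      refine Finset.sum_congr rfl fun p _ => ?_
      rw [LinearMap.lTensor_tmul, TensorProduct.rid_tmul, smul_smul, mul_comm]
  | add x y hx hy =>
    obtain ⟨s, hs⟩ := hx
    obtain ⟨s', hs'⟩ := hy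
    refine ⟨s ∪ s', fun t ht => ?_⟩
    obtain ⟨h1, h2⟩ := hs t (Finset.union_subset_left ht)
    obtain ⟨h1', h2'⟩ := hs' t (Finset.union_subset_right ht)
    refine ⟨fun p hp => by rw [map_add, map_add, h1 p hp, h1' p hp, add_zero], fun q => ?_⟩
    rw [map_add, LinearMap.add_apply, h2, h2', ← Finset.sum_add_distrib]
    refine Finset.sum_congr rfl fun p _ => ?_
    rw [map_add, map_add, smul_add]

namespace HTVertexAlgebra

variable {V : Type*} [AddCommGroup V] [Module ℂ V] (A : HTVertexAlgebra V)

theorem localRational_commutator (f g : V) : LocalRational (commutator (A.Y f) (A.Y g)) :=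
  HTVertex.localRational_commutator (A.isField g) (A.rational f g)

/-- The commutator formula on `ℂ[τ] ⊗ K`. -/
theorem commutator_ofPoly_tmul (f g : V) {a : ℂ[X]} {N : ℕ} (hN : ofPoly a ⊗ₜ[ℂ] (1 : K) =
    ∑ l ∈ Finset.range N,
      polyDiff (descPochhammer ℂ l) * (1 ⊗ₜ[ℂ] actK (Delta l) (ofPoly a))) (B : K) :
    commutator (A.Y f) (A.Y g) (ofPoly a ⊗ₜ B) = ∑ l ∈ Finset.range N,
      A.Y (A.Y f (ofPoly (descPochhammer ℂ l)) g) (actK (Delta l) (ofPoly a) * B) := by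
  have : ofPoly a ⊗ₜ[ℂ] B = (ofPoly a ⊗ₜ[ℂ] (1 : K)) * (1 ⊗ₜ[ℂ] B) := by
    rw [Algebra.TensorProduct.tmul_mul_tmul, mul_one, one_mul]
  rw [this, hN, Finset.sum_mul, map_sum]
  refine Finset.sum_congr rfl fun l _ => ?_
  -- Each Newton term has the form q(τ₁ - τ₂)(1 ⊗ B'), where the commutator is a product of fields
  -- and hence, by associativity, a vertex operator.
  rw [mul_assoc, Algebra.TensorProduct.tmul_mul_tmul, one_mul, Y_Y_apply,
    nprod_ofPoly (A.isField f) (A.isField g)]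

theorem hasFinSum_commutator_ofPoly_tmul (f g : V) (p : ℂ[X]) (B : K) :
    HasFinSum (fun l : ℕ => mulDelta (A.Y (A.Y f (ofPoly (descPochhammer ℂ l)) g)) (Delta l)
      (ofPoly p ⊗ₜ[ℂ] B)) (commutator (A.Y f) (A.Y g) (ofPoly p ⊗ₜ[ℂ] B)) := by
  obtain ⟨N, hN⟩ := exists_newton p
  refine hasFinSum_of_eq_sum (Finset.range N) (fun l hl => ?_)
    (A.commutator_ofPoly_tmul f g (hN N le_rfl).2 B)
  rw [mulDelta_apply, actMul_tmul, (hN l (by simpa using hl)).1, zero_mul, map_zero]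

/-- A finite sum of terms D(τ₂)h₂δ is local and rational in τ₂, as is the commutator, so the
identity on ℂ[τ] ⊗ K suffices. -/
theorem hasFinSum_commutator_descPochhammer (f g : V)
    (hfin : {l : ℕ | A.Y f (ofPoly (descPochhammer ℂ l)) g ≠ 0}.Finite) :
    HasFinSum (fun l : ℕ => mulDelta (A.Y (A.Y f (ofPoly (descPochhammer ℂ l)) g)) (Delta l))
      (commutator (A.Y f) (A.Y g)) := by
  have h0 : ∀ l ∉ hfin.toFinset, A.Y f (ofPoly (descPochhammer ℂ l)) g = 0 := by
    intro l hl
    simpa using hl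
  have h1 : ∀ l ∉ hfin.toFinset,
      mulDelta (A.Y (A.Y f (ofPoly (descPochhammer ℂ l)) g)) (Delta l) = 0 := by
    intro l hl
    rw [h0 l hl, map_zero]; exact LinearMap.zero_comp _
  refine hasFinSum_of_eq_sum hfin.toFinset h1 ((A.localRational_commutator f g).ext
    (LocalRational.sum fun l => localRational_mulDelta (A.isField _) _) fun a B => ?_)
  have h2 := (A.hasFinSum_commutator_ofPoly_tmul f g a B).2
  rw [← h2, LinearMap.sum_apply]
  refine finsum_eq_sum_of_support_subset _ fun l hl => ?_
  by_contra hc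
  refine hl ?_
  show mulDelta _ _ _ = 0
  rw [h1 l hc, LinearMap.zero_apply]

theorem component_eStar (f g : V) (p : ℤ × ℕ) : component (A.Y f) (eStar p, 0) g =
    TensorProduct.rid ℂ V ((eStar p).lTensor V (singKer ((A.Y f).flip g))) := by
  rw [component_apply, evalHat_inl]

/-- On ℂ[τ] ⊗ K, expand f_{τ(l)}g as the sum of ⟨e_p, τ(l)⟩ f_{e*_p}g in the Newton form of the
commutator. After interchanging the sums, the sum over l is the Newton expansion of e_p applied to
the polynomial (`actK_eq_sum_Delta`). Uniqueness extends the result to K ⊗ K. -/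
theorem hasFinSum_commutator_eStar (f g : V) :
    {p : ℤ × ℕ | component (A.Y f) (eStar p, 0) g ≠ 0}.Finite ∧
    HasFinSum (fun p : ℤ × ℕ => mulDelta (A.Y (component (A.Y f) (eStar p, 0) g)) (e p))
      (commutator (A.Y f) (A.Y g)) := by
  obtain ⟨s, hs⟩ := exists_singPairing_eq_sum (singKer ((A.Y f).flip g))
  obtain ⟨h0, hsum⟩ := hs s subset_rfl
  simp only [← component_eStar] at h0 hsum
  have hf : ∀ q, A.Y f (ofPoly q) g =
      ∑ p ∈ s, pairing (e p) q • component (A.Y f) (eStar p, 0) g := fun q => by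
    rw [← hsum, ← (A.isField f g).apply]; rfl
  refine ⟨s.finite_toSet.subset fun p hp => by_contra fun hc => hp (h0 p hc), ?_⟩
  refine hasFinSum_of_eq_sum s (fun p hp => ?_) ((A.localRational_commutator f g).ext
    (LocalRational.sum fun l => localRational_mulDelta (A.isField _) _) fun a B => ?_)
  · rw [h0 p hp, map_zero]; exact LinearMap.zero_comp _
  · obtain ⟨N, hN⟩ := exists_newton a
    have hN' := (hN N le_rfl).2
    have he : ∀ p, actK (e p) (ofPoly a) = _ := fun p => actK_eq_sum_Delta (e p) hN'
    rw [A.commutator_ofPoly_tmul f g hN', LinearMap.sum_apply]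
    simp only [mulDelta_apply, actMul_tmul, he, Finset.sum_mul, map_sum, hf,
      LinearMap.sum_apply, map_smul, smul_mul_assoc, LinearMap.smul_apply]
    exact Finset.sum_comm

end HTVertexAlgebra

end
end HTVertex

theorem mainTheorem9 {V : Type*} [AddCommGroup V] [Module ℂ V] (A : HTVertex.HTVertexAlgebra V) :
    (∀ (f g : V), ∀ F ∈ HTVertex.KHat,
      A.Y (HTVertex.component (A.Y f) F g) = HTVertex.nprod (A.Y f) F (A.Y g)) ∧
    (∀ L : List (V × HTVertex.KHat),
      A.Y (L.foldr (fun p v => HTVertex.component (A.Y p.1) p.2 v) A.vac) =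
        L.foldr (fun p D => HTVertex.nprod (A.Y p.1) p.2 D) HTVertex.idField) ∧
    (∀ f g : V,
      {p : ℤ × ℕ | HTVertex.component (A.Y f) (HTVertex.eStar p, 0) g ≠ 0}.Finite ∧
      HTVertex.HasFinSum
        (fun p : ℤ × ℕ => HTVertex.mulDelta
          (A.Y (HTVertex.component (A.Y f) (HTVertex.eStar p, 0) g)) (HTVertex.e p))
        (HTVertex.commutator (A.Y f) (A.Y g)) ∧
      (∀ (p : ℂ[X]) (B : HTVertex.K), HTVertex.HasFinSum
        (fun l : ℕ => HTVertex.mulDelta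
          (A.Y (A.Y f (HTVertex.ofPoly (descPochhammer ℂ l)) g)) (HTVertex.Delta l)
            (HTVertex.ofPoly p ⊗ₜ[ℂ] B))
        (HTVertex.commutator (A.Y f) (A.Y g) (HTVertex.ofPoly p ⊗ₜ[ℂ] B))) ∧
      ({l : ℕ | A.Y f (HTVertex.ofPoly (descPochhammer ℂ l)) g ≠ 0}.Finite →
        HTVertex.HasFinSum
          (fun l : ℕ => HTVertex.mulDelta
            (A.Y (A.Y f (HTVertex.ofPoly (descPochhammer ℂ l)) g)) (HTVertex.Delta l))
          (HTVertex.commutator (A.Y f) (A.Y g)))) :=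
  ⟨fun f g F _ => A.Y_component f g F, A.Y_foldr_component, fun f g =>
    ⟨(A.hasFinSum_commutator_eStar f g).1, (A.hasFinSum_commutator_eStar f g).2,
      A.hasFinSum_commutator_ofPoly_tmul f g, A.hasFinSum_commutator_descPochhammer f g⟩⟩
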